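/- **Model.** Let $p,r,\lambda>0$, $\alpha>r$, $\delta>r$. On a complete probability space, let claims arrive at the epochs $S_1<S_2<\dots$ of a Poisson process $N$ of rate $\lambda$, with i.i.d. nonnegative sizes $U_1,U_2,\dots$ of distribution $F$, independent of $N$. Put $Y_t=\sum_{i\le N(t)}U_i$ and let $\mathcal F_t$ be generated by $(Y_s)_{s\le t}$ and the null sets. Write $c(y)=p+ry\,1_{\{y\ge 0\}}+\alpha y\,1_{\{y<0\}}$. A dividend strategy is a predictable, nondecreasing, left-continuous process $L=(L_t)_{t\ge0}$ with right limits and $L_0=0$; with initial reserve $x$ it generates the controlled reserve $$R_t=x+\int_0^t c(R_s)\,ds-Y_t-L_t .$$ The ruin time is $T=\inf\{t\ge0: R_t\le -p/\alpha\}$. The strategy is admissible if dividends do not by themselves push the reserve strictly below the critical level: $L_{t+}-L_t\le \max(R_t+p/\alpha,0)$ for all $t\le T$. Its return is $V_L(x)=\mathbb E_x\big[\int_{[0,T]}e^{-\delta s}\,dL_s\big]$, where $dL$ has mass $L_{t+}-L_t$ at $t$, and the value function is $V(x)=\sup_L V_L(x)$ over all admissible $L$. **Band strategy.** For $x\ge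 -p/\alpha$ let $$\mathcal G_V(x)=c(x)-(\lambda+\delta)V(x)+\lambda\int_{[0,\,x+p/\alpha]}V(x-y)\,dF(y),$$ and let $\mathcal A=\{x\ge-p/\alpha:\mathcal G_V(x)=0\}$, $\mathcal B=\{x\ge-p/\alpha: V'(x)=1,\ \mathcal G_V(x)<0\}$, $\mathcal C=[-p/\alpha,\infty)\setminus(\mathcal A\cup\mathcal B)$. An admissible strategy $L^*$ with reserve $R$ is called a band strategy if almost surely, at every time $t\ge0$: (a) if $R_t\in\mathcal A$, then from $t$ on, for a short time, dividends are paid at the rate at which premium and interest come in: $dL^*_s=c(R_s)\,ds$; (b) if $R_t\in\mathcal B$, then a lump sum $L^*_{t+}-L^*_t=R_t-x_0$ is paid, where $x_0\in\mathcal A$, $x_0<R_t$ and $(x_0,R_t]\subset\mathcal B$ (so $x_0$ is the nearest point of $\mathcal A$ below $R_t$); (c) if $R_t\in\mathcal C$, then no dividends are paid at $t$ and for a short time after $t$. **Theorem 4.2.** For every $x\ge -p/\alpha$, the value $V(x)$ is finite, a band strategy $L^*$ with initial reserve $x$ exists, and every such strategy is optimal: $$V_{L^*}(x)=V(x).$$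 -/

import Mathlib

open MeasureTheory ProbabilityTheory Filter Topology Set
open scoped NNReal ENNReal

/-- The data of the compound Poisson risk model with credit and debit interest on a probability
space `(Ω, μ)`.  Claims arrive at the epochs of a Poisson process of rate `lam` (that is, the
waiting times between successive claims are i.i.d. exponential with parameter `lam`), the claim
sizes are i.i.d. and nonnegative, and are independent of the claim arrival process. -/
structure RiskModel {Ω : Type*} [MeasurableSpace Ω] (μ : Measure Ω) where
  /-- premium rate -/
  p : ℝ
  /-- force of credit interest -/
  r : ℝ
  /-- force of debit interest -/
  α : ℝ
  /-- force of discount -/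
  δ : ℝ
  /-- claim arrival intensity -/
  lam : ℝ
  p_pos : 0 < p
  r_pos : 0 < r
  r_lt_α : r < α
  r_lt_δ : r < δ
  lam_pos : 0 < lam
  /-- `W 0` is the arrival time of the first claim, `W (n + 1)` the waiting time between the
  claims with indices `n` and `n + 1` (claims are numbered from `0`) -/
  W : ℕ → Ω → ℝ
  /-- `U n` is the size of the claim with index `n` -/
  U : ℕ → Ω → ℝ
  measurable_W : ∀ n, Measurable (W n)
  measurable_U : ∀ n, Measurable (U n)
  law_W : ∀ n, μ.map (W n) = expMeasure lam
  iIndep_W : iIndepFun W μ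
  U_nonneg : ∀ n, ∀ᵐ ω ∂μ, 0 ≤ U n ω
  identDistrib_U : ∀ n, IdentDistrib (U n) (U 0) μ μ
  iIndep_U : iIndepFun U μ
  indep_W_U : IndepFun (fun ω n => W n ω) (fun ω n => U n ω) μ

namespace RiskModel

variable {Ω : Type*} [MeasurableSpace Ω] {μ : Measure Ω}

/-- The claim size distribution `F`. -/
noncomputable def claimLaw (M : RiskModel μ) : Measure ℝ := μ.map (M.U 0)

/-- The arrival epoch of the claim with index `n`. -/
noncomputable def claimTime (M : RiskModel μ) (n : ℕ) (ω : Ω) : ℝ :=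
  ∑ k ∈ Finset.range (n + 1), M.W k ω

/-- The aggregate claims `Y_t = ∑_{i ≤ N(t)} U_i`, where `N(t)` is the number of claim epochs in
`[0, t]` (almost surely finite for every `t`, so that the series below is a finite sum). -/
noncomputable def aggregateClaims (M : RiskModel μ) (t : ℝ) (ω : Ω) : ℝ :=
  ∑' n, if M.claimTime n ω ≤ t then M.U n ω else 0

/-- The critical value `-p/α`. -/
noncomputable def critical (M : RiskModel μ) : ℝ := -(M.p / M.α)

/-- The rate `p + r y 1_{y ≥ 0} + α y 1_{y < 0}` of premium plus interest at reserve level `y`. -/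
noncomputable def drift (M : RiskModel μ) (y : ℝ) : ℝ :=
  M.p + if 0 ≤ y then M.r * y else M.α * y

theorem measurable_claimTime (M : RiskModel μ) (n : ℕ) : Measurable (M.claimTime n) :=
  Finset.measurable_fun_sum _ fun k _ => M.measurable_W k

theorem measurable_aggregateClaims (M : RiskModel μ) (t : ℝ) :
    Measurable (M.aggregateClaims t) := by
  have h : ∀ n, Measurable fun ω => if M.claimTime n ω ≤ t then M.U n ω else 0 := fun n =>
    Measurable.ite (measurableSet_le (M.measurable_claimTime n) measurable_const)
      (M.measurable_U n) measurable_const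
  exact Measurable.tsum h

/-- The natural filtration of the aggregate claims, augmented by all null sets:
`ℱ_t = σ(Y_s, s ≤ t) ∨ 𝒩`. -/
noncomputable def filtration (M : RiskModel μ) [μ.IsComplete] : Filtration ℝ≥0 ‹MeasurableSpace Ω› where
  seq t := (⨆ s : Set.Iic t, MeasurableSpace.comap (M.aggregateClaims ((s : ℝ≥0) : ℝ)) inferInstance) ⊔
    MeasurableSpace.generateFrom {N : Set Ω | μ N = 0}
  mono' t t' h := by
    refine sup_le_sup_right (iSup_le fun s => ?_) _
    exact le_iSup (fun s : Set.Iic t' =>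
      MeasurableSpace.comap (M.aggregateClaims ((s : ℝ≥0) : ℝ)) inferInstance)
      ⟨s, (show (s : ℝ≥0) ≤ t from s.2).trans h⟩
  le' t := by
    refine sup_le (iSup_le fun s => ?_) (MeasurableSpace.generateFrom_le fun N hN => ?_)
    · exact (M.measurable_aggregateClaims _).comap_le
    · exact Measure.IsComplete.out' N hN

variable [μ.IsComplete]

/-- An admissible dividend strategy `L` for initial reserve `x`, together with the (unstopped)
controlled reserve `R` it generates.  `L t` is the amount paid out before time `t`; the lump sum
paid at time `t` is `L_{t+} - L_t`, and `R t` is the reserve at time `t` after a possible claim at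
`t` and before a possible lump sum dividend at `t`.  Paths are extended by `L t = 0` to `t < 0`. -/
structure Strategy (M : RiskModel μ) (x : ℝ) where
  L : ℝ → Ω → ℝ
  R : ℝ → Ω → ℝ
  predictable : IsStronglyPredictable M.filtration fun (t : ℝ≥0) ω => L (t : ℝ) ω
  mono : ∀ ω, Monotone fun t => L t ω
  leftCont : ∀ ω t, ContinuousWithinAt (fun t => L t ω) (Set.Iic t) t
  eq_zero : ∀ ω, ∀ t ≤ 0, L t ω = 0
  /-- `dR = drift(R) dt - dY - dL`, `R_0 = x` -/
  dynamics : ∀ᵐ ω ∂μ, ∀ t, 0 ≤ t →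
    IntervalIntegrable (fun u => M.drift (R u ω)) volume 0 t ∧
    R t ω = x + (∫ u in (0 : ℝ)..t, M.drift (R u ω)) - M.aggregateClaims t ω - L t ω
  /-- Until ruin, a lump sum dividend never takes the reserve strictly below the critical value
  (and nothing is paid at an instant at which the reserve is already at or below it). -/
  no_ruin : ∀ᵐ ω ∂μ, ∀ t, 0 ≤ t → (∀ s ∈ Set.Ico 0 t, M.critical < R s ω) →
    Function.rightLim (fun t => L t ω) t - L t ω ≤ max (R t ω - M.critical) 0

namespace Strategy

variable {M : RiskModel μ} {x : ℝ}

/-- The time of ruin `T = inf {t ≥ 0 : R_t ≤ -p/α}` (`∞` if there is no such `t`). -/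
noncomputable def ruinTime (S : M.Strategy x) (ω : Ω) : ℝ≥0∞ :=
  ⨅ (t : ℝ) (_ : 0 ≤ t ∧ S.R t ω ≤ M.critical), ENNReal.ofReal t

/-- The return `V_L(x) = E_x [∫_{[0,T]} e^{-δ s} dL_s]`, where `dL` is the Lebesgue-Stieltjes
measure of the path of `L`, of mass `L_{t+} - L_t` at `t`. -/
noncomputable def payoff (S : M.Strategy x) : ℝ≥0∞ :=
  ∫⁻ ω, ∫⁻ t in {t : ℝ | 0 ≤ t ∧ ENNReal.ofReal t ≤ S.ruinTime ω},
    ENNReal.ofReal (Real.exp (-M.δ * t)) ∂(S.mono ω).stieltjesFunction.measure ∂μ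

end Strategy

/-- The value function, as an extended nonnegative number: the supremum of the returns of all
admissible strategies. -/
noncomputable def value (M : RiskModel μ) (x : ℝ) : ℝ≥0∞ := ⨆ S : M.Strategy x, S.payoff

/-- The value function as a real function on the line. -/
noncomputable def V (M : RiskModel μ) (x : ℝ) : ℝ := (M.value x).toReal

/-- `𝒢_V(x) = p + r x 1_{x ≥ 0} + α x 1_{x < 0} - (λ + δ) V(x) + λ ∫_{[0, x + p/α]} V(x - y) dF(y)`. -/
noncomputable def GV (M : RiskModel μ) (x : ℝ) : ℝ :=
  M.drift x - (M.lam + M.δ) * M.V x +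
    M.lam * ∫ y in Set.Icc 0 (x - M.critical), M.V (x - y) ∂M.claimLaw

/-- `𝒜 = {𝒢_V = 0}` -/
def setA (M : RiskModel μ) : Set ℝ := {x | M.critical ≤ x ∧ M.GV x = 0}

/-- `ℬ = {V' = 1, 𝒢_V < 0}` -/
def setB (M : RiskModel μ) : Set ℝ := {x | M.critical ≤ x ∧ HasDerivAt M.V 1 x ∧ M.GV x < 0}

/-- `𝒞` is the rest of `[-p/α, ∞)`. -/
def setC (M : RiskModel μ) : Set ℝ := {x | M.critical ≤ x ∧ x ∉ M.setA ∧ x ∉ M.setB}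

/-- `S` is the band strategy determined by `𝒜`, `ℬ`, `𝒞`: almost surely, at every time `t`,
* if the reserve is in `𝒜`, then dividends are paid from `t` on at the rate at which premium and
  interest come in, `dL_s = drift(R_s) ds`;
* if the reserve is in `ℬ`, then a lump sum is paid that takes it down to the point `x₀` of `𝒜`
  with `(x₀, R_t] ⊆ ℬ` (so `x₀` is the nearest point of `𝒜` below `R_t`);
* if the reserve is in `𝒞`, then nothing is paid at `t` and for a short time after `t`. -/
def Strategy.IsBand {M : RiskModel μ} {x : ℝ} (S : M.Strategy x) : Prop :=
  ∀ᵐ ω ∂μ, ∀ t, 0 ≤ t →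
    (S.R t ω ∈ M.setA →
      ∀ᶠ s in 𝓝[>] t, S.L s ω - S.L t ω = ∫ u in t..s, M.drift (S.R u ω)) ∧
    (S.R t ω ∈ M.setB → ∃ x₀ ∈ M.setA, x₀ < S.R t ω ∧ Set.Ioc x₀ (S.R t ω) ⊆ M.setB ∧
      Function.rightLim (fun u => S.L u ω) t - S.L t ω = S.R t ω - x₀) ∧
    (S.R t ω ∈ M.setC → ∀ᶠ s in 𝓝[>] t, S.L s ω = S.L t ω)

end RiskModel

/-! The value function is identified with the least supersolution of the Hamilton-Jacobi-Bellman
equation, and the optimality of band strategies is read off from minimality.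

A supersolution (`IsSuper`) vanishes at and below the critical level, gains at least one per unit of
reserve, and does not gain on average while one waits without paying. The last condition is
integrated along the dividend-free flow. No derivative is needed, and all three conditions survive
infima. The function `explicitSuper`, whose construction uses `r < δ`, shows that the class is
nonempty and controls the growth of its infimum `minSuper`.

Upper bound. Between two claims, and before ruin, discounted value plus discounted dividends minus
the compensator of the claims is nonincreasing for every reserve path, because its upper right Dini
derivatives are nonpositive (`balance_le`). In expectation the compensator equals the loss of value
at the claims (`lintegral_next_epoch`), so the sum over the claims telescopes (`payoff_le`). The
compensation formula needs a predictable version of the reserve. It is recovered from dividends and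
claims by Picard iteration.

Lower bound. The generator of `minSuper` is nonpositive. Where it is negative, `minSuper` either has
slope one in a neighbourhood or satisfies the flow equation to the right (`minSuper_dichotomy`).
This holds because the maximum of a line of slope one and a flow solution, inserted on a short
interval, is again a supersolution and lies below (`isSuper_lowered`). It follows that `𝒜` is
closed, `ℬ` is open, the rest is open to the right, and below each point of `ℬ` a stretch of `ℬ`
leads down to a point of `𝒜`. Along a band strategy the inequalities of the upper bound become
equalities: in `𝒜` because the generator vanishes and all income is paid, in `ℬ` because of slope
one, elsewhere because of the flow equation. The discounted value is of order `exp (-(δ - r) t)`, so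
nothing is lost at infinity. Hence `V = minSuper`, and band strategies attain it.

Existence. The strategy is written down explicitly between claims and glued at the claims. The
delicate point is predictability with respect to the aggregate claims alone. Two scenarios with the
same aggregate claims up to `t` have the same controlled path up to `t` (`eq_of_strictBandRule`), so
the dividends are a function of the observed claims. This function is measurable because, on a
standard Borel space, a Borel set that is a union of fibres of a Borel map is the preimage of a
Borel set. Left continuity then gives predictability. -/

set_option linter.unusedSectionVars false

namespace RiskModel

/-! ### The rate of premium and interest. -/

section Drift

variable {Ω : Type*} [MeasurableSpace Ω] {μ : Measure Ω} (M : RiskModel μ)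

theorem α_pos : 0 < M.α := M.r_pos.trans M.r_lt_α

theorem δ_pos : 0 < M.δ := M.r_pos.trans M.r_lt_δ

theorem critical_neg : M.critical < 0 := neg_neg_of_pos (div_pos M.p_pos M.α_pos)

theorem α_mul_critical : M.α * M.critical = -M.p := by
  have := M.α_pos.ne'
  unfold critical
  field_simp

/-- As `r < α`, the broken line is the lower envelope of its two branches. Monotonicity, the
Lipschitz constant `α` and the two affine upper bounds all come from here. -/
theorem drift_eq_min (y : ℝ) : M.drift y = min (M.p + M.r * y) (M.p + M.α * y) := by
  unfold drift
  have := M.r_lt_α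
  split_ifs with h
  · rw [min_eq_left]; nlinarith
  · rw [min_eq_right]; nlinarith

theorem continuous_drift : Continuous M.drift := by
  have : M.drift = fun y => min (M.p + M.r * y) (M.p + M.α * y) := funext M.drift_eq_min
  rw [this]
  fun_prop

theorem monotone_drift : Monotone M.drift := by
  intro a b h
  rw [M.drift_eq_min, M.drift_eq_min]
  exact min_le_min (by nlinarith [M.r_pos]) (by nlinarith [M.α_pos])

theorem drift_sub_le {a b : ℝ} (h : a ≤ b) : M.drift b - M.drift a ≤ M.α * (b - a) := by
  have h1 := M.r_lt_α
  have h2 := M.r_pos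
  rw [M.drift_eq_min, M.drift_eq_min, sub_le_iff_le_add']
  rcases min_choice (M.p + M.r * a) (M.p + M.α * a) with h' | h' <;> rw [h']
  · exact (min_le_left _ _).trans (by nlinarith)
  · exact (min_le_right _ _).trans (by nlinarith)

theorem abs_drift_sub_le (a b : ℝ) : |M.drift a - M.drift b| ≤ M.α * |a - b| := by
  rcases le_total a b with h | h
  · rw [abs_sub_comm, abs_sub_comm a, abs_of_nonneg (sub_nonneg.2 (M.monotone_drift h)),
      abs_of_nonneg (sub_nonneg.2 h)]
    exact M.drift_sub_le h
  · rw [abs_of_nonneg (sub_nonneg.2 (M.monotone_drift h)), abs_of_nonneg (sub_nonneg.2 h)]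
    exact M.drift_sub_le h

theorem drift_le_α (y : ℝ) : M.drift y ≤ M.α * (y - M.critical) := by
  rw [M.drift_eq_min, mul_sub, M.α_mul_critical]
  exact (min_le_right _ _).trans (by linarith)

theorem drift_le_r (y : ℝ) : M.drift y ≤ M.p + M.r * y := by
  rw [M.drift_eq_min]
  exact min_le_left _ _

theorem drift_critical : M.drift M.critical = 0 := by
  have := M.critical_neg
  unfold drift
  rw [if_neg (by linarith), M.α_mul_critical]; ring

theorem drift_nonneg {y : ℝ} (h : M.critical ≤ y) : 0 ≤ M.drift y :=
  M.drift_critical ▸ M.monotone_drift h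

theorem drift_pos {y : ℝ} (h : M.critical < y) : 0 < M.drift y := by
  have h1 := M.p_pos
  have h2 := M.r_pos
  have h3 := M.α_pos
  have h4 := M.α_mul_critical
  rw [drift]
  split_ifs with h'
  · positivity
  · nlinarith

theorem drift_nonpos {y : ℝ} (h : y ≤ M.critical) : M.drift y ≤ 0 :=
  M.drift_critical ▸ M.monotone_drift h

end Drift

section Claims

variable {Ω : Type*} [MeasurableSpace Ω] {μ : Measure Ω} [IsProbabilityMeasure μ]
  (M : RiskModel μ)

instance isProbabilityMeasure_claimLaw : IsProbabilityMeasure M.claimLaw :=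
  Measure.isProbabilityMeasure_map (M.measurable_U 0).aemeasurable

theorem ae_claimLaw_nonneg : ∀ᵐ u ∂M.claimLaw, 0 ≤ u :=
  (ae_map_iff (M.measurable_U 0).aemeasurable measurableSet_Ici).2 (M.U_nonneg 0)

/-- The expected value of `w` after a claim that hits the reserve `x`. -/
noncomputable def afterClaim (w : ℝ → ℝ) (x : ℝ) : ℝ := ∫ u, w (x - u) ∂M.claimLaw

end Claims

/-! ### Discounting along the flow without dividends and claims. -/

section Discount

variable {Ω : Type*} [MeasurableSpace Ω] {μ : Measure Ω} (M : RiskModel μ)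

theorem continuousOn_inv_drift : ContinuousOn (fun t => 1 / M.drift t) (Ioi M.critical) :=
  continuousOn_const.div M.continuous_drift.continuousOn fun _ h => (M.drift_pos h).ne'

/-- The factor `exp (-(λ + δ) T x)`, where `T x` is the time at which a reserve that is at level
`0` at time `0` passes the level `x` when no claims occur and no dividends are paid. -/
noncomputable def levelDiscount (x : ℝ) : ℝ :=
  Real.exp (-(M.lam + M.δ) * ∫ t in (0 : ℝ)..x, 1 / M.drift t)

theorem levelDiscount_pos (x : ℝ) : 0 < M.levelDiscount x := Real.exp_pos _

theorem uIcc_subset_Ioi {a b c : ℝ} (ha : c < a) (hb : c < b) : uIcc a b ⊆ Ioi c :=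
  fun _ ht => (lt_min ha hb).trans_le ht.1

theorem hasDerivAt_levelDiscount {x : ℝ} (hx : M.critical < x) :
    HasDerivAt M.levelDiscount (-(M.lam + M.δ) / M.drift x * M.levelDiscount x) x := by
  have h1 : HasDerivAt (fun x => ∫ t in (0 : ℝ)..x, 1 / M.drift t) (1 / M.drift x) x := by
    refine intervalIntegral.integral_hasDerivAt_right ?_ ?_ ?_
    · exact (M.continuousOn_inv_drift.mono
        (uIcc_subset_Ioi M.critical_neg hx)).intervalIntegrable
    · exact M.continuousOn_inv_drift.stronglyMeasurableAtFilter isOpen_Ioi _ hx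
    · exact M.continuousOn_inv_drift.continuousAt (Ioi_mem_nhds hx)
  exact (h1.const_mul (-(M.lam + M.δ))).exp.congr_deriv (by rw [levelDiscount]; ring)

theorem continuousOn_levelDiscount : ContinuousOn M.levelDiscount (Ioi M.critical) :=
  fun _ hx => (M.hasDerivAt_levelDiscount hx).continuousAt.continuousWithinAt

end Discount

/-! ### Supersolutions in integrated form. -/

section Super

variable {Ω : Type*} [MeasurableSpace Ω] {μ : Measure Ω} (M : RiskModel μ)

/-- The rate, per unit of level, at which discounted claims are incurred on the way up. -/
noncomputable def claimRate (w : ℝ → ℝ) (t : ℝ) : ℝ :=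
  M.levelDiscount t * (M.lam * M.afterClaim w t) / M.drift t

/-- A supersolution of the Hamilton-Jacobi-Bellman equation of the dividend problem, in
integrated form. -/
structure IsSuper (w : ℝ → ℝ) : Prop where
  zero : ∀ x ≤ M.critical, w x = 0
  slope : ∀ x y, M.critical ≤ x → x ≤ y → y - x ≤ w y - w x
  -- For smooth `w` this says `drift · w' ≤ (λ + δ) w - λ I_w`, with `I_w` the expected value after
  -- a claim. The rate `λ + δ` combines discounting with the probability that no claim has occurred.
  flow : ∀ x y, M.critical < x → x ≤ y →
    M.levelDiscount y * w y + ∫ t in x..y, M.claimRate w t ≤ M.levelDiscount x * w x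

variable {M} {w : ℝ → ℝ}

theorem IsSuper.monotone (h : M.IsSuper w) : Monotone w := by
  intro x y hxy
  rcases le_total y M.critical with hy | hy
  · rw [h.zero x (hxy.trans hy), h.zero y hy]
  rcases le_total x M.critical with hx | hx
  · have := h.slope _ _ le_rfl hy
    rw [h.zero _ le_rfl] at this
    rw [h.zero x hx]; linarith
  · linarith [h.slope x y hx hxy]

theorem IsSuper.nonneg (h : M.IsSuper w) (x : ℝ) : 0 ≤ w x := by
  rw [← h.zero (min x M.critical) (min_le_right _ _)]
  exact h.monotone (min_le_left _ _)

variable [IsProbabilityMeasure μ]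

theorem integrable_afterClaim (hm : Monotone w) (h0 : ∀ x, 0 ≤ w x) (x : ℝ) :
    Integrable (fun u => w (x - u)) M.claimLaw := by
  refine Integrable.of_bound (C := w x)
    (hm.measurable.comp (measurable_const.sub measurable_id)).aestronglyMeasurable ?_
  filter_upwards [M.ae_claimLaw_nonneg] with u hu
  rw [Real.norm_of_nonneg (h0 _)]
  exact hm (by linarith)

theorem afterClaim_mono {v : ℝ → ℝ} (hm : Monotone w) (h0 : ∀ x, 0 ≤ w x) (hm' : Monotone v)
    (h0' : ∀ x, 0 ≤ v x) (h : ∀ x, v x ≤ w x) (x : ℝ) : M.afterClaim v x ≤ M.afterClaim w x :=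
  integral_mono (integrable_afterClaim hm' h0' x) (integrable_afterClaim hm h0 x) fun _ => h _

theorem monotone_afterClaim (hm : Monotone w) (h0 : ∀ x, 0 ≤ w x) :
    Monotone (M.afterClaim w) := fun x y hxy =>
  integral_mono (integrable_afterClaim hm h0 x) (integrable_afterClaim hm h0 y) fun _ =>
    hm (by linarith)

theorem afterClaim_nonneg (h0 : ∀ x, 0 ≤ w x) (x : ℝ) : 0 ≤ M.afterClaim w x :=
  integral_nonneg fun _ => h0 _

theorem afterClaim_le (hm : Monotone w) (h0 : ∀ x, 0 ≤ w x) (x : ℝ) :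
    M.afterClaim w x ≤ w x := by
  have : M.afterClaim w x ≤ ∫ _, w x ∂M.claimLaw := by
    refine integral_mono_ae (integrable_afterClaim hm h0 x) (integrable_const _) ?_
    filter_upwards [M.ae_claimLaw_nonneg] with u hu
    exact hm (by linarith)
  simpa using this

theorem continuous_afterClaim (hm : Monotone w) (h0 : ∀ x, 0 ≤ w x) (hc : Continuous w) :
    Continuous (M.afterClaim w) := by
  rw [continuous_iff_continuousAt]
  intro x
  refine tendsto_integral_filter_of_dominated_convergence (fun _ => w (x + 1)) ?_ ?_
    (integrable_const _) ?_
  · exact Eventually.of_forall fun y => (integrable_afterClaim hm h0 y).aestronglyMeasurable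
  · filter_upwards [Iio_mem_nhds (lt_add_one x)] with y hy
    filter_upwards [M.ae_claimLaw_nonneg] with u hu
    rw [Real.norm_of_nonneg (h0 _)]
    exact hm (by linarith [mem_Iio.1 hy])
  · exact Eventually.of_forall fun u => (hc.tendsto _).comp (tendsto_id.sub_const u)

theorem intervalIntegrable_claimRate (hm : Monotone w) (h0 : ∀ x, 0 ≤ w x) {x y : ℝ}
    (hx : M.critical < x) (hy : M.critical < y) :
    IntervalIntegrable (M.claimRate w) volume x y := by
  have h1 : IntervalIntegrable (M.afterClaim w) volume x y :=
    (monotone_afterClaim hm h0).intervalIntegrable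
  have h2 : ContinuousOn (fun t => M.levelDiscount t * M.lam / M.drift t) (uIcc x y) :=
    ((M.continuousOn_levelDiscount.mul continuousOn_const).div M.continuous_drift.continuousOn
      fun t ht => (M.drift_pos ht).ne').mono (uIcc_subset_Ioi hx hy)
  refine (h1.continuousOn_mul h2).congr fun t _ => ?_
  simp only [claimRate]; ring

theorem claimRate_nonneg (h0 : ∀ x, 0 ≤ w x) {t : ℝ} (ht : M.critical < t) :
    0 ≤ M.claimRate w t :=
  div_nonneg (mul_nonneg (M.levelDiscount_pos _).le
    (mul_nonneg M.lam_pos.le (afterClaim_nonneg h0 t))) (M.drift_pos ht).le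

theorem claimRate_mono {v : ℝ → ℝ} {t : ℝ} (h : M.afterClaim v t ≤ M.afterClaim w t)
    (ht : M.critical < t) : M.claimRate v t ≤ M.claimRate w t := by
  have := M.levelDiscount_pos t
  have := M.lam_pos
  have := M.drift_pos ht
  unfold claimRate
  gcongr

theorem integral_claimRate_mono {v : ℝ → ℝ} (hm : Monotone w) (h0 : ∀ x, 0 ≤ w x)
    (hm' : Monotone v) (h0' : ∀ x, 0 ≤ v x) (h : ∀ x, v x ≤ w x) {x y : ℝ}
    (hx : M.critical < x) (hxy : x ≤ y) :
    ∫ t in x..y, M.claimRate v t ≤ ∫ t in x..y, M.claimRate w t :=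
  intervalIntegral.integral_mono_on hxy
    (intervalIntegrable_claimRate hm' h0' hx (hx.trans_le hxy))
    (intervalIntegrable_claimRate hm h0 hx (hx.trans_le hxy))
    fun t ht => claimRate_mono (afterClaim_mono hm h0 hm' h0' h t) (hx.trans_le ht.1)

end Super

end RiskModel

/-! ### The least supersolution. -/

namespace RiskModel

section

variable {Ω : Type*} [MeasurableSpace Ω] {μ : Measure Ω} [IsProbabilityMeasure μ]
  {M : RiskModel μ} {w : ℝ → ℝ}

/-- The solution, with value `w κ` at `κ`, of `drift · v' = (λ + δ) v - λ I_w`, where `I_w` is the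
expected value of `w` after a claim. -/
noncomputable def flowCont (M : RiskModel μ) (w : ℝ → ℝ) (κ z : ℝ) : ℝ :=
  (M.levelDiscount κ * w κ - ∫ t in κ..z, M.claimRate w t) / M.levelDiscount z

theorem flowCont_self (κ : ℝ) : M.flowCont w κ κ = w κ := by
  have := M.levelDiscount_pos κ
  simp only [flowCont, intervalIntegral.integral_same, sub_zero]
  field_simp

theorem levelDiscount_mul_flowCont (κ z : ℝ) : M.levelDiscount z * M.flowCont w κ z =
    M.levelDiscount κ * w κ - ∫ t in κ..z, M.claimRate w t := by
  have := M.levelDiscount_pos z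
  simp only [flowCont]
  field_simp

theorem continuousAt_claimRate (hm : Monotone w) (h0 : ∀ x, 0 ≤ w x) (hc : Continuous w) {z : ℝ}
    (hz : M.critical < z) : ContinuousAt (M.claimRate w) z :=
  ((M.hasDerivAt_levelDiscount hz).continuousAt.mul
    ((continuous_afterClaim hm h0 hc).continuousAt.const_mul _)).div
    M.continuous_drift.continuousAt (M.drift_pos hz).ne'

theorem hasDerivAt_integral_claimRate (hm : Monotone w) (h0 : ∀ x, 0 ≤ w x) (hc : Continuous w)
    {κ z : ℝ} (hκ : M.critical < κ) (hz : M.critical < z) :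
    HasDerivAt (fun z => ∫ t in κ..z, M.claimRate w t) (M.claimRate w z) z := by
  refine intervalIntegral.integral_hasDerivAt_right (intervalIntegrable_claimRate hm h0 hκ hz) ?_
    (continuousAt_claimRate hm h0 hc hz)
  exact ContinuousOn.stronglyMeasurableAtFilter isOpen_Ioi
    (fun x hx => (continuousAt_claimRate hm h0 hc hx).continuousWithinAt) _ hz

theorem hasDerivAt_flowCont (hm : Monotone w) (h0 : ∀ x, 0 ≤ w x) (hc : Continuous w)
    {κ z : ℝ} (hκ : M.critical < κ) (hz : M.critical < z) :
    HasDerivAt (M.flowCont w κ)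
      (((M.lam + M.δ) * M.flowCont w κ z - M.lam * M.afterClaim w z) / M.drift z) z := by
  have hE := (M.levelDiscount_pos z).ne'
  have hd := (M.drift_pos hz).ne'
  have := ((hasDerivAt_const z (M.levelDiscount κ * w κ)).sub
    (hasDerivAt_integral_claimRate hm h0 hc hκ hz)).div (M.hasDerivAt_levelDiscount hz) hE
  refine this.congr_deriv ?_
  simp only [flowCont, claimRate, Pi.sub_apply]
  field_simp
  ring

/-- A supersolution grows no faster than a solution of the flow equation: the solution through a
point of its graph lies above it to the right and, by the next lemma, below it to the left. -/
theorem IsSuper.le_flowCont (h : M.IsSuper w) {x y : ℝ} (hx : M.critical < x) (hxy : x ≤ y) :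
    w y ≤ M.flowCont w x y := by
  rw [flowCont, le_div_iff₀ (M.levelDiscount_pos y)]
  linarith [h.flow x y hx hxy, mul_comm (w y) (M.levelDiscount y)]

theorem IsSuper.flowCont_le (h : M.IsSuper w) {x y : ℝ} (hx : M.critical < x) (hxy : x ≤ y) :
    M.flowCont w y x ≤ w x := by
  rw [flowCont, div_le_iff₀ (M.levelDiscount_pos x), intervalIntegral.integral_symm]
  linarith [h.flow x y hx hxy, mul_comm (w x) (M.levelDiscount x)]

/-- Above the critical level `w` is nondecreasing while `levelDiscount * w` is nonincreasing. As
`levelDiscount` is continuous and positive, `w` is squeezed from both sides. -/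
theorem IsSuper.continuousAt (h : M.IsSuper w) {x : ℝ} (hx : M.critical < x) :
    ContinuousAt w x := by
  have hE : Tendsto (fun y => w x * (M.levelDiscount x / M.levelDiscount y)) (𝓝 x) (𝓝 (w x)) := by
    have : Tendsto (fun y => w x * (M.levelDiscount x / M.levelDiscount y)) (𝓝 x)
        (𝓝 (w x * (M.levelDiscount x / M.levelDiscount x))) :=
      ((tendsto_const_nhds.div (M.hasDerivAt_levelDiscount hx).continuousAt
        (M.levelDiscount_pos x).ne').const_mul _)
    rwa [div_self (M.levelDiscount_pos x).ne', mul_one] at this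
  have key : ∀ a b, M.critical < a → a ≤ b →
      M.levelDiscount b * w b ≤ M.levelDiscount a * w a := fun a b ha hab => by
    have : 0 ≤ ∫ t in a..b, M.claimRate w t :=
      intervalIntegral.integral_nonneg hab fun t ht => claimRate_nonneg h.nonneg (ha.trans_le ht.1)
    linarith [h.flow a b ha hab]
  refine tendsto_of_tendsto_of_tendsto_of_le_of_le'
    (g := fun y => min (w x) (w x * (M.levelDiscount x / M.levelDiscount y)))
    (h := fun y => max (w x) (w x * (M.levelDiscount x / M.levelDiscount y))) ?_ ?_ ?_ ?_
  · simpa using (tendsto_const_nhds (x := w x)).min hE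
  · simpa using (tendsto_const_nhds (x := w x)).max hE
  · filter_upwards [Ioi_mem_nhds hx] with y hy
    have hEy := M.levelDiscount_pos y
    rcases le_total x y with hxy | hxy
    · exact (min_le_left _ _).trans (h.monotone hxy)
    · refine (min_le_right _ _).trans ?_
      rw [← mul_div_assoc, div_le_iff₀ hEy]
      linarith [key y x hy hxy]
  · filter_upwards [Ioi_mem_nhds hx] with y hy
    have hEy := M.levelDiscount_pos y
    rcases le_total x y with hxy | hxy
    · refine le_trans ?_ (le_max_right _ _)
      rw [← mul_div_assoc, le_div_iff₀ hEy]
      linarith [key x y hx hxy]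
    · exact (h.monotone hxy).trans (le_max_left _ _)

theorem afterClaim_eq_zero (h0 : ∀ x ≤ M.critical, w x = 0) {x : ℝ} (hx : x ≤ M.critical) :
    M.afterClaim w x = 0 := by
  refine integral_eq_zero_of_ae ?_
  filter_upwards [M.ae_claimLaw_nonneg] with u hu
  exact h0 _ (by linarith)

/-- An explicit supersolution. -/
noncomputable def explicitSuper (M : RiskModel μ) (x : ℝ) : ℝ :=
  if x ≤ M.critical then 0 else
    2 * (M.α + M.p) / M.δ * (x - M.critical) ^ min (1 / 2) (M.δ / (2 * M.α)) + (x - M.critical)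

/-- Claims only reduce the value, so `I_w` may be replaced by `w`; the terms in `λ` cancel and
`drift · w' ≤ δ w` remains to be shown. With `η` the distance to the critical level and `w = K η ^ γ
+ η`, the bound `drift ≤ α η` and `γ α ≤ δ / 2` make the power term use up only half of `δ K η ^ γ`.
By the choice of `K` the other half is `(α + p) η ^ γ`. It dominates `drift ≤ α η` for `η ≤ 1`, and
the constant part of `drift ≤ p + r η` for `η ≥ 1`, where `r < δ` takes care of the linear part. A
linear function alone would not do near the critical level unless `α ≤ δ`. -/
theorem isSuper_explicitSuper (M : RiskModel μ) : M.IsSuper M.explicitSuper := by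
  have hα := M.α_pos
  have hδ := M.δ_pos
  have hp := M.p_pos
  set γ := min (1 / 2) (M.δ / (2 * M.α)) with hγ
  set K := 2 * (M.α + M.p) / M.δ with hK
  have hγ0 : 0 < γ := lt_min (by norm_num) (by positivity)
  have hγ1 : γ ≤ 1 / 2 := min_le_left _ _
  have hγα : γ * M.α ≤ M.δ / 2 := by
    have : γ ≤ M.δ / (2 * M.α) := min_le_right _ _
    calc γ * M.α ≤ M.δ / (2 * M.α) * M.α := by gcongr
      _ = M.δ / 2 := by field_simp
  have hK0 : 0 < K := by positivity
  have hKδ : M.δ / 2 * K = M.α + M.p := by rw [hK]; field_simp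
  have hpos : ∀ x, M.critical < x →
      M.explicitSuper x = K * (x - M.critical) ^ γ + (x - M.critical) := fun x hx => by
    rw [explicitSuper, if_neg (not_le.2 hx)]
  have hz : ∀ x ≤ M.critical, M.explicitSuper x = 0 := fun x hx => if_pos hx
  have hslope : ∀ x y, M.critical ≤ x → x ≤ y →
      y - x ≤ M.explicitSuper y - M.explicitSuper x := by
    intro x y hx hxy
    rcases hx.eq_or_lt with rfl | hx
    · rcases hxy.eq_or_lt with rfl | hy
      · simp
      · rw [hz _ le_rfl, hpos y hy]
        have : 0 ≤ (y - M.critical) ^ γ := Real.rpow_nonneg (by linarith) _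
        nlinarith
    · rw [hpos x hx, hpos y (hx.trans_le hxy)]
      have : (x - M.critical) ^ γ ≤ (y - M.critical) ^ γ :=
        Real.rpow_le_rpow (by linarith) (by linarith) hγ0.le
      nlinarith
  have h0 : ∀ x, 0 ≤ M.explicitSuper x := fun x => by
    rcases le_or_gt x M.critical with hx | hx
    · rw [hz x hx]
    · have := hslope _ _ le_rfl hx.le
      rw [hz _ le_rfl] at this
      linarith
  have hm : Monotone M.explicitSuper := by
    intro x y hxy
    rcases le_total x M.critical with hx | hx
    · rw [hz x hx]; exact h0 y
    · linarith [hslope x y hx hxy]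
  have hd : ∀ x, M.critical < x →
      HasDerivAt M.explicitSuper (K * (γ * (x - M.critical) ^ (γ - 1)) + 1) x := by
    intro x hx
    have h1 : HasDerivAt (fun x => x - M.critical) 1 x := (hasDerivAt_id x).sub_const _
    have h2 := ((h1.rpow_const (p := γ) (Or.inl (sub_pos.2 hx).ne')).const_mul K).add h1
    refine (h2.congr_of_eventuallyEq ?_).congr_deriv (by ring)
    filter_upwards [Ioi_mem_nhds hx] with y hy
    exact hpos y hy
  have hgen : ∀ x, M.critical < x →
      M.drift x * (K * (γ * (x - M.critical) ^ (γ - 1)) + 1) ≤ M.δ * M.explicitSuper x := by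
    intro x hx
    rw [hpos x hx]
    set η := x - M.critical with hη
    have hη0 : 0 < η := sub_pos.2 hx
    have e : η * η ^ (γ - 1) = η ^ γ := by
      rw [Real.rpow_sub_one hη0.ne']; field_simp
    have hP : 0 ≤ η ^ (γ - 1) := Real.rpow_nonneg hη0.le _
    have h1 : M.drift x * (K * (γ * η ^ (γ - 1))) ≤ K * (M.δ / 2) * η ^ γ := by
      calc M.drift x * (K * (γ * η ^ (γ - 1))) ≤ (M.α * η) * (K * (γ * η ^ (γ - 1))) := by
            gcongr; exact M.drift_le_α x
        _ = K * (γ * M.α) * (η * η ^ (γ - 1)) := by ring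
        _ ≤ K * (M.δ / 2) * η ^ γ := by rw [e]; gcongr
    have h2 : M.drift x ≤ K * (M.δ / 2) * η ^ γ + M.δ * η := by
      rw [show K * (M.δ / 2) = M.α + M.p by linarith]
      rcases le_total η 1 with h | h
      · have h3 : η ≤ η ^ γ := by
          conv_lhs => rw [← Real.rpow_one η]
          exact Real.rpow_le_rpow_of_exponent_ge hη0 h (by linarith)
        have := M.drift_le_α x
        rw [← hη] at this
        nlinarith [mul_pos hδ hη0, mul_le_mul_of_nonneg_left h3 hα.le]
      · have h3 : 1 ≤ η ^ γ := Real.one_le_rpow h hγ0.le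
        have h4 := M.drift_le_r x
        have h5 : M.r * x ≤ M.r * η := by
          have := M.critical_neg
          exact mul_le_mul_of_nonneg_left (by linarith) M.r_pos.le
        nlinarith [M.r_lt_δ]
    linarith
  refine ⟨hz, hslope, fun x y hx hxy => ?_⟩
  have hcw : ContinuousOn M.explicitSuper (Ioi M.critical) := fun t ht =>
    (hd t ht).continuousAt.continuousWithinAt
  have hcr : ContinuousOn (fun t => M.levelDiscount t * (M.lam * M.explicitSuper t) / M.drift t)
      (Ioi M.critical) :=
    (M.continuousOn_levelDiscount.mul (hcw.const_smul M.lam)).div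
      M.continuous_drift.continuousOn fun t ht => (M.drift_pos ht).ne'
  have hint : ∫ t in x..y, M.claimRate M.explicitSuper t ≤
      ∫ t in x..y, M.levelDiscount t * (M.lam * M.explicitSuper t) / M.drift t := by
    refine intervalIntegral.integral_mono_on hxy
      (intervalIntegrable_claimRate hm h0 hx (hx.trans_le hxy))
      (hcr.mono (uIcc_subset_Ioi hx (hx.trans_le hxy))).intervalIntegrable fun t ht => ?_
    have := M.levelDiscount_pos t
    have := M.lam_pos
    have := M.drift_pos (hx.trans_le ht.1)
    have := afterClaim_le (M := M) hm h0 t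
    unfold claimRate
    gcongr
  have hder : ∀ t, M.critical < t → HasDerivAt (fun y => M.levelDiscount y * M.explicitSuper y +
      ∫ t in x..y, M.levelDiscount t * (M.lam * M.explicitSuper t) / M.drift t)
      (-(M.lam + M.δ) / M.drift t * M.levelDiscount t * M.explicitSuper t + M.levelDiscount t *
        (K * (γ * (t - M.critical) ^ (γ - 1)) + 1) +
        M.levelDiscount t * (M.lam * M.explicitSuper t) / M.drift t) t := by
    intro t ht
    refine ((M.hasDerivAt_levelDiscount ht).mul (hd t ht)).add
      (intervalIntegral.integral_hasDerivAt_right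
        (hcr.mono (uIcc_subset_Ioi hx ht)).intervalIntegrable
        (hcr.stronglyMeasurableAtFilter isOpen_Ioi _ ht) (hcr.continuousAt (Ioi_mem_nhds ht)))
  have hanti := antitoneOn_of_hasDerivWithinAt_nonpos (convex_Icc x y)
    (fun t ht => (hder t (hx.trans_le ht.1)).continuousAt.continuousWithinAt)
    (fun t ht => (hder t (hx.trans_le (interior_subset ht).1)).hasDerivWithinAt)
    (fun t ht => by
      have hcr := hx.trans_le (interior_subset ht).1
      have h1 := M.drift_pos hcr
      have h2 := hgen t hcr
      have h3 := M.levelDiscount_pos t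
      rw [show -(M.lam + M.δ) / M.drift t * M.levelDiscount t * M.explicitSuper t +
        M.levelDiscount t * (K * (γ * (t - M.critical) ^ (γ - 1)) + 1) +
        M.levelDiscount t * (M.lam * M.explicitSuper t) / M.drift t = M.levelDiscount t / M.drift t *
        (M.drift t * (K * (γ * (t - M.critical) ^ (γ - 1)) + 1) - M.δ * M.explicitSuper t) by
          field_simp; ring]
      exact mul_nonpos_of_nonneg_of_nonpos (by positivity) (by linarith))
  have := hanti (left_mem_Icc.2 hxy) (right_mem_Icc.2 hxy) hxy
  simp only [intervalIntegral.integral_same, add_zero] at this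
  linarith

/-- The least supersolution. It is going to be the value function. -/
noncomputable def minSuper (M : RiskModel μ) (x : ℝ) : ℝ := sInf ((fun w => w x) '' {w | M.IsSuper w})

theorem IsSuper.minSuper_le (h : M.IsSuper w) (x : ℝ) : M.minSuper x ≤ w x :=
  csInf_le ⟨0, by rintro _ ⟨v, hv, rfl⟩; exact hv.nonneg x⟩ ⟨w, h, rfl⟩

theorem le_minSuper {x a : ℝ} (h : ∀ w, M.IsSuper w → a ≤ w x) : a ≤ M.minSuper x :=
  le_csInf ⟨_, _, M.isSuper_explicitSuper, rfl⟩ (by rintro _ ⟨v, hv, rfl⟩; exact h v hv)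

/-- Each condition bounds the value at one point from below by a monotone expression in the values
elsewhere, and such conditions pass to infima. For the flow condition this uses that the claim
integral is monotone in `w`. -/
theorem isSuper_minSuper (M : RiskModel μ) : M.IsSuper M.minSuper := by
  have hz : ∀ x ≤ M.critical, M.minSuper x = 0 := fun x hx =>
    le_antisymm ((M.isSuper_explicitSuper.minSuper_le x).trans_eq (M.isSuper_explicitSuper.zero x hx))
      (le_minSuper fun w hw => hw.nonneg x)
  have hslope : ∀ x y, M.critical ≤ x → x ≤ y → y - x ≤ M.minSuper y - M.minSuper x := by
    intro x y hx hxy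
    rw [le_sub_iff_add_le]
    exact le_minSuper fun w hw => by linarith [hw.slope x y hx hxy, hw.minSuper_le x]
  have h0 : ∀ x, 0 ≤ M.minSuper x := fun x => le_minSuper fun w hw => hw.nonneg x
  have hm : Monotone M.minSuper := fun x y hxy => le_minSuper fun w hw =>
    (hw.minSuper_le x).trans (hw.monotone hxy)
  refine ⟨hz, hslope, fun x y hx hxy => ?_⟩
  have hE := M.levelDiscount_pos x
  rw [mul_comm _ (M.minSuper x), ← div_le_iff₀ hE]
  refine le_minSuper fun w hw => ?_
  rw [div_le_iff₀ hE, mul_comm (w x)]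
  refine le_trans (add_le_add ?_ ?_) (hw.flow x y hx hxy)
  · exact mul_le_mul_of_nonneg_left (hw.minSuper_le y) (M.levelDiscount_pos y).le
  · exact integral_claimRate_mono hw.monotone hw.nonneg hm h0 hw.minSuper_le hx hxy

theorem continuous_minSuper (M : RiskModel μ) : Continuous M.minSuper := by
  rw [continuous_iff_continuousAt]
  intro x
  rcases lt_trichotomy x M.critical with hx | rfl | hx
  · refine (continuousAt_const (y := (0 : ℝ))).congr ?_
    filter_upwards [Iio_mem_nhds hx] with y hy
    exact (M.isSuper_minSuper.zero y (le_of_lt hy)).symm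
  -- At the critical level the flow stalls and the squeeze used above it is not available. Here
  -- continuity comes from the explicit supersolution, which tends to `0`.
  · set γ := min (1 / 2) (M.δ / (2 * M.α)) with hγ
    have hγ0 : 0 < γ := lt_min (by norm_num) (div_pos M.δ_pos (by linarith [M.α_pos]))
    rw [ContinuousAt, M.isSuper_minSuper.zero _ le_rfl]
    have hu : Tendsto (fun x => 2 * (M.α + M.p) / M.δ * |x - M.critical| ^ γ + |x - M.critical|)
        (𝓝 M.critical) (𝓝 0) := by
      have h1 : Tendsto (fun x => |x - M.critical|) (𝓝 M.critical) (𝓝 0) := by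
        have : Continuous (fun x => |x - M.critical|) := by fun_prop
        simpa using this.tendsto M.critical
      have h2 : Tendsto (fun x => |x - M.critical| ^ γ) (𝓝 M.critical) (𝓝 0) := by
        simpa [Real.zero_rpow hγ0.ne'] using h1.rpow_const (Or.inr hγ0.le) (p := γ)
      simpa using (h2.const_mul (2 * (M.α + M.p) / M.δ)).add h1
    refine tendsto_of_tendsto_of_tendsto_of_le_of_le tendsto_const_nhds hu
      (fun y => M.isSuper_minSuper.nonneg y) fun y => ?_
    refine (M.isSuper_explicitSuper.minSuper_le y).trans ?_
    rw [explicitSuper]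
    have := M.α_pos
    have := M.δ_pos
    have := M.p_pos
    split_ifs with h
    · positivity
    · rw [abs_of_pos (by linarith)]
  · exact M.isSuper_minSuper.continuousAt hx

/-- Linear growth, against reserves that grow at most like `exp (r t)`, is what makes the discounted
value vanish at infinity. -/
theorem exists_minSuper_le (M : RiskModel μ) : ∃ C, 0 < C ∧ ∀ x, M.critical ≤ x →
    M.minSuper x ≤ C * (x - M.critical + 1) := by
  have h1 := M.α_pos
  have h2 := M.δ_pos
  have h3 := M.p_pos
  refine ⟨2 * (M.α + M.p) / M.δ + 1, by positivity, fun x hx => ?_⟩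
  refine (M.isSuper_explicitSuper.minSuper_le x).trans ?_
  rw [explicitSuper]
  have hη : 0 ≤ x - M.critical := by linarith
  have hK : 0 ≤ 2 * (M.α + M.p) / M.δ := by positivity
  split_ifs with h
  · positivity
  · set γ := min (1 / 2) (M.δ / (2 * M.α)) with hγ
    have hγ0 : 0 < γ := lt_min (by norm_num) (by positivity)
    have hγ1 : γ ≤ 1 := (min_le_left _ _).trans (by norm_num)
    have : (x - M.critical) ^ γ ≤ x - M.critical + 1 := by
      calc (x - M.critical) ^ γ ≤ (x - M.critical + 1) ^ γ :=
            Real.rpow_le_rpow hη (by linarith) hγ0.le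
        _ ≤ (x - M.critical + 1) ^ (1 : ℝ) := Real.rpow_le_rpow_of_exponent_le (by linarith) hγ1
        _ = _ := Real.rpow_one _
    nlinarith

end

end RiskModel

/-! ### Local structure of the least supersolution. -/

namespace RiskModel

section

variable {Ω : Type*} [MeasurableSpace Ω] {μ : Measure Ω} [IsProbabilityMeasure μ]
  {M : RiskModel μ} {w : ℝ → ℝ}

/-- The function `𝒢_w`. -/
noncomputable def generator (M : RiskModel μ) (w : ℝ → ℝ) (x : ℝ) : ℝ :=
  M.drift x - (M.lam + M.δ) * w x + M.lam * M.afterClaim w x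

theorem continuous_generator (hm : Monotone w) (h0 : ∀ x, 0 ≤ w x) (hc : Continuous w) :
    Continuous (M.generator w) :=
  (M.continuous_drift.sub (hc.const_smul (M.lam + M.δ))).add
    ((continuous_afterClaim hm h0 hc).const_smul M.lam)

theorem IsSuper.generator_critical (h : M.IsSuper w) : M.generator w M.critical = 0 := by
  rw [generator, M.drift_critical, h.zero _ le_rfl, afterClaim_eq_zero h.zero le_rfl]
  ring

theorem deriv_nonpos_of_le_right {f : ℝ → ℝ} {f' x : ℝ} (hf : HasDerivAt f f' x)
    (h : ∀ y, x ≤ y → f y ≤ f x) : f' ≤ 0 := by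
  have h1 := (hasDerivWithinAt_iff_tendsto_slope' (s := Ioi x) (by simp)).1 hf.hasDerivWithinAt
  refine le_of_tendsto h1 ?_
  filter_upwards [self_mem_nhdsWithin] with y hy
  rw [slope_def_field]
  exact div_nonpos_of_nonpos_of_nonneg (sub_nonpos.2 (h y (le_of_lt hy)))
    (sub_nonneg.2 (le_of_lt hy))

/-- To the right of `x` the graph lies above the line of slope one through its point at `x` and
below the flow solution through that point. So the slope of the flow solution at `x` is at least
one, which is the claim. -/
theorem IsSuper.generator_nonpos (h : M.IsSuper w) (hc : Continuous w) {x : ℝ}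
    (hx : M.critical ≤ x) : M.generator w x ≤ 0 := by
  rcases hx.eq_or_lt with rfl | hx
  · exact h.generator_critical.le
  have hd : HasDerivAt (fun y => w x + (y - x) - M.flowCont w x y)
      (1 - ((M.lam + M.δ) * M.flowCont w x x - M.lam * M.afterClaim w x) / M.drift x) x :=
    (((hasDerivAt_id x).sub_const x).const_add (w x)).sub
      (hasDerivAt_flowCont h.monotone h.nonneg hc hx hx)
  have hneg := deriv_nonpos_of_le_right hd fun y hy => by
    rw [flowCont_self]
    linarith [h.slope x y hx.le hy, h.le_flowCont hx hy]
  have hp := M.drift_pos hx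
  rw [flowCont_self, sub_nonpos, le_div_iff₀ hp] at hneg
  rw [generator]
  linarith

/-- The modification of `w` on `[z, y]` by the larger one of the line of slope one through the
left end and the solution of the flow equation through the right end. -/
noncomputable def lowered (M : RiskModel μ) (w : ℝ → ℝ) (z y s : ℝ) : ℝ :=
  if s ∈ Icc z y then max (w z + (s - z)) (M.flowCont w y s) else w s

theorem lowered_le (h : M.IsSuper w) {z y : ℝ} (hz : M.critical < z) (s : ℝ) :
    M.lowered w z y s ≤ w s := by
  rw [lowered]
  split_ifs with hs
  · refine max_le (by linarith [h.slope z s hz.le hs.1]) (h.flowCont_le (hz.trans_le hs.1) hs.2)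
  · exact le_rfl

/-- Both the slope condition and the flow condition chain over adjacent intervals. They can
therefore be checked separately to the left of, inside and to the right of the interval on which a
supersolution is modified. -/
theorem rel_of_rel_pieces {r : ℝ → ℝ → Prop} {z y : ℝ}
    (ht : ∀ a b c, a ≤ b → b ≤ c → r a b → r b c → r a c)
    (h1 : ∀ a b, a ≤ b → b ≤ z → r a b) (h2 : ∀ a b, z ≤ a → a ≤ b → b ≤ y → r a b)
    (h3 : ∀ a b, y ≤ a → a ≤ b → r a b) {a b : ℝ} (hab : a ≤ b) : r a b := by
  have h12 : ∀ a b, a ≤ b → b ≤ y → r a b := by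
    intro a b hab hb
    rcases le_total b z with hbz | hbz
    · exact h1 a b hab hbz
    rcases le_total z a with haz | haz
    · exact h2 a b haz hab hb
    · exact ht a z b haz hbz (h1 a z haz le_rfl) (h2 z b le_rfl hbz hb)
  rcases le_total b y with hb | hb
  · exact h12 a b hab hb
  rcases le_total y a with ha | ha
  · exact h3 a b ha hab
  · exact ht a y b ha hb (h12 a y ha le_rfl) (h3 y b le_rfl hb)

/-- Where the flow solution is at or above the line, its value is at least `w z`, and `hb` then
makes its derivative exceed one. It therefore runs above every line of slope one from there on. -/
theorem flowCont_slope (h : M.IsSuper w) (hc : Continuous w) {z y : ℝ} (hz : M.critical < z)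
    (hb : ∀ s ∈ Icc z y, M.drift s < (M.lam + M.δ) * w z - M.lam * M.afterClaim w s)
    {a b : ℝ} (ha : z ≤ a) (hab : a ≤ b) (hby : b ≤ y) (hv : w z + (a - z) ≤ M.flowCont w y a) :
    M.flowCont w y a + (b - a) ≤ M.flowCont w y b := by
  have hd : ∀ s, z ≤ s → HasDerivAt (M.flowCont w y)
      (((M.lam + M.δ) * M.flowCont w y s - M.lam * M.afterClaim w s) / M.drift s) s := fun s hs =>
    hasDerivAt_flowCont h.monotone h.nonneg hc (hz.trans_le (ha.trans (hab.trans hby)))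
      (hz.trans_le hs)
  refine image_le_of_deriv_right_lt_deriv_boundary' (f := fun u => M.flowCont w y a + (u - a))
    (f' := fun _ => 1) (a := a) (b := b) (B := M.flowCont w y)
    (B' := fun s => ((M.lam + M.δ) * M.flowCont w y s - M.lam * M.afterClaim w s) / M.drift s)
    (by fun_prop) (fun x _ => (((hasDerivAt_id x).sub_const a).const_add _).hasDerivWithinAt)
    (by simp) (fun s hs => (hd s (ha.trans hs.1)).continuousAt.continuousWithinAt)
    (fun s hs => (hd s (ha.trans hs.1)).hasDerivWithinAt) ?_ (right_mem_Icc.2 hab)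
  intro s hs he
  have hzs := ha.trans hs.1
  rw [lt_div_iff₀ (M.drift_pos (hz.trans_le hzs))]
  have h1 := hb s ⟨hzs, hs.2.le.trans hby⟩
  have h2 : w z ≤ M.flowCont w y s := by rw [← he]; linarith [hs.1]
  have := M.lam_pos
  have := M.δ_pos
  nlinarith

/-- The line has slope one, and it satisfies the flow inequality because of `hb`. The flow solution
satisfies the flow condition with equality, and it has slope at least one wherever it is the larger
of the two. Hence the maximum has both properties. It agrees with `w` at both ends of the interval,
so the pieces fit together. -/
theorem isSuper_lowered (h : M.IsSuper w) (hc : Continuous w) {z y : ℝ} (hz : M.critical < z)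
    (hzy : z ≤ y)
    (hb : ∀ s ∈ Icc z y, M.drift s < (M.lam + M.δ) * w z - M.lam * M.afterClaim w s) :
    M.IsSuper (M.lowered w z y) := by
  have hle := lowered_le (y := y) h hz
  have hmid : ∀ s, z ≤ s → s ≤ y → M.lowered w z y s = max (w z + (s - z)) (M.flowCont w y s) :=
    fun s h1 h2 => if_pos ⟨h1, h2⟩
  have hleft : ∀ s ≤ z, M.lowered w z y s = w s := by
    intro s hs
    rcases hs.eq_or_lt with rfl | hs
    · rw [hmid s le_rfl hzy, sub_self, add_zero, max_eq_left (h.flowCont_le hz hzy)]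
    · exact if_neg fun hs' => absurd hs'.1 (not_le.2 hs)
  have hright : ∀ s, y ≤ s → M.lowered w z y s = w s := by
    intro s hs
    rcases hs.eq_or_lt with rfl | hs
    · rw [hmid y hzy le_rfl, flowCont_self, max_eq_right]
      linarith [h.slope z y hz.le hzy]
    · exact if_neg fun hs' => absurd hs'.2 (not_le.2 hs)
  have hzero : ∀ x ≤ M.critical, M.lowered w z y x = 0 := fun x hx => by
    rw [hleft x (hx.trans hz.le), h.zero x hx]
  have hslope : ∀ a b, a ≤ b → M.critical ≤ a →
      b - a ≤ M.lowered w z y b - M.lowered w z y a := by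
    intro a b hab
    refine rel_of_rel_pieces (z := z) (y := y) (r := fun a b => M.critical ≤ a →
      b - a ≤ M.lowered w z y b - M.lowered w z y a) ?_ ?_ ?_ ?_ hab
    · intro a b c hab _ h1 h2 ha
      linarith [h1 ha, h2 (ha.trans hab)]
    · intro a b hab hbz ha
      rw [hleft a (hab.trans hbz), hleft b hbz]
      exact h.slope a b ha hab
    · intro a b ha hab hby _
      rw [hmid a ha (hab.trans hby), hmid b (ha.trans hab) hby]
      rcases le_total (M.flowCont w y a) (w z + (a - z)) with hv | hv
      · rw [max_eq_left hv]
        linarith [le_max_left (w z + (b - z)) (M.flowCont w y b)]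
      · rw [max_eq_right hv]
        linarith [flowCont_slope h hc hz hb ha hab hby hv,
          le_max_right (w z + (b - z)) (M.flowCont w y b)]
    · intro a b ha hab hca
      rw [hright a ha, hright b (ha.trans hab)]
      exact h.slope a b hca hab
  have h0 : ∀ x, 0 ≤ M.lowered w z y x := fun x => by
    rcases le_total x M.critical with hx | hx
    · rw [hzero x hx]
    · have := hslope _ _ hx le_rfl
      rw [hzero _ le_rfl] at this
      linarith
  have hm : Monotone (M.lowered w z y) := by
    intro x x' hxx
    rcases le_total x M.critical with hx | hx
    · rw [hzero x hx]; exact h0 _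
    · linarith [hslope x x' hxx hx]
  -- Here claims are valued with `w` itself. This is more than required, since the lowered function
  -- lies below `w` and so has the smaller claim integral.
  have hflow : ∀ a b, a ≤ b → M.critical < a → M.levelDiscount b * M.lowered w z y b +
      ∫ t in a..b, M.claimRate w t ≤ M.levelDiscount a * M.lowered w z y a := by
    intro a b hab
    refine rel_of_rel_pieces (z := z) (y := y) (r := fun a b => M.critical < a →
      M.levelDiscount b * M.lowered w z y b + ∫ t in a..b, M.claimRate w t ≤
        M.levelDiscount a * M.lowered w z y a) ?_ ?_ ?_ ?_ hab
    · intro a b c hab hbc h1 h2 ha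
      have hcb := ha.trans_le hab
      rw [← intervalIntegral.integral_add_adjacent_intervals
        (intervalIntegrable_claimRate h.monotone h.nonneg ha hcb)
        (intervalIntegrable_claimRate h.monotone h.nonneg hcb (hcb.trans_le hbc))]
      linarith [h1 ha, h2 (ha.trans_le hab)]
    · intro a b hab hbz ha
      rw [hleft a (hab.trans hbz), hleft b hbz]
      exact h.flow a b ha hab
    · intro a b ha hab hby hca
      have hcy := hz.trans_le hzy
      have hcb := hca.trans_le hab
      rw [hmid a ha (hab.trans hby), hmid b (ha.trans hab) hby]
      rcases le_total (w z + (b - z)) (M.flowCont w y b) with hv | hv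
      · rw [max_eq_right hv, levelDiscount_mul_flowCont]
        refine le_trans (le_of_eq ?_) (mul_le_mul_of_nonneg_left (le_max_right _ _)
          (M.levelDiscount_pos a).le)
        rw [levelDiscount_mul_flowCont, ← intervalIntegral.integral_add_adjacent_intervals
          (intervalIntegrable_claimRate h.monotone h.nonneg hcy hca)
          (intervalIntegrable_claimRate h.monotone h.nonneg hca hcb)]
        ring
      · rw [max_eq_left hv]
        refine le_trans ?_ (mul_le_mul_of_nonneg_left (le_max_left _ _) (M.levelDiscount_pos a).le)
        have hder : ∀ t, M.critical < t → HasDerivAt (fun t => M.levelDiscount t *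
            (w z + (t - z)) + ∫ u in a..t, M.claimRate w u)
            (-(M.lam + M.δ) / M.drift t * M.levelDiscount t * (w z + (t - z)) +
              M.levelDiscount t * 1 + M.claimRate w t) t := fun t ht =>
          ((M.hasDerivAt_levelDiscount ht).mul (((hasDerivAt_id t).sub_const z).const_add _)).add
            (hasDerivAt_integral_claimRate h.monotone h.nonneg hc hca ht)
        have hanti := antitoneOn_of_hasDerivWithinAt_nonpos (convex_Icc a b)
          (fun t ht => (hder t (hca.trans_le ht.1)).continuousAt.continuousWithinAt)
          (fun t ht => (hder t (hca.trans_le (interior_subset ht).1)).hasDerivWithinAt)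
          (fun t ht => by
            have ht := interior_subset ht
            have hct := hca.trans_le ht.1
            have h1 := M.drift_pos hct
            have h2 := hb t ⟨ha.trans ht.1, ht.2.trans hby⟩
            have h3 := M.levelDiscount_pos t
            have h4 : 0 ≤ (M.lam + M.δ) * (t - z) :=
              mul_nonneg (add_pos M.lam_pos M.δ_pos).le (by linarith [ht.1])
            rw [claimRate, show -(M.lam + M.δ) / M.drift t * M.levelDiscount t *
              (w z + (t - z)) + M.levelDiscount t * 1 + M.levelDiscount t *
              (M.lam * M.afterClaim w t) / M.drift t = M.levelDiscount t / M.drift t *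
              (M.drift t - ((M.lam + M.δ) * w z - M.lam * M.afterClaim w t) -
                (M.lam + M.δ) * (t - z)) by field_simp; ring]
            exact mul_nonpos_of_nonneg_of_nonpos (by positivity) (by linarith))
        have := hanti (left_mem_Icc.2 hab) (right_mem_Icc.2 hab) hab
        simpa using this
    · intro a b ha hab hca
      rw [hright a ha, hright b (ha.trans hab)]
      exact h.flow a b hca hab
  refine ⟨hzero, fun a b ha hab => hslope a b hab ha, fun a b ha hab =>
    le_trans ?_ (hflow a b hab ha)⟩
  gcongr
  exact integral_claimRate_mono h.monotone h.nonneg hm h0 hle ha hab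

/-- Near a level at which the generator is negative, the least supersolution first has slope one
and then satisfies the flow equation. -/
theorem minSuper_dichotomy {t : ℝ} (ht : M.critical < t) (hg : M.generator M.minSuper t < 0) :
    (∀ᶠ s in 𝓝 t, M.minSuper s = M.minSuper t + (s - t)) ∨
    ∃ y > t, ∀ κ ∈ Ico t y, ∀ s ∈ Icc κ y, M.minSuper s = M.flowCont M.minSuper κ s := by
  set w := M.minSuper with hw
  have h := M.isSuper_minSuper
  rw [← hw] at h
  have hc : Continuous w := M.continuous_minSuper
  -- The lowering needs a bound with `w` taken at the left end of the interval and the other terms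
  -- at a running point, hence continuity in two independent variables.
  have hcont : Continuous fun q : ℝ × ℝ =>
      (M.lam + M.δ) * w q.1 - M.lam * M.afterClaim w q.2 - M.drift q.2 := by
    have h1 := continuous_afterClaim (M := M) h.monotone h.nonneg hc
    have h2 := M.continuous_drift
    fun_prop
  have hev : ∀ᶠ q : ℝ × ℝ in 𝓝 (t, t),
      0 < (M.lam + M.δ) * w q.1 - M.lam * M.afterClaim w q.2 - M.drift q.2 := by
    refine hcont.continuousAt.eventually (lt_mem_nhds ?_)
    rw [generator] at hg
    simp only
    linarith
  obtain ⟨ε, hε, hball⟩ := Metric.eventually_nhds_iff.1 (hev.and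
    ((continuous_fst.tendsto (t, t)).eventually (Ioi_mem_nhds ht)))
  set z := t - ε / 2 with hz
  set y := t + ε / 2 with hy
  have hb : ∀ s ∈ Icc z y, M.drift s < (M.lam + M.δ) * w z - M.lam * M.afterClaim w s := by
    intro s hs
    have : dist (z, s) (t, t) < ε := by
      rw [Prod.dist_eq, max_lt_iff, Real.dist_eq, Real.dist_eq, abs_lt, abs_lt]
      have := hs.1
      have := hs.2
      refine ⟨⟨?_, ?_⟩, ?_, ?_⟩ <;> simp only [] <;> linarith
    linarith [(hball this).1]
  have hcz : M.critical < z := by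
    have : dist (z, t) (t, t) < ε := by
      rw [Prod.dist_eq, max_lt_iff, Real.dist_eq, Real.dist_eq, abs_lt, abs_lt]
      refine ⟨⟨?_, ?_⟩, ?_, ?_⟩ <;> simp only [] <;> linarith
    exact (hball this).2
  have hzy : z ≤ y := by linarith
  have hcy := hcz.trans_le hzy
  -- Minimality: the lowered function is a supersolution below `w`, so nothing was lowered.
  have heq : ∀ s ∈ Icc z y, w s = max (w z + (s - z)) (M.flowCont w y s) := fun s hs => by
    refine le_antisymm (((isSuper_lowered h hc hcz hzy hb).minSuper_le s).trans_eq (if_pos hs)) ?_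
    exact (if_pos hs).symm.trans_le (lowered_le h hcz s)
  -- If the line is strictly on top at `t`, it is so in a neighbourhood. Otherwise the flow solution
  -- stays on top from `t` on, by `flowCont_slope`; nothing is then said about levels below `t`.
  rcases lt_or_ge (M.flowCont w y t) (w z + (t - z)) with hv | hv
  · left
    have hwt : w t = w z + (t - z) := by
      rw [heq t ⟨by linarith, by linarith⟩, max_eq_left hv.le]
    have hcv : ContinuousAt (M.flowCont w y) t :=
      (hasDerivAt_flowCont h.monotone h.nonneg hc hcy ht).continuousAt
    filter_upwards [Ioo_mem_nhds (show z < t by linarith) (show t < y by linarith),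
      hcv.eventually_lt (g := fun s => w z + (s - z)) (by fun_prop) hv] with s hs hlt
    rw [heq s ⟨hs.1.le, hs.2.le⟩, max_eq_left hlt.le, hwt]
    ring
  · right
    refine ⟨y, by linarith, fun κ hκ s hs => ?_⟩
    have hv' : ∀ s, t ≤ s → s ≤ y → w s = M.flowCont w y s := fun s hts hsy => by
      rw [heq s ⟨by linarith, hsy⟩, max_eq_right]
      linarith [flowCont_slope h hc hcz hb (by linarith) hts hsy hv]
    have hcs := ht.trans_le (hκ.1.trans hs.1)
    have hcκ := ht.trans_le hκ.1
    rw [hv' s (hκ.1.trans hs.1) hs.2, flowCont, flowCont, hv' κ hκ.1 hκ.2.le,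
      levelDiscount_mul_flowCont, ← intervalIntegral.integral_add_adjacent_intervals
          (intervalIntegrable_claimRate h.monotone h.nonneg hcy hcκ)
          (intervalIntegrable_claimRate h.monotone h.nonneg hcκ hcs)]
    ring

end

end RiskModel

/-! ### Induction along an interval and one-sided derivatives. -/

theorem real_induction {a b : ℝ} {P : ℝ → Prop}
    (left : ∀ s ∈ Icc a b, (∀ u ∈ Ico a s, P u) → P s)
    (right : ∀ s ∈ Ico a b, (∀ u ∈ Icc a s, P u) → ∀ᶠ u in 𝓝[>] s, P u) :
    ∀ s ∈ Icc a b, P s := by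
  by_contra! hcon
  obtain ⟨s₁, hs₁, hP₁⟩ := hcon
  set bad := {s | s ∈ Icc a b ∧ ¬ P s} with hbad
  have hbdd : BddBelow bad := ⟨a, fun s hs => hs.1.1⟩
  have hne : bad.Nonempty := ⟨s₁, hs₁, hP₁⟩
  -- The first rule makes this infimum good, and the second makes a right neighbourhood of it good,
  -- so it cannot be the infimum of the bad points.
  set m := sInf bad with hm
  have ham : a ≤ m := le_csInf hne fun s hs => hs.1.1
  have hmb : m ≤ b := (csInf_le hbdd ⟨hs₁, hP₁⟩).trans hs₁.2
  have hbelow : ∀ u ∈ Ico a m, P u := fun u hu => by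
    by_contra hPu
    exact absurd (csInf_le hbdd (⟨⟨hu.1, hu.2.le.trans hmb⟩, hPu⟩ : u ∈ bad)) (not_le.2 hu.2)
  have hPm : P m := left m ⟨ham, hmb⟩ hbelow
  have hmb' : m < b := by
    rcases hmb.eq_or_lt with h | h
    · have : s₁ = m := le_antisymm (hs₁.2.trans h.ge) (csInf_le hbdd ⟨hs₁, hP₁⟩)
      exact absurd (this ▸ hPm) hP₁
    · exact h
  have hev := right m ⟨ham, hmb'⟩ fun u hu => by
    rcases hu.2.eq_or_lt with h | h
    · exact h ▸ hPm
    · exact hbelow u ⟨hu.1, h⟩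
  obtain ⟨c, hc, hgood⟩ := (mem_nhdsGT_iff_exists_Ioo_subset' hmb').1 hev
  obtain ⟨s, hs, hsc⟩ := (csInf_lt_iff hbdd hne).1 (show sInf bad < c from hc)
  have hms : m ≤ s := csInf_le hbdd hs
  rcases hms.eq_or_lt with h | h
  · exact hs.2 (h ▸ hPm)
  · exact hs.2 (hgood ⟨h, hsc⟩)

/-- A left continuous function whose upper right derivatives are nonpositive is nonincreasing. -/
theorem le_of_right_dini_nonpos {f : ℝ → ℝ} {a b : ℝ} (hab : a ≤ b)
    (hl : ∀ s ∈ Ioc a b, ContinuousWithinAt f (Iic s) s)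
    (hr : ∀ s ∈ Ico a b, ∀ ε > 0, ∀ᶠ u in 𝓝[>] s, f u ≤ f s + ε * (u - s)) : f b ≤ f a := by
  have key : ∀ ε > 0, ∀ s ∈ Icc a b, f s ≤ f a + ε * (s - a) := by
    intro ε hε
    refine real_induction (fun s hs hu => ?_) (fun s hs hu => ?_)
    · rcases hs.1.eq_or_lt with rfl | has
      · simp
      · have h1 : Tendsto f (𝓝[<] s) (𝓝 (f s)) :=
          (hl s ⟨has, hs.2⟩).mono Iio_subset_Iic_self
        have h2 : Tendsto (fun u => f a + ε * (u - a)) (𝓝[<] s) (𝓝 (f a + ε * (s - a))) :=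
          ((by fun_prop : Continuous fun u => f a + ε * (u - a)).tendsto s).mono_left
            nhdsWithin_le_nhds
        refine le_of_tendsto_of_tendsto h1 h2 ?_
        filter_upwards [Ioo_mem_nhdsLT has] with u hu'
        exact hu u ⟨hu'.1.le, hu'.2⟩
    · filter_upwards [hr s hs ε hε] with u hu'
      linarith [hu s ⟨hs.1, le_rfl⟩]
  refine le_of_forall_pos_le_add fun ε hε => ?_
  have h1 : 0 < ε / (b - a + 1) := div_pos hε (by linarith)
  refine (key _ h1 b ⟨hab, le_rfl⟩).trans ?_
  gcongr
  rw [div_mul_eq_mul_div, div_le_iff₀ (by linarith)]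
  nlinarith

theorem eventually_le_of_hasDerivWithinAt {f : ℝ → ℝ} {s : ℝ}
    (h : HasDerivWithinAt f 0 (Ici s) s) {ε : ℝ} (hε : 0 < ε) :
    ∀ᶠ u in 𝓝[>] s, f u ≤ f s + ε * (u - s) ∧ f s ≤ f u + ε * (u - s) := by
  have := (hasDerivWithinAt_iff_isLittleO.1 h).def hε
  filter_upwards [this.filter_mono (nhdsWithin_mono _ Ioi_subset_Ici_self), self_mem_nhdsWithin]
    with u hu hsu
  simp only [smul_zero, sub_zero, Real.norm_eq_abs, abs_of_pos (sub_pos.2 (mem_Ioi.1 hsu))] at hu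
  have := abs_le.1 hu
  constructor <;> linarith

/-! ### The partition of the reserve levels into bands. -/

namespace RiskModel

section

variable {Ω : Type*} [MeasurableSpace Ω] {μ : Measure Ω} [IsProbabilityMeasure μ]
  (M : RiskModel μ) {w : ℝ → ℝ}

/-- `{𝒢_w = 0}` -/
def bandA (w : ℝ → ℝ) : Set ℝ := {x | M.critical ≤ x ∧ M.generator w x = 0}

/-- `{w' = 1, 𝒢_w < 0}` -/
def bandB (w : ℝ → ℝ) : Set ℝ :=
  {x | M.critical ≤ x ∧ HasDerivAt w 1 x ∧ M.generator w x < 0}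

/-- The properties of a pair of sets of reserve levels that make it possible to follow the
corresponding band strategy. -/
structure IsBandPartition (A B : Set ℝ) : Prop where
  critical_mem : M.critical ∈ A
  isClosed : IsClosed A
  critical_le : ∀ x ∈ A, M.critical ≤ x
  isOpen : IsOpen B
  critical_lt : ∀ x ∈ B, M.critical < x
  disjoint : ∀ x ∈ A, x ∉ B
  right_open : ∀ x, M.critical ≤ x → x ∉ A → x ∉ B → ∀ᶠ s in 𝓝[>] x, s ∉ A ∧ s ∉ B
  nearest : ∀ x ∈ B, ∃ x₀ ∈ A, x₀ < x ∧ Ioc x₀ x ⊆ B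

theorem IsBandPartition.nearest_unique {A B : Set ℝ} (h : M.IsBandPartition A B) {x x₀ x₁ : ℝ}
    (h0 : x₀ ∈ A) (hx0 : x₀ < x) (hs0 : Ioc x₀ x ⊆ B) (h1 : x₁ ∈ A) (hx1 : x₁ < x)
    (hs1 : Ioc x₁ x ⊆ B) : x₀ = x₁ := by
  rcases lt_trichotomy x₀ x₁ with hlt | heq | hlt
  · exact absurd (hs0 ⟨hlt, hx1.le⟩) (h.disjoint _ h1)
  · exact heq
  · exact absurd (hs1 ⟨hlt, hx0.le⟩) (h.disjoint _ h0)

theorem generator_neg_of_notMem_bandA (h : M.IsSuper w) (hc : Continuous w) {x : ℝ}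
    (hx : M.critical ≤ x) (hA : x ∉ M.bandA w) : M.critical < x ∧ M.generator w x < 0 := by
  have hg : M.generator w x < 0 :=
    lt_of_le_of_ne (h.generator_nonpos hc hx) fun hg => hA ⟨hx, hg⟩
  refine ⟨lt_of_le_of_ne hx ?_, hg⟩
  rintro rfl
  exact hg.ne h.generator_critical

/-- The right derivative of a flow solution equals one only where the generator vanishes. -/
theorem not_hasDerivAt_one_of_flow (h : M.IsSuper w) (hc : Continuous w) {x y : ℝ}
    (hx : M.critical < x) (hg : M.generator w x < 0) (hxy : x < y)
    (hf : ∀ s ∈ Icc x y, w s = M.flowCont w x s) : ¬ HasDerivAt w 1 x := by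
  intro hd
  have h1 : HasDerivWithinAt w 1 (Ici x) x := hd.hasDerivWithinAt
  have h2 := (hasDerivAt_flowCont h.monotone h.nonneg hc hx hx).hasDerivWithinAt (s := Ici x)
  have h3 := h2.congr_of_eventuallyEq (f₁ := w) (by
    filter_upwards [Icc_mem_nhdsGE hxy] with s hs
    exact hf s hs) (hf x ⟨le_rfl, hxy.le⟩)
  have h4 := (uniqueDiffOn_Ici x x self_mem_Ici).eq_deriv _ h1 h3
  rw [flowCont_self, eq_comm, div_eq_one_iff_eq (M.drift_pos hx).ne'] at h4
  rw [generator] at hg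
  linarith

/-- In the dichotomy, derivative one at `x` excludes the flow alternative. What remains is slope one
in a whole neighbourhood, where the generator stays negative by continuity. -/
theorem bandB_mem_nhds {x : ℝ} (hx : x ∈ M.bandB M.minSuper) : M.bandB M.minSuper ∈ 𝓝 x := by
  have h := M.isSuper_minSuper
  have hc := M.continuous_minSuper
  have hcg := continuous_generator (M := M) h.monotone h.nonneg hc
  have hA : x ∉ M.bandA M.minSuper := fun hA => hx.2.2.ne hA.2
  obtain ⟨hcx, hg⟩ := M.generator_neg_of_notMem_bandA h hc hx.1 hA
  rcases minSuper_dichotomy hcx hg with hs | ⟨y, hxy, hf⟩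
  · filter_upwards [hs.eventually_nhds, Ioi_mem_nhds hcx,
      hcg.continuousAt.eventually_lt_const hg] with s hs hcs hgs
    refine ⟨le_of_lt hcs, ?_, hgs⟩
    have : HasDerivAt (fun s => M.minSuper x + (s - x)) 1 s :=
      ((hasDerivAt_id s).sub_const x).const_add _
    exact this.congr_of_eventuallyEq hs
  · exact absurd hx.2.1 (M.not_hasDerivAt_one_of_flow h hc hcx hg hxy fun s hs =>
      hf x ⟨le_rfl, hxy⟩ s hs)

/-- In the dichotomy, slope one near `x` would put `x` into `ℬ`, so the flow equation holds to the
right of `x`. The alternative is available with every starting point `κ` in a right neighbourhood,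
which keeps those levels out of `ℬ` as well. -/
theorem exists_flow_of_notMem {x : ℝ} (hx : M.critical ≤ x) (hA : x ∉ M.bandA M.minSuper)
    (hB : x ∉ M.bandB M.minSuper) : ∃ y > x, (∀ s ∈ Ico x y, s ∉ M.bandA M.minSuper ∧
      s ∉ M.bandB M.minSuper) ∧ ∀ s ∈ Icc x y, M.minSuper s = M.flowCont M.minSuper x s := by
  have h := M.isSuper_minSuper
  have hc := M.continuous_minSuper
  have hcg := continuous_generator (M := M) h.monotone h.nonneg hc
  obtain ⟨hcx, hg⟩ := M.generator_neg_of_notMem_bandA h hc hx hA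
  rcases minSuper_dichotomy hcx hg with hs | ⟨y, hxy, hf⟩
  · refine absurd ⟨hx, ?_, hg⟩ hB
    have : HasDerivAt (fun s => M.minSuper x + (s - x)) 1 x :=
      ((hasDerivAt_id x).sub_const x).const_add _
    exact this.congr_of_eventuallyEq hs
  · have hev : ∀ᶠ s in 𝓝[>] x, M.generator M.minSuper s < 0 :=
      (hcg.continuousAt.eventually_lt_const hg).filter_mono nhdsWithin_le_nhds
    obtain ⟨z, hz, hzs⟩ := (mem_nhdsGT_iff_exists_Ioo_subset' hxy).1 hev
    have hneg : ∀ s ∈ Ico x (min y z), M.generator M.minSuper s < 0 := fun s hs => by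
      rcases hs.1.eq_or_lt with rfl | hxs
      · exact hg
      · exact hzs ⟨hxs, hs.2.trans_le (min_le_right _ _)⟩
    refine ⟨min y z, lt_min hxy hz, fun s hs => ⟨fun hsA => (hneg s hs).ne hsA.2, fun hsB => ?_⟩,
      fun s hs => hf x ⟨le_rfl, hxy⟩ s ⟨hs.1, hs.2.trans (min_le_left _ _)⟩⟩
    have hsy := hs.2.trans_le (min_le_left _ _)
    exact M.not_hasDerivAt_one_of_flow h hc (hcx.trans_le hs.1) (hneg s hs) hsy
      (hf s ⟨hs.1, hsy⟩) hsB.2.1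

theorem isBandPartition_minSuper :
    M.IsBandPartition (M.bandA M.minSuper) (M.bandB M.minSuper) := by
  have h := M.isSuper_minSuper
  have hc := M.continuous_minSuper
  have hcg := continuous_generator (M := M) h.monotone h.nonneg hc
  have hcrit : M.critical ∈ M.bandA M.minSuper := ⟨le_rfl, h.generator_critical⟩
  have hopen : IsOpen (M.bandB M.minSuper) :=
    isOpen_iff_mem_nhds.2 fun x hx => M.bandB_mem_nhds hx
  have hdisj : ∀ x ∈ M.bandA M.minSuper, x ∉ M.bandB M.minSuper := fun x hA hB =>
    hB.2.2.ne hA.2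
  have hlt : ∀ x ∈ M.bandB M.minSuper, M.critical < x := fun x hx =>
    lt_of_le_of_ne hx.1 fun he => hdisj _ hcrit (he ▸ hx)
  have hright : ∀ x, M.critical ≤ x → x ∉ M.bandA M.minSuper → x ∉ M.bandB M.minSuper →
      ∀ᶠ s in 𝓝[>] x, s ∉ M.bandA M.minSuper ∧ s ∉ M.bandB M.minSuper := fun x hx hA hB => by
    obtain ⟨y, hxy, hs, -⟩ := M.exists_flow_of_notMem hx hA hB
    filter_upwards [Ioo_mem_nhdsGT hxy] with s hs'
    exact hs s ⟨hs'.1.le, hs'.2⟩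
  refine ⟨hcrit, isClosed_Ici.inter (isClosed_eq hcg continuous_const), fun x hx => hx.1, hopen,
    hlt, hdisj, hright, fun x hx => ?_⟩
  -- The stretch of `ℬ` below `x` is extended down as far as possible. Its lower end is not in `ℬ`,
  -- which is open, and not in the rest, which is open to the right; so it belongs to `𝒜`.
  set S := {z | M.critical ≤ z ∧ z ≤ x ∧ Ioc z x ⊆ M.bandB M.minSuper} with hS
  have hbdd : BddBelow S := ⟨M.critical, fun z hz => hz.1⟩
  have hxS : x ∈ S := ⟨hx.1, le_rfl, by simp⟩
  set x₀ := sInf S with hx₀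
  have hc0 : M.critical ≤ x₀ := le_csInf ⟨x, hxS⟩ fun z hz => hz.1
  have hx0 : x₀ ≤ x := csInf_le hbdd hxS
  have hsub : Ioc x₀ x ⊆ M.bandB M.minSuper := fun s hs => by
    obtain ⟨z, hz, hzs⟩ := (csInf_lt_iff hbdd ⟨x, hxS⟩).1 hs.1
    exact hz.2.2 ⟨hzs, hs.2⟩
  have hB0 : x₀ ∉ M.bandB M.minSuper := fun hB0 => by
    obtain ⟨l, hl, hsl⟩ := exists_Ioc_subset_of_mem_nhds (hopen.mem_nhds hB0) ⟨_, hlt _ hB0⟩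
    have : max l M.critical ∈ S := by
      refine ⟨le_max_right _ _, (max_lt hl (hlt _ hB0)).le.trans hx0, fun s hs => ?_⟩
      rcases le_or_gt s x₀ with h' | h'
      · exact hsl ⟨(le_max_left _ _).trans_lt hs.1, h'⟩
      · exact hsub ⟨h', hs.2⟩
    exact absurd (csInf_le hbdd this) (not_le.2 (max_lt hl (hlt _ hB0)))
  have hxlt : x₀ < x := lt_of_le_of_ne hx0 fun he => hB0 (he ▸ hx)
  refine ⟨x₀, ?_, hxlt, hsub⟩
  by_contra hA0
  obtain ⟨s, hs, hs'⟩ := ((hright x₀ hc0 hA0 hB0).and (Ioo_mem_nhdsGT hxlt)).exists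
  exact hs.2 (hsub ⟨hs'.1, hs'.2.le⟩)

theorem minSuper_sub_eq_of_subset_bandB {x₀ x : ℝ} (hx : x₀ ≤ x)
    (h : Ioc x₀ x ⊆ M.bandB M.minSuper) : M.minSuper x - M.minSuper x₀ = x - x₀ := by
  have hd : ∀ s ∈ Ioo x₀ x, HasDerivAt (fun s => M.minSuper s - s) 0 s := fun s hs => by
    exact ((h ⟨hs.1, hs.2.le⟩).2.1.sub (hasDerivAt_id s)).congr_deriv (sub_self 1)
  have hcont : Continuous fun s => M.minSuper s - s := M.continuous_minSuper.sub continuous_id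
  rcases hx.eq_or_lt with rfl | hlt
  · simp
  · obtain ⟨c, hc, hc'⟩ := exists_hasDerivAt_eq_slope _ _ hlt hcont.continuousOn hd
    have : x - x₀ ≠ 0 := by linarith
    field_simp at hc'
    linarith

end

end RiskModel

/-! ### Reserve paths between two claims. -/

theorem IntervalIntegrable.sub_interval {f : ℝ → ℝ} {a b u v : ℝ}
    (h : IntervalIntegrable f volume a b) (hab : a ≤ b) (hu : u ∈ Icc a b) (hv : v ∈ Icc a b) :
    IntervalIntegrable f volume u v :=
  h.mono_set (by rw [uIcc_of_le hab]; exact uIcc_subset_Icc hu hv)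

theorem hasDerivWithinAt_integral_of_tendsto {f : ℝ → ℝ} {a b c : ℝ} (hab : a < b)
    (hf : IntervalIntegrable f volume a b) (hc : Tendsto f (𝓝[>] a) (𝓝 c)) :
    HasDerivWithinAt (fun s => ∫ u in a..s, f u) c (Ici a) a := by
  refine intervalIntegral.integral_hasDerivWithinAt_of_tendsto_ae_right (s := Ici a) (t := Ioi a)
    (by simp) ?_ (hc.mono_left inf_le_left)
  refine ⟨Ioc a b, Ioc_mem_nhdsGT hab, ?_⟩
  exact ((intervalIntegrable_iff_integrableOn_Ioc_of_le hab.le).1 hf).aestronglyMeasurable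

theorem continuousOn_primitive_of_le {f : ℝ → ℝ} {a b : ℝ} (hab : a ≤ b)
    (hf : IntervalIntegrable f volume a b) :
    ContinuousOn (fun s => ∫ u in a..s, f u) (Icc a b) := by
  have := intervalIntegral.continuousOn_primitive_interval' hf (left_mem_uIcc)
  rwa [uIcc_of_le hab] at this

/-- **Grönwall's inequality** in integral form, without continuity. -/
theorem gronwall_nonpos {f : ℝ → ℝ} {a b K : ℝ} (hab : a ≤ b) (hK : 0 ≤ K)
    (hf : IntervalIntegrable f volume a b) (h : ∀ s ∈ Icc a b, f s ≤ K * ∫ u in a..s, f u) :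
    ∀ s ∈ Icc a b, f s ≤ 0 := by
  set F := fun s => ∫ u in a..s, f u with hF
  have hFc : ContinuousOn F (Icc a b) := continuousOn_primitive_of_le hab hf
  have hFi : IntervalIntegrable F volume a b := by
    rw [← uIcc_of_le hab] at hFc
    exact hFc.intervalIntegrable
  -- Integrating the hypothesis once more replaces `f` by its continuous primitive `F`. The
  -- primitive of `F` is then differentiable, and its product with `exp (-K s)` is nonincreasing.
  have hFle : ∀ s ∈ Icc a b, F s ≤ K * ∫ u in a..s, F u := by
    intro s hs
    rw [← intervalIntegral.integral_const_mul]
    exact intervalIntegral.integral_mono_on hs.1 (hf.sub_interval hab ⟨le_rfl, hab⟩ hs)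
      ((hFi.sub_interval hab ⟨le_rfl, hab⟩ hs).const_mul K)
      fun u hu => h u ⟨hu.1, hu.2.trans hs.2⟩
  have hΦd : ∀ s ∈ Ioo a b, HasDerivAt (fun s => ∫ u in a..s, F u) (F s) s := by
    intro s hs
    refine intervalIntegral.integral_hasDerivAt_right
      (hFi.sub_interval hab ⟨le_rfl, hab⟩ ⟨hs.1.le, hs.2.le⟩) ?_
      (hFc.continuousAt (Icc_mem_nhds hs.1 hs.2))
    exact (hFc.mono Ioo_subset_Icc_self).stronglyMeasurableAtFilter isOpen_Ioo _ hs
  have hGanti : AntitoneOn (fun s => Real.exp (-K * s) * ∫ u in a..s, F u) (Icc a b) := by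
    refine antitoneOn_of_hasDerivWithinAt_nonpos
      (f' := fun s => Real.exp (-K * s) * (-K * 1) * (∫ u in a..s, F u) + Real.exp (-K * s) * F s)
      (convex_Icc a b) ?_ ?_ ?_
    · exact (by fun_prop : Continuous fun s => Real.exp (-K * s)).continuousOn.mul
        (continuousOn_primitive_of_le hab hFi)
    · intro s hs
      rw [interior_Icc] at hs
      exact (((hasDerivAt_id s).const_mul (-K)).exp.mul (hΦd s hs)).hasDerivWithinAt
    · intro s hs
      rw [interior_Icc] at hs
      have := hFle s ⟨hs.1.le, hs.2.le⟩
      have := Real.exp_pos (-K * s)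
      nlinarith
  intro s hs
  have h1 := hGanti ⟨le_rfl, hab⟩ hs hs.1
  simp only [intervalIntegral.integral_same, mul_zero] at h1
  have h2 : ∫ u in a..s, F u ≤ 0 := by
    by_contra! hcon
    exact absurd h1 (not_le.2 (mul_pos (Real.exp_pos _) hcon))
  have h3 : F s ≤ 0 := (hFle s hs).trans (mul_nonpos_of_nonneg_of_nonpos hK h2)
  exact (h s hs).trans (mul_nonpos_of_nonneg_of_nonpos hK h3)

namespace RiskModel

section

variable {Ω : Type*} [MeasurableSpace Ω] {μ : Measure Ω} (M : RiskModel μ)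

/-- `R` is the reserve that results from the cumulated dividends `L` in a time interval
`[t₀, t₁]` without claims. -/
structure IsReservePath (R L : ℝ → ℝ) (t₀ t₁ : ℝ) : Prop where
  mono : Monotone L
  leftCont : ∀ t, ContinuousWithinAt L (Iic t) t
  le : t₀ ≤ t₁
  integrable : IntervalIntegrable (fun u => M.drift (R u)) volume t₀ t₁
  dyn : ∀ s ∈ Icc t₀ t₁, R s = R t₀ + (∫ u in t₀..s, M.drift (R u)) - (L s - L t₀)

/-- The rule by which dividends are paid at time `t` under a band strategy. -/
def BandRule (A B : Set ℝ) (R L : ℝ → ℝ) (t : ℝ) : Prop :=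
  (R t ∈ A → ∀ᶠ s in 𝓝[>] t, L s - L t = ∫ u in t..s, M.drift (R u)) ∧
  (R t ∈ B → ∃ x₀ ∈ A, x₀ < R t ∧ Ioc x₀ (R t) ⊆ B ∧
    Function.rightLim L t - L t = R t - x₀) ∧
  (M.critical ≤ R t ∧ R t ∉ A ∧ R t ∉ B → ∀ᶠ s in 𝓝[>] t, L s = L t)

variable {M} {R L : ℝ → ℝ} {t₀ t₁ : ℝ}

namespace IsReservePath

theorem integrable_sub (h : M.IsReservePath R L t₀ t₁) {u v : ℝ} (hu : u ∈ Icc t₀ t₁)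
    (hv : v ∈ Icc t₀ t₁) : IntervalIntegrable (fun u => M.drift (R u)) volume u v :=
  h.integrable.sub_interval h.le hu hv

theorem dyn_sub (h : M.IsReservePath R L t₀ t₁) {u s : ℝ} (hu : u ∈ Icc t₀ t₁)
    (hs : s ∈ Icc t₀ t₁) :
    R s = R u + (∫ v in u..s, M.drift (R v)) - (L s - L u) := by
  rw [h.dyn s hs, h.dyn u hu, ← intervalIntegral.integral_add_adjacent_intervals
    (h.integrable_sub (left_mem_Icc.2 h.le) hu) (h.integrable_sub hu hs)]
  ring

theorem sub (h : M.IsReservePath R L t₀ t₁) {a b : ℝ} (ha : t₀ ≤ a) (hab : a ≤ b) (hb : b ≤ t₁) :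
    M.IsReservePath R L a b where
  mono := h.mono
  leftCont := h.leftCont
  le := hab
  integrable := h.integrable_sub ⟨ha, hab.trans hb⟩ ⟨ha.trans hab, hb⟩
  dyn _ hs := h.dyn_sub ⟨ha, hab.trans hb⟩ ⟨ha.trans hs.1, hs.2.trans hb⟩

theorem tendsto_integral_right (h : M.IsReservePath R L t₀ t₁) {u : ℝ} (hu : u ∈ Ico t₀ t₁) :
    Tendsto (fun s => ∫ v in u..s, M.drift (R v)) (𝓝[>] u) (𝓝 0) := by
  have h1 := continuousOn_primitive_of_le hu.2.le
    (h.integrable_sub ⟨hu.1, hu.2.le⟩ (right_mem_Icc.2 h.le))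
  have h2 := h1 u ⟨le_rfl, hu.2.le⟩
  rw [ContinuousWithinAt, intervalIntegral.integral_same] at h2
  refine h2.mono_left ?_
  rw [← nhdsWithin_Ioc_eq_nhdsGT hu.2]
  exact nhdsWithin_mono _ Ioc_subset_Icc_self

theorem tendsto_right (h : M.IsReservePath R L t₀ t₁) {u : ℝ} (hu : u ∈ Ico t₀ t₁) :
    Tendsto R (𝓝[>] u) (𝓝 (R u - (Function.rightLim L u - L u))) := by
  have h1 : Tendsto (fun s => R u + (∫ v in u..s, M.drift (R v)) - (L s - L u)) (𝓝[>] u)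
      (𝓝 (R u + 0 - (Function.rightLim L u - L u))) :=
    ((h.tendsto_integral_right hu).const_add _).sub ((h.mono.tendsto_rightLim u).sub_const _)
  rw [add_zero] at h1
  refine h1.congr' ?_
  filter_upwards [Ioc_mem_nhdsGT hu.2] with s hs
  exact (h.dyn_sub ⟨hu.1, hu.2.le⟩ ⟨hu.1.trans hs.1.le, hs.2⟩).symm

theorem tendsto_left (h : M.IsReservePath R L t₀ t₁) {s : ℝ} (hs : s ∈ Ioc t₀ t₁) :
    Tendsto R (𝓝[<] s) (𝓝 (R s)) := by
  have h1 := continuousOn_primitive_of_le h.le h.integrable s ⟨hs.1.le, hs.2⟩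
  have h2 : Tendsto (fun s => ∫ u in t₀..s, M.drift (R u)) (𝓝[<] s)
      (𝓝 (∫ u in t₀..s, M.drift (R u))) := by
    refine h1.mono_left ?_
    rw [← nhdsWithin_Ico_eq_nhdsLT hs.1]
    exact nhdsWithin_mono _ fun x hx => ⟨hx.1, hx.2.le.trans hs.2⟩
  have h3 : Tendsto L (𝓝[<] s) (𝓝 (L s)) := (h.leftCont s).mono Iio_subset_Iic_self
  rw [h.dyn s ⟨hs.1.le, hs.2⟩]
  refine ((h2.const_add _).sub (h3.sub_const _)).congr' ?_
  filter_upwards [Ioo_mem_nhdsLT hs.1] with u hu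
  exact (h.dyn u ⟨hu.1.le, hu.2.le.trans hs.2⟩).symm

theorem rightLim_sub_nonneg (h : M.IsReservePath R L t₀ t₁) (u : ℝ) :
    0 ≤ Function.rightLim L u - L u := sub_nonneg.2 (h.mono.le_rightLim le_rfl)

theorem dyn_right (h : M.IsReservePath R L t₀ t₁) {u s : ℝ} (hu : u ∈ Icc t₀ t₁)
    (hs : s ∈ Icc t₀ t₁) : R s = R u - (Function.rightLim L u - L u) +
      (∫ v in u..s, M.drift (R v)) - (L s - Function.rightLim L u) := by
  rw [h.dyn_sub hu hs]; ring

/-- The composition with a continuous function is integrable, as paths are bounded. -/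
theorem intervalIntegrable_comp (h : M.IsReservePath R L t₀ t₁) {g : ℝ → ℝ} (hg : Continuous g) :
    IntervalIntegrable (fun s => g (R s)) volume t₀ t₁ := by
  have hprim := continuousOn_primitive_of_le h.le h.integrable
  rw [intervalIntegrable_iff_integrableOn_Icc_of_le h.le]
  obtain ⟨C, hC⟩ := isCompact_Icc.exists_bound_of_continuousOn hprim
  obtain ⟨D, hD⟩ := (isCompact_Icc (a := R t₀ - C - (L t₁ - L t₀)) (b := R t₀ + C)
    ).exists_bound_of_continuousOn hg.continuousOn
  have hbd : ∀ s ∈ Icc t₀ t₁, ‖g (R s)‖ ≤ D := fun s hs => by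
    have h1 := abs_le.1 (hC s hs)
    have h2 := h.mono hs.1
    have h3 := h.mono hs.2
    exact hD _ ⟨by rw [h.dyn s hs]; linarith [h1.1], by rw [h.dyn s hs]; linarith [h1.2]⟩
  have hmeas : AEStronglyMeasurable (fun s => g (R s)) (volume.restrict (Icc t₀ t₁)) := by
    have h1 : AEStronglyMeasurable (fun s => R t₀ + (∫ u in t₀..s, M.drift (R u)) - (L s - L t₀))
        (volume.restrict (Icc t₀ t₁)) :=
      ((hprim.aestronglyMeasurable measurableSet_Icc).const_add _).sub
        (h.mono.measurable.sub_const _).aestronglyMeasurable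
    refine (hg.comp_aestronglyMeasurable h1).congr ?_
    filter_upwards [ae_restrict_mem measurableSet_Icc] with s hs
    rw [h.dyn s hs]
  refine Integrable.of_bound hmeas D ?_
  filter_upwards [ae_restrict_mem measurableSet_Icc] with s hs using hbd s hs

/-- A reserve that is at or below the critical level does not get above it. -/
theorem le_critical (h : M.IsReservePath R L t₀ t₁) {u : ℝ} (hu : u ∈ Icc t₀ t₁)
    (hR : R u - (Function.rightLim L u - L u) ≤ M.critical) {s : ℝ} (hs : s ∈ Ioc u t₁) :
    R s ≤ M.critical := by
  -- The value at `u` is reset, since `R u` is the level before the lump sum and may exceed the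
  -- critical level. Only the level after the payment is controlled.
  set f : ℝ → ℝ := fun v => if v ≤ u then 0 else R v - M.critical with hf
  have hint : IntervalIntegrable (fun v => R v - M.critical) volume u t₁ :=
    (h.intervalIntegrable_comp (g := fun x => x - M.critical) (by fun_prop)).sub_interval h.le hu
      (right_mem_Icc.2 h.le)
  have hut : u ≤ t₁ := hu.2
  have hcongr : ∀ v ∈ Icc u t₁, EqOn (fun v => R v - M.critical) f (Ioo u v) := fun v hv x hx => by
    simp only [hf, if_neg (not_le.2 hx.1)]
  have hfi : IntervalIntegrable f volume u t₁ := by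
    refine hint.congr_uIoo ?_
    rw [uIoo_of_le hut]
    exact hcongr t₁ ⟨hut, le_rfl⟩
  have := gronwall_nonpos hut M.α_pos.le hfi (fun v hv => ?_) s ⟨hs.1.le, hs.2⟩
  · simp only [hf, if_neg (not_le.2 hs.1)] at this
    linarith
  · rcases hv.1.eq_or_lt with rfl | huv
    · simp [hf]
    · have hvI : v ∈ Icc t₀ t₁ := ⟨hu.1.trans hv.1, hv.2⟩
      have e : ∫ x in u..v, f x = ∫ x in u..v, (R x - M.critical) := by
        refine intervalIntegral.integral_congr_uIoo ?_
        rw [uIoo_of_le hv.1]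
        exact (hcongr v hv).symm
      have h1 : ∫ x in u..v, M.drift (R x) ≤ ∫ x in u..v, M.α * (R x - M.critical) :=
        intervalIntegral.integral_mono_on hv.1 (h.integrable_sub hu hvI)
          ((hint.sub_interval hut ⟨le_rfl, hut⟩ hv).const_mul _) fun x _ => M.drift_le_α _
      rw [intervalIntegral.integral_const_mul] at h1
      have h2 : Function.rightLim L u ≤ L v := h.mono.rightLim_le huv
      simp only [hf, if_neg (not_le.2 huv)] at *
      rw [e, h.dyn_right hu hvI]
      linarith

variable {A B : Set ℝ}

/-- Levels in `A` are never left. -/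
theorem eq_of_mem_A (h : M.IsReservePath R L t₀ t₁) (hr : ∀ t ∈ Ico t₀ t₁, M.BandRule A B R L t)
    {v : ℝ} (hv : v ∈ Icc t₀ t₁) (hA : R v ∈ A) : ∀ s ∈ Icc v t₁, R s = R v := by
  refine real_induction (fun s hs hind => ?_) (fun s hs hind => ?_)
  · rcases hs.1.eq_or_lt with rfl | hvs
    · rfl
    · refine tendsto_nhds_unique (h.tendsto_left ⟨hv.1.trans_lt hvs, hs.2⟩)
        (tendsto_const_nhds.congr' ?_)
      filter_upwards [Ioo_mem_nhdsLT hvs] with u hu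
      exact (hind u ⟨hu.1.le, hu.2⟩).symm
  · have hRs := hind s ⟨hs.1, le_rfl⟩
    have hsI : s ∈ Ico t₀ t₁ := ⟨hv.1.trans hs.1, hs.2⟩
    filter_upwards [(hr s hsI).1 (hRs ▸ hA), Ioc_mem_nhdsGT hs.2] with u hu hu'
    rw [h.dyn_sub ⟨hsI.1, hsI.2.le⟩ ⟨hsI.1.trans hu'.1.le, hu'.2⟩, hu, hRs]
    ring

/-- After a lump sum payment, the reserve stays at the level to which it was taken. -/
theorem eventually_eq_of_mem_B (hp : M.IsBandPartition A B) (h : M.IsReservePath R L t₀ t₁)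
    (hr : ∀ t ∈ Ico t₀ t₁, M.BandRule A B R L t) {t : ℝ} (ht : t ∈ Ico t₀ t₁) {x₀ : ℝ}
    (hx₀ : x₀ ∈ A) (hlt : x₀ < R t) (hsub : Ioc x₀ (R t) ⊆ B)
    (hjump : Function.rightLim L t - L t = R t - x₀)
    (hcrit : ∀ᶠ s in 𝓝[>] t, M.critical ≤ R s) : ∀ᶠ s in 𝓝[>] t, R s = x₀ := by
  have hlim : Tendsto R (𝓝[>] t) (𝓝 x₀) := by
    have := h.tendsto_right ht
    rwa [hjump, sub_sub_cancel] at this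
  -- The lump sum only gives the right limit `x₀`; the rule for later times sees levels near `x₀`,
  -- not `x₀` itself. If `A` is visited arbitrarily soon after `t`, the path is constant there by
  -- absorption, and the constant is the limit `x₀`.
  by_cases H : ∀ t' ∈ Ioo t t₁, ∃ v ∈ Ioo t t', R v ∈ A
  · have hconst : ∀ s ∈ Ioo t t₁, ∀ s' ∈ Ioo t t₁, R s = R s' := by
      intro s hs s' hs'
      obtain ⟨v, hv, hvA⟩ := H (min s s') ⟨lt_min hs.1 hs'.1, (min_le_left _ _).trans_lt hs.2⟩
      have hv1 := hv.2.trans_le (min_le_left _ _)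
      have hv2 := hv.2.trans_le (min_le_right _ _)
      have hvI : v ∈ Icc t₀ t₁ := ⟨ht.1.trans hv.1.le, (hv1.trans hs.2).le⟩
      rw [h.eq_of_mem_A hr hvI hvA s ⟨hv1.le, hs.2.le⟩, h.eq_of_mem_A hr hvI hvA s' ⟨hv2.le, hs'.2.le⟩]
    filter_upwards [Ioo_mem_nhdsGT ht.2] with s hs
    refine tendsto_nhds_unique (tendsto_const_nhds.congr' ?_) hlim
    filter_upwards [Ioo_mem_nhdsGT ht.2] with s' hs'
    exact hconst s hs s' hs'
  · exfalso
    push Not at H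
    obtain ⟨t', ht', hnA⟩ := H
    obtain ⟨t₂, ht₂, hgood⟩ := (mem_nhdsGT_iff_exists_Ioo_subset' ht'.1).1
      (hcrit.and (hlim.eventually_lt_const hlt))
    set b := min t' t₂ with hb
    have htb : t < b := lt_min ht'.1 ht₂
    have hbt : b ≤ t₁ := (min_le_left _ _).trans ht'.2.le
    have hgoodb : ∀ s ∈ Ioo t b, R s ∉ A ∧ M.critical ≤ R s ∧ R s < R t := fun s hs =>
      ⟨hnA s ⟨hs.1, hs.2.trans_le (min_le_left _ _)⟩, hgood ⟨hs.1, hs.2.trans_le (min_le_right _ _)⟩⟩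
    -- At every time spent in `B` the dividends jump, and a monotone function has only countably
    -- many jumps. So `B` cannot be occupied throughout an interval of times.
    have hdense : ∀ t'' ∈ Ioo t b, ∃ v ∈ Ioo t t'', R v ∉ B := by
      intro t'' ht''
      by_contra! hall
      have hcount : (Ioo t t'').Countable := by
        refine Countable.mono (s₂ := {v | ¬ ContinuousAt L v}) (fun v hv hcont => ?_)
          h.mono.countable_not_continuousAt
        obtain ⟨x₁, -, hx₁, -, hj⟩ := (hr v ⟨ht.1.trans hv.1.le,
          (hv.2.trans ht''.2).trans_le hbt⟩).2.1 (hall v hv)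
        have : Function.rightLim L v = L v :=
          rightLim_eq_of_tendsto (hcont.tendsto.mono_left nhdsWithin_le_nhds)
        linarith
      have := hcount.measure_zero volume
      simp only [Real.volume_Ioo, ENNReal.ofReal_eq_zero] at this
      linarith [ht''.1]
    -- Outside `A` and `B` nothing is paid and the reserve does not fall. It stays outside `B`
    -- because the third band is open to the right and `B` is open.
    have hstay : ∀ v ∈ Ioo t b, R v ∉ B → ∀ b' ∈ Ioo v b, ∀ s ∈ Icc v b', R s ∉ B ∧ R v ≤ R s := by
      intro v hv hvB b' hb'
      refine real_induction (fun s hs hind => ?_) (fun s hs hind => ?_)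
      · rcases hs.1.eq_or_lt with rfl | hvs
        · exact ⟨hvB, le_rfl⟩
        · have hsI : s ∈ Ioc t₀ t₁ := ⟨ht.1.trans_lt (hv.1.trans hvs),
            (hs.2.trans hb'.2.le).trans hbt⟩
          have hl := h.tendsto_left hsI
          refine ⟨fun hsB => ?_, ge_of_tendsto hl ?_⟩
          · obtain ⟨u, hu, hu'⟩ := ((hl.eventually (hp.isOpen.mem_nhds hsB)).and
              (Ioo_mem_nhdsLT hvs)).exists
            exact (hind u ⟨hu'.1.le, hu'.2⟩).1 hu
          · filter_upwards [Ioo_mem_nhdsLT hvs] with u hu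
            exact (hind u ⟨hu.1.le, hu.2⟩).2
      · have hsb : s ∈ Ioo t b := ⟨hv.1.trans_le hs.1, hs.2.trans hb'.2⟩
        have hsI : s ∈ Ico t₀ t₁ := ⟨ht.1.trans hsb.1.le, hsb.2.trans_le hbt⟩
        obtain ⟨hsA, hsc, -⟩ := hgoodb s hsb
        obtain ⟨hsB, hvs⟩ := hind s ⟨hs.1, le_rfl⟩
        have hL := (hr s hsI).2.2 ⟨hsc, hsA, hsB⟩
        have hRs : Tendsto R (𝓝[>] s) (𝓝 (R s)) := by
          have h1 := h.tendsto_right hsI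
          rwa [rightLim_eq_of_tendsto (tendsto_const_nhds.congr' (hL.mono fun u hu => hu.symm)),
            sub_self, sub_zero] at h1
        obtain ⟨z, hz, hzs⟩ := (mem_nhdsGT_iff_exists_Ioo_subset' (lt_add_one (R s))).1
          (hp.right_open _ hsc hsA hsB)
        filter_upwards [hL, Ioo_mem_nhdsGT hsb.2, hRs.eventually_lt_const hz] with u hu hub huz
        have hge : R s ≤ R u := by
          rw [h.dyn_sub (u := s) (s := u) ⟨hsI.1, hsI.2.le⟩ ⟨hsI.1.trans hub.1.le, hub.2.le.trans hbt⟩, hu]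
          have : 0 ≤ ∫ x in s..u, M.drift (R x) :=
            intervalIntegral.integral_nonneg hub.1.le fun x hx =>
              M.drift_nonneg (hgoodb x ⟨hsb.1.trans_le hx.1, hx.2.trans_lt hub.2⟩).2.1
          linarith
        refine ⟨?_, hvs.trans hge⟩
        rcases hge.eq_or_lt with he | he
        · rwa [← he]
        · exact (hzs ⟨he, huz⟩).2
    have hmid : (t + b) / 2 ∈ Ioo t b := ⟨by linarith, by linarith⟩
    have hbefore : ∀ a ∈ Ioo t ((t + b) / 2), ∃ v ∈ Ioo t a, R v ≤ R ((t + b) / 2) ∧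
        R ((t + b) / 2) ∉ B := by
      intro a ha
      obtain ⟨v, hv, hvB⟩ := hdense a ⟨ha.1, ha.2.trans hmid.2⟩
      have hvm := hv.2.trans ha.2
      obtain ⟨h1, h2⟩ := hstay v ⟨hv.1, hvm.trans hmid.2⟩ hvB (((t + b) / 2 + b) / 2)
        ⟨by linarith [hmid.2], by linarith [hmid.2]⟩ _ ⟨hvm.le, by linarith [hmid.2]⟩
      exact ⟨v, hv, h2, h1⟩
    -- The level at the midpoint dominates levels at times arbitrarily close to `t`, which tend to
    -- `x₀`. It then lies between `x₀` and `R t` but neither in `A` nor in `B`, although that range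
    -- is contained in their union.
    have hxm : x₀ ≤ R ((t + b) / 2) := by
      by_contra! hcon
      obtain ⟨a, ha, hav⟩ := (mem_nhdsGT_iff_exists_Ioo_subset' hmid.1).1
        (hlim.eventually_const_lt hcon)
      obtain ⟨v, hv, hvle, -⟩ := hbefore (min a ((t + (t + b) / 2) / 2))
        ⟨lt_min ha (by linarith [hmid.1]), (min_le_right _ _).trans_lt (by linarith [hmid.1])⟩
      exact absurd (hav ⟨hv.1, hv.2.trans_le (min_le_left _ _)⟩) (not_lt.2 hvle)
    obtain ⟨v, -, -, hmB⟩ := hbefore ((t + (t + b) / 2) / 2)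
      ⟨by linarith [hmid.1], by linarith [hmid.1]⟩
    obtain ⟨hmA, -, hmt⟩ := hgoodb _ hmid
    rcases hxm.eq_or_lt with he | he
    · exact hmA (he ▸ hx₀)
    · exact hmB (hsub ⟨he, hmt.le⟩)

end IsReservePath

end

end RiskModel

/-! ### Discounted dividends as Stieltjes integrals. -/

section Discounted

variable {L : ℝ → ℝ}

/-- The Stieltjes function of `L` is its right-continuous modification. The left-continuous `L` is
recovered as its left limit, so that half-open intervals `[a, b)` have mass `L b - L a`. -/
theorem leftLim_stieltjesFunction (hL : Monotone L)
    (hc : ∀ t, ContinuousWithinAt L (Iic t) t) (t : ℝ) :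
    Function.leftLim hL.stieltjesFunction t = L t := by
  refine leftLim_eq_of_tendsto ?_
  have h1 : Tendsto L (𝓝[<] t) (𝓝 (L t)) := (hc t).mono Iio_subset_Iic_self
  refine tendsto_of_tendsto_of_tendsto_of_le_of_le' h1 tendsto_const_nhds ?_ ?_
  · filter_upwards with s
    rw [hL.stieltjesFunction_eq]
    exact hL.le_rightLim le_rfl
  · filter_upwards [self_mem_nhdsWithin] with s hs
    rw [hL.stieltjesFunction_eq]
    exact hL.rightLim_le hs

variable (hL : Monotone L) (hc : ∀ t, ContinuousWithinAt L (Iic t) t)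
include hc

theorem measureReal_Ico_stieltjes {a b : ℝ} (hab : a ≤ b) :
    hL.stieltjesFunction.measure.real (Ico a b) = L b - L a := by
  rw [Measure.real, StieltjesFunction.measure_Ico, leftLim_stieltjesFunction hL hc,
    leftLim_stieltjesFunction hL hc, ENNReal.toReal_ofReal (sub_nonneg.2 (hL hab))]

theorem measureReal_singleton_stieltjes (a : ℝ) :
    hL.stieltjesFunction.measure.real {a} = Function.rightLim L a - L a := by
  rw [Measure.real, StieltjesFunction.measure_singleton, leftLim_stieltjesFunction hL hc,
    hL.stieltjesFunction_eq, ENNReal.toReal_ofReal (sub_nonneg.2 (hL.le_rightLim le_rfl))]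

theorem measureReal_Ioo_stieltjes {a b : ℝ} (hab : a < b) :
    hL.stieltjesFunction.measure.real (Ioo a b) = L b - Function.rightLim L a := by
  rw [Measure.real, StieltjesFunction.measure_Ioo, leftLim_stieltjesFunction hL hc,
    hL.stieltjesFunction_eq, ENNReal.toReal_ofReal (sub_nonneg.2 (hL.rightLim_le hab))]

omit hc in
theorem integrableOn_exp_stieltjes (δ a b : ℝ) :
    IntegrableOn (fun t => Real.exp (-δ * t)) (Icc a b) hL.stieltjesFunction.measure :=
  (by fun_prop : Continuous fun t => Real.exp (-δ * t)).continuousOn.integrableOn_compact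
    isCompact_Icc

omit hc in
theorem exp_mul_measureReal_le {δ a b : ℝ} (hδ : 0 ≤ δ) {s : Set ℝ} (hs : MeasurableSet s)
    (hsub : s ⊆ Icc a b) : Real.exp (-δ * b) * hL.stieltjesFunction.measure.real s ≤
      ∫ t in s, Real.exp (-δ * t) ∂hL.stieltjesFunction.measure := by
  have hfin : hL.stieltjesFunction.measure s ≠ ∞ :=
    ((measure_mono hsub).trans_lt isCompact_Icc.measure_lt_top).ne
  rw [mul_comm, ← smul_eq_mul, ← setIntegral_const]
  refine setIntegral_mono_on (integrableOn_const hfin)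
    ((integrableOn_exp_stieltjes hL δ a b).mono_set hsub) hs fun t ht => ?_
  exact Real.exp_le_exp.2 (by nlinarith [(hsub ht).2])

omit hc in
theorem le_exp_mul_measureReal {δ a b : ℝ} (hδ : 0 ≤ δ) {s : Set ℝ} (hs : MeasurableSet s)
    (hsub : s ⊆ Icc a b) : ∫ t in s, Real.exp (-δ * t) ∂hL.stieltjesFunction.measure ≤
      Real.exp (-δ * a) * hL.stieltjesFunction.measure.real s := by
  have hfin : hL.stieltjesFunction.measure s ≠ ∞ :=
    ((measure_mono hsub).trans_lt isCompact_Icc.measure_lt_top).ne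
  rw [mul_comm (Real.exp _), ← smul_eq_mul, ← setIntegral_const]
  refine setIntegral_mono_on ((integrableOn_exp_stieltjes hL δ a b).mono_set hsub)
    (integrableOn_const hfin) hs fun t ht => ?_
  exact Real.exp_le_exp.2 (by nlinarith [(hsub ht).1])

theorem integral_Ico_stieltjes_le {δ a b : ℝ} (hδ : 0 ≤ δ) (hab : a ≤ b) :
    ∫ t in Ico a b, Real.exp (-δ * t) ∂hL.stieltjesFunction.measure ≤
      Real.exp (-δ * a) * (L b - L a) := by
  rw [← measureReal_Ico_stieltjes hL hc hab]
  exact le_exp_mul_measureReal hL hδ measurableSet_Ico Ico_subset_Icc_self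

omit hc in
theorem integral_singleton_stieltjes (δ a : ℝ) :
    ∫ t in {a}, Real.exp (-δ * t) ∂hL.stieltjesFunction.measure =
      hL.stieltjesFunction.measure.real {a} * Real.exp (-δ * a) := by
  rw [integral_singleton, smul_eq_mul]

/-- The lump sum at `a` keeps its exact discount factor. Only the remainder, which vanishes as `b`
decreases to `a`, is discounted to the later time `b`. -/
theorem le_integral_Ico_stieltjes {δ a b : ℝ} (hδ : 0 ≤ δ) (hab : a < b) :
    Real.exp (-δ * a) * (Function.rightLim L a - L a) +
      Real.exp (-δ * b) * (L b - Function.rightLim L a) ≤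
    ∫ t in Ico a b, Real.exp (-δ * t) ∂hL.stieltjesFunction.measure := by
  have hI := integrableOn_exp_stieltjes hL δ a b
  have hs : ({a} : Set ℝ) ⊆ Icc a b := by simpa using hab.le
  rw [← Ioo_union_left hab, union_comm, setIntegral_union (by simp) measurableSet_Ioo
    (hI.mono_set hs) (hI.mono_set Ioo_subset_Icc_self),
    integral_singleton_stieltjes, measureReal_singleton_stieltjes hL hc,
    ← measureReal_Ioo_stieltjes hL hc hab, mul_comm]
  gcongr
  exact exp_mul_measureReal_le hL hδ measurableSet_Ioo Ioo_subset_Icc_self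

omit hc in
theorem integral_Ico_add_integral_Ico (δ : ℝ) {a b c : ℝ} (hab : a ≤ b) (hbc : b ≤ c) :
    ∫ t in Ico a c, Real.exp (-δ * t) ∂hL.stieltjesFunction.measure =
      (∫ t in Ico a b, Real.exp (-δ * t) ∂hL.stieltjesFunction.measure) +
      ∫ t in Ico b c, Real.exp (-δ * t) ∂hL.stieltjesFunction.measure := by
  have hI := integrableOn_exp_stieltjes hL δ a c
  rw [← Ico_union_Ico_eq_Ico hab hbc, setIntegral_union Ico_disjoint_Ico_same measurableSet_Ico
    (hI.mono_set fun x hx => ⟨hx.1, hx.2.le.trans hbc⟩)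
    (hI.mono_set fun x hx => ⟨hab.trans hx.1, hx.2.le⟩)]

end Discounted

/-! ### The balance of discounted value between claims: upper bound. -/

namespace RiskModel

section

variable {Ω : Type*} [MeasurableSpace Ω] {μ : Measure Ω} [IsProbabilityMeasure μ]
  {M : RiskModel μ} {w R L : ℝ → ℝ} {t₀ t₁ : ℝ}

/-- The discounted rate at which, for the value function `w`, claims reduce the value. -/
noncomputable def claimLoss (M : RiskModel μ) (w : ℝ → ℝ) (R : ℝ → ℝ) (s : ℝ) : ℝ :=
  Real.exp (-M.δ * s) * (M.lam * (w (R s) - M.afterClaim w (R s)))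

/-- Discounted dividends of the time set `s`. -/
noncomputable def paid (M : RiskModel μ) (hL : Monotone L) (s : Set ℝ) : ℝ :=
  ∫ t in s, Real.exp (-M.δ * t) ∂hL.stieltjesFunction.measure

theorem claimLoss_eq_zero (h : M.IsSuper w) {s : ℝ} (hs : R s ≤ M.critical) :
    M.claimLoss w R s = 0 := by
  rw [claimLoss, h.zero _ hs, afterClaim_eq_zero h.zero hs]
  ring

namespace IsReservePath

theorem intervalIntegrable_claimLoss (hw : M.IsSuper w) (hc : Continuous w)
    (h : M.IsReservePath R L t₀ t₁) : IntervalIntegrable (M.claimLoss w R) volume t₀ t₁ := by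
  have h1 := continuous_afterClaim (M := M) hw.monotone hw.nonneg hc
  have h2 := h.intervalIntegrable_comp (g := fun x => M.lam * (w x - M.afterClaim w x))
    (by fun_prop)
  exact h2.continuousOn_mul (by fun_prop : Continuous fun s => Real.exp (-M.δ * s)).continuousOn

theorem tendsto_claimLoss (hw : M.IsSuper w) (hc : Continuous w) {u κ : ℝ}
    (hκ : Tendsto R (𝓝[>] u) (𝓝 κ)) : Tendsto (M.claimLoss w R) (𝓝[>] u)
      (𝓝 (Real.exp (-M.δ * u) * (M.lam * (w κ - M.afterClaim w κ)))) := by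
  have h1 := continuous_afterClaim (M := M) hw.monotone hw.nonneg hc
  have h2 : Tendsto (fun x => M.lam * (w x - M.afterClaim w x)) (𝓝 κ)
      (𝓝 (M.lam * (w κ - M.afterClaim w κ))) :=
    (by fun_prop : Continuous fun x => M.lam * (w x - M.afterClaim w x)).tendsto κ
  exact (((by fun_prop : Continuous fun s => Real.exp (-M.δ * s)).tendsto u).mono_left
    nhdsWithin_le_nhds).mul (h2.comp hκ)

/-- Discounted value plus discounted dividends so far, compensated for the claims. -/
noncomputable def balance (M : RiskModel μ) (w R : ℝ → ℝ) (hL : Monotone L) (t₀ s : ℝ) : ℝ :=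
  Real.exp (-M.δ * s) * w (R s) + M.paid hL (Ico t₀ s) - ∫ u in t₀..s, M.claimLoss w R u

theorem balance_self (hL : Monotone L) :
    balance M w R hL t₀ t₀ = Real.exp (-M.δ * t₀) * w (R t₀) := by
  simp [balance, paid]

theorem balance_sub (hw : M.IsSuper w) (hc : Continuous w) (h : M.IsReservePath R L t₀ t₁)
    {u s : ℝ} (hu : t₀ ≤ u) (hus : u ≤ s) (hs : s ≤ t₁) :
    balance M w R h.mono t₀ s - balance M w R h.mono t₀ u = Real.exp (-M.δ * s) * w (R s) -
      Real.exp (-M.δ * u) * w (R u) + M.paid h.mono (Ico u s) -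
      ∫ v in u..s, M.claimLoss w R v := by
  have hi := h.intervalIntegrable_claimLoss hw hc
  have hu' : u ∈ Icc t₀ t₁ := ⟨hu, hus.trans hs⟩
  rw [balance, balance, paid, integral_Ico_add_integral_Ico h.mono M.δ hu hus,
    ← intervalIntegral.integral_add_adjacent_intervals
      (hi.sub_interval h.le (left_mem_Icc.2 h.le) hu')
      (hi.sub_interval h.le hu' ⟨hu.trans hus, hs⟩), paid, paid]
  ring

theorem balance_leftCont (hw : M.IsSuper w) (hc : Continuous w) (h : M.IsReservePath R L t₀ t₁)
    {s : ℝ} (hs : s ∈ Ioc t₀ t₁) :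
    ContinuousWithinAt (balance M w R h.mono t₀) (Iic s) s := by
  rw [← continuousWithinAt_sdiff_self, Iic_sdiff_right]
  have h1 : Tendsto (fun u => Real.exp (-M.δ * u) * w (R u)) (𝓝[<] s)
      (𝓝 (Real.exp (-M.δ * s) * w (R s))) :=
    (((by fun_prop : Continuous fun s => Real.exp (-M.δ * s)).tendsto s).mono_left
      nhdsWithin_le_nhds).mul ((hc.tendsto _).comp (h.tendsto_left hs))
  have h2 : Tendsto (fun u => ∫ v in t₀..u, M.claimLoss w R v) (𝓝[<] s)
      (𝓝 (∫ v in t₀..s, M.claimLoss w R v)) := by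
    refine (continuousOn_primitive_of_le h.le (h.intervalIntegrable_claimLoss hw hc) s
      ⟨hs.1.le, hs.2⟩).mono_left ?_
    rw [← nhdsWithin_Ico_eq_nhdsLT hs.1]
    exact nhdsWithin_mono _ fun x hx => ⟨hx.1, hx.2.le.trans hs.2⟩
  have h3 : Tendsto (fun u => M.paid h.mono (Ico t₀ u)) (𝓝[<] s)
      (𝓝 (M.paid h.mono (Ico t₀ s))) := by
    have hL : Tendsto L (𝓝[<] s) (𝓝 (L s)) := (h.leftCont s).mono Iio_subset_Iic_self
    have hz : Tendsto (fun u => M.paid h.mono (Ico t₀ s) -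
        Real.exp (-M.δ * t₀) * (L s - L u)) (𝓝[<] s)
        (𝓝 (M.paid h.mono (Ico t₀ s) - Real.exp (-M.δ * t₀) * (L s - L s))) :=
      tendsto_const_nhds.sub ((tendsto_const_nhds.sub hL).const_mul _)
    rw [sub_self, mul_zero, sub_zero] at hz
    refine tendsto_of_tendsto_of_tendsto_of_le_of_le' hz tendsto_const_nhds ?_ ?_
    · filter_upwards [Ioo_mem_nhdsLT hs.1] with u hu
      have e := integral_Ico_add_integral_Ico h.mono M.δ hu.1.le hu.2.le
      have := integral_Ico_stieltjes_le h.mono h.leftCont M.δ_pos.le hu.2.le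
      have h4 : Real.exp (-M.δ * u) * (L s - L u) ≤ Real.exp (-M.δ * t₀) * (L s - L u) := by
        refine mul_le_mul_of_nonneg_right (Real.exp_le_exp.2 ?_) (sub_nonneg.2 (h.mono hu.2.le))
        nlinarith [M.δ_pos, hu.1]
      simp only [paid]
      linarith
    · filter_upwards [Ioo_mem_nhdsLT hs.1] with u hu
      have e := integral_Ico_add_integral_Ico h.mono M.δ hu.1.le hu.2.le
      have : 0 ≤ ∫ t in Ico u s, Real.exp (-M.δ * t) ∂h.mono.stieltjesFunction.measure :=
        integral_nonneg fun _ => (Real.exp_pos _).le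
      simp only [paid]
      linarith
  exact (h1.add h3).sub h2

theorem hasDerivWithinAt_integral_drift (h : M.IsReservePath R L t₀ t₁) {u κ : ℝ}
    (hu : u ∈ Ico t₀ t₁) (hκ : Tendsto R (𝓝[>] u) (𝓝 κ)) :
    HasDerivWithinAt (fun s => ∫ v in u..s, M.drift (R v)) (M.drift κ) (Ici u) u :=
  hasDerivWithinAt_integral_of_tendsto hu.2
    (h.integrable_sub ⟨hu.1, hu.2.le⟩ (right_mem_Icc.2 h.le))
    ((M.continuous_drift.tendsto κ).comp hκ)

theorem hasDerivWithinAt_integral_claimLoss (hw : M.IsSuper w) (hc : Continuous w)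
    (h : M.IsReservePath R L t₀ t₁) {u κ : ℝ}
    (hu : u ∈ Ico t₀ t₁) (hκ : Tendsto R (𝓝[>] u) (𝓝 κ)) :
    HasDerivWithinAt (fun s => ∫ v in u..s, M.claimLoss w R v)
      (Real.exp (-M.δ * u) * (M.lam * (w κ - M.afterClaim w κ))) (Ici u) u :=
  hasDerivWithinAt_integral_of_tendsto hu.2
    ((h.intervalIntegrable_claimLoss hw hc).sub_interval h.le ⟨hu.1, hu.2.le⟩
      (right_mem_Icc.2 h.le)) (tendsto_claimLoss hw hc hκ)

theorem hasDerivAt_exp_neg (δ u : ℝ) :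
    HasDerivAt (fun s => Real.exp (-δ * s)) (-δ * Real.exp (-δ * u)) u :=
  (((hasDerivAt_id u).const_mul (-δ)).exp).congr_deriv (by simp; ring)

/-- The change of the discounted value along the flow without dividends. -/
theorem hasDerivWithinAt_flow (hw : M.IsSuper w) (hc : Continuous w)
    (h : M.IsReservePath R L t₀ t₁) {u κ : ℝ} (hu : u ∈ Ico t₀ t₁)
    (hκ : Tendsto R (𝓝[>] u) (𝓝 κ)) (hκc : M.critical < κ) :
    HasDerivWithinAt (fun s => Real.exp (-M.δ * s) *
      M.flowCont w κ (κ + ∫ v in u..s, M.drift (R v)) - ∫ v in u..s, M.claimLoss w R v)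
      0 (Ici u) u := by
  have h1 := (h.hasDerivWithinAt_integral_drift hu hκ).const_add κ
  have h2 : HasDerivAt (M.flowCont w κ)
      (((M.lam + M.δ) * M.flowCont w κ κ - M.lam * M.afterClaim w κ) / M.drift κ)
      (κ + ∫ v in u..u, M.drift (R v)) := by
    rw [intervalIntegral.integral_same, add_zero]
    exact hasDerivAt_flowCont hw.monotone hw.nonneg hc hκc hκc
  have h3 := ((hasDerivAt_exp_neg M.δ u).hasDerivWithinAt (s := Ici u)).mul
    (h2.comp_hasDerivWithinAt u h1)
  refine (h3.sub (h.hasDerivWithinAt_integral_claimLoss hw hc hu hκ)).congr_deriv ?_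
  have := (M.drift_pos hκc).ne'
  simp only [Function.comp, intervalIntegral.integral_same, add_zero, flowCont_self]
  field_simp
  ring

/-- A lump sum down to or below the critical level would keep the reserve there afterwards, contrary
to solvency up to `b`. -/
theorem rightLim_gt_critical (h : M.IsReservePath R L t₀ t₁) {b : ℝ} (hb : b ≤ t₁)
    (hR : ∀ s ∈ Ico t₀ b, M.critical < R s) {u : ℝ} (hu : u ∈ Ico t₀ b) :
    M.critical < R u - (Function.rightLim L u - L u) := by
  by_contra! hcon
  have hm : (u + b) / 2 ∈ Ioo u b := ⟨by linarith [hu.2], by linarith [hu.2]⟩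
  have := h.le_critical ⟨hu.1, hu.2.le.trans hb⟩ hcon ⟨hm.1, hm.2.le.trans hb⟩
  exact absurd (hR _ ⟨hu.1.trans hm.1.le, hm.2⟩) (not_lt.2 this)

/-- Before ruin, no dividend strategy does better than the supersolution. -/
theorem balance_le (hw : M.IsSuper w) (hc : Continuous w) (h : M.IsReservePath R L t₀ t₁)
    {b : ℝ} (hb : b ∈ Icc t₀ t₁) (hR : ∀ s ∈ Ico t₀ b, M.critical < R s) :
    balance M w R h.mono t₀ b ≤ balance M w R h.mono t₀ t₀ := by
  refine le_of_right_dini_nonpos hb.1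
    (fun s hs => h.balance_leftCont hw hc ⟨hs.1, hs.2.trans hb.2⟩) fun u hu ε hε => ?_
  have huI : u ∈ Ico t₀ t₁ := ⟨hu.1, hu.2.trans_le hb.2⟩
  -- The level just after the lump sum at `u`. The lump sum is paid for by slope one between `κ` and
  -- `R u`, the later dividends by slope one below the flow, and the flow itself by `le_flowCont`.
  set κ := R u - (Function.rightLim L u - L u) with hκdef
  have hκ : Tendsto R (𝓝[>] u) (𝓝 κ) := h.tendsto_right huI
  have hκc : M.critical < κ := h.rightLim_gt_critical hb.2 hR hu
  have hJ := h.rightLim_sub_nonneg u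
  have hd := eventually_le_of_hasDerivWithinAt (h.hasDerivWithinAt_flow hw hc huI hκ hκc)
    (half_pos hε)
  have hexp := eventually_le_of_hasDerivWithinAt
    (f := fun s => Real.exp (-M.δ * s) + M.δ * Real.exp (-M.δ * u) * s) (s := u)
    (((hasDerivAt_exp_neg M.δ u).add ((hasDerivAt_id u).const_mul _)).hasDerivWithinAt.congr_deriv
      (by simp)) one_pos
  -- A bound for the rate at which the discount factor falls to the right of `u`, with the slack `1`
  -- from `hexp`.
  set D := 1 + M.δ * Real.exp (-M.δ * u) with hD
  have hD0 : 0 < D := by have := M.δ_pos; positivity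
  have hLlim : ∀ᶠ s in 𝓝[>] u, L s - Function.rightLim L u < ε / 2 / D := by
    refine ((h.mono.tendsto_rightLim u).sub_const _).eventually_lt_const ?_
    rw [sub_self]
    positivity
  filter_upwards [hd, hexp, hLlim, Ioo_mem_nhdsGT hu.2] with s hds hes hLs hs
  have hsI : s ∈ Icc t₀ t₁ := ⟨hu.1.trans hs.1.le, hs.2.le.trans hb.2⟩
  have hsb := h.balance_sub hw hc hu.1 hs.1.le hsI.2
  have hpaid : M.paid h.mono (Ico u s) ≤ Real.exp (-M.δ * u) * (L s - L u) :=
    integral_Ico_stieltjes_le h.mono h.leftCont M.δ_pos.le hs.1.le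
  have hRs := h.dyn_right ⟨huI.1, huI.2.le⟩ hsI
  rw [← hκdef] at hRs
  have hLs0 : 0 ≤ L s - Function.rightLim L u := sub_nonneg.2 (h.mono.rightLim_le hs.1)
  have hI0 : 0 ≤ ∫ v in u..s, M.drift (R v) :=
    intervalIntegral.integral_nonneg hs.1.le fun v hv =>
      M.drift_nonneg (hR v ⟨hu.1.trans hv.1, hv.2.trans_lt hs.2⟩).le
  have hcs : M.critical < R s := hR s ⟨hsI.1, hs.2⟩
  have hW1 := hw.slope (R s) (κ + ∫ v in u..s, M.drift (R v)) hcs.le (by linarith)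
  have hW2 := hw.le_flowCont hκc (show κ ≤ κ + ∫ v in u..s, M.drift (R v) by linarith)
  have hW3 := hw.slope κ (R u) hκc.le (by linarith)
  have hE : 0 < Real.exp (-M.δ * s) := Real.exp_pos _
  have hE' : 0 < Real.exp (-M.δ * u) := Real.exp_pos _
  simp only [intervalIntegral.integral_same, add_zero, sub_zero, flowCont_self] at hds
  have h1 : Real.exp (-M.δ * s) * w (R s) ≤ Real.exp (-M.δ * s) *
      (M.flowCont w κ (κ + ∫ v in u..s, M.drift (R v)) - (L s - Function.rightLim L u)) :=
    mul_le_mul_of_nonneg_left (by linarith) hE.le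
  have h2 : Real.exp (-M.δ * u) * (w κ + (Function.rightLim L u - L u)) ≤
      Real.exp (-M.δ * u) * w (R u) := mul_le_mul_of_nonneg_left (by linarith) hE'.le
  -- Dividends after `u` were discounted as if paid at `u`. The error is the product of `O(s - u)`
  -- with an amount that tends to `0`, and so is negligible for the Dini derivative.
  have h3 : (Real.exp (-M.δ * u) - Real.exp (-M.δ * s)) * (L s - Function.rightLim L u) ≤
      ε / 2 * (s - u) := by
    have : Real.exp (-M.δ * u) - Real.exp (-M.δ * s) ≤ D * (s - u) := by
      rw [hD]; linarith [hes.2]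
    calc _ ≤ D * (s - u) * (L s - Function.rightLim L u) := by gcongr
      _ ≤ D * (s - u) * (ε / 2 / D) :=
        mul_le_mul_of_nonneg_left hLs.le (mul_nonneg hD0.le (by linarith [hs.1]))
      _ = ε / 2 * (s - u) := by field_simp
  nlinarith [hds.1]

/-- The times in `[t₀, t₁)` that precede ruin or coincide with it. -/
def aliveTimes (M : RiskModel μ) (R : ℝ → ℝ) (t₀ t₁ : ℝ) : Set ℝ :=
  {t | t ∈ Ico t₀ t₁ ∧ ∀ v ∈ Ico t₀ t, M.critical < R v}

/-- Either ruin does not occur in `[t₀, t₁)`, or there is an instant up to which the reserve is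
above the critical level and after which it is not. -/
theorem ruin_cases (h : M.IsReservePath R L t₀ t₁) : (∀ s ∈ Ico t₀ t₁, M.critical < R s) ∨
    ∃ τ ∈ Ico t₀ t₁, (∀ s ∈ Ico t₀ τ, M.critical < R s) ∧ (∀ s ∈ Ioc τ t₁, R s ≤ M.critical) ∧
      R τ - (Function.rightLim L τ - L τ) ≤ M.critical := by
  by_cases H : ∀ s ∈ Ico t₀ t₁, M.critical < R s
  · exact Or.inl H
  right
  push Not at H
  obtain ⟨s₁, hs₁, hR₁⟩ := H
  set bad := {s | s ∈ Ico t₀ t₁ ∧ R s ≤ M.critical} with hbad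
  have hbdd : BddBelow bad := ⟨t₀, fun s hs => hs.1.1⟩
  have hne : bad.Nonempty := ⟨s₁, hs₁, hR₁⟩
  have h0 : t₀ ≤ sInf bad := le_csInf hne fun s hs => hs.1.1
  have h1 : sInf bad < t₁ := (csInf_le hbdd ⟨hs₁, hR₁⟩).trans_lt hs₁.2
  have hafter : ∀ s ∈ Ioc (sInf bad) t₁, R s ≤ M.critical := fun s hs => by
    obtain ⟨v, hv, hvs⟩ := (csInf_lt_iff hbdd hne).1 hs.1
    exact h.le_critical ⟨hv.1.1, hv.1.2.le⟩ (by linarith [hv.2, h.rightLim_sub_nonneg v])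
      ⟨hvs, hs.2⟩
  refine ⟨sInf bad, ⟨h0, h1⟩, fun s hs => ?_, hafter, ?_⟩
  · by_contra! hcon
    exact absurd (csInf_le hbdd (⟨⟨hs.1, hs.2.trans h1⟩, hcon⟩ : s ∈ bad)) (not_le.2 hs.2)
  · refine le_of_tendsto (h.tendsto_right ⟨h0, h1⟩) ?_
    filter_upwards [Ioc_mem_nhdsGT h1] with s hs using hafter s hs

theorem integral_claimLoss_eq_of_ruin (hw : M.IsSuper w) (hc : Continuous w)
    (h : M.IsReservePath R L t₀ t₁) {τ : ℝ} (hτ : τ ∈ Ico t₀ t₁)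
    (hafter : ∀ s ∈ Ioc τ t₁, R s ≤ M.critical) :
    ∫ u in t₀..t₁, M.claimLoss w R u = ∫ u in t₀..τ, M.claimLoss w R u := by
  have hi := h.intervalIntegrable_claimLoss hw hc
  have hτ' : τ ∈ Icc t₀ t₁ := ⟨hτ.1, hτ.2.le⟩
  rw [← intervalIntegral.integral_add_adjacent_intervals
    (hi.sub_interval h.le (left_mem_Icc.2 h.le) hτ')
    (hi.sub_interval h.le hτ' (right_mem_Icc.2 h.le)), add_eq_left]
  refine intervalIntegral.integral_zero_ae (Eventually.of_forall fun u hu => ?_)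
  rw [uIoc_of_le hτ.2.le] at hu
  exact claimLoss_eq_zero hw (hafter u hu)

theorem paid_nonneg (hL : Monotone L) (s : Set ℝ) : 0 ≤ M.paid hL s :=
  integral_nonneg fun _ => (Real.exp_pos _).le

theorem paid_mono (hL : Monotone L) {s t : Set ℝ} (hst : s ⊆ t) {a b : ℝ} (ht : t ⊆ Icc a b) :
    M.paid hL s ≤ M.paid hL t :=
  setIntegral_mono_set ((integrableOn_exp_stieltjes hL M.δ a b).mono_set ht)
    (Eventually.of_forall fun _ => (Real.exp_pos _).le) hst.eventuallyLE

theorem paid_Icc (h : M.IsReservePath R L t₀ t₁) {τ : ℝ} (hτ : t₀ ≤ τ) :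
    M.paid h.mono (Icc t₀ τ) = M.paid h.mono (Ico t₀ τ) +
      Real.exp (-M.δ * τ) * (Function.rightLim L τ - L τ) := by
  have hI := integrableOn_exp_stieltjes h.mono M.δ t₀ τ
  rw [← Ico_union_right hτ, paid, setIntegral_union (by simp) (measurableSet_singleton _)
    (hI.mono_set Ico_subset_Icc_self) (hI.mono_set (by simpa using hτ)),
    integral_singleton_stieltjes, measureReal_singleton_stieltjes h.mono h.leftCont, paid,
    mul_comm (Real.exp _)]

/-- In an interval without claims, no admissible dividend strategy does better than the
supersolution. -/
theorem paid_alive_le (hw : M.IsSuper w) (hc : Continuous w) (h : M.IsReservePath R L t₀ t₁)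
    (had : ∀ t ∈ Ico t₀ t₁, (∀ s ∈ Ico t₀ t, M.critical < R s) →
      Function.rightLim L t - L t ≤ max (R t - M.critical) 0) :
    M.paid h.mono (aliveTimes M R t₀ t₁) + Real.exp (-M.δ * t₁) * w (R t₁) ≤
      Real.exp (-M.δ * t₀) * w (R t₀) + ∫ u in t₀..t₁, M.claimLoss w R u := by
  rcases h.ruin_cases with hR | ⟨τ, hτ, hbefore, hafter, -⟩
  · have h1 := h.balance_le hw hc (right_mem_Icc.2 h.le) hR
    have h2 : M.paid h.mono (aliveTimes M R t₀ t₁) ≤ M.paid h.mono (Ico t₀ t₁) :=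
      paid_mono h.mono (fun t ht => ht.1) Ico_subset_Icc_self
    rw [balance_self, balance] at h1
    linarith
  · have h1 := h.balance_le hw hc ⟨hτ.1, hτ.2.le⟩ hbefore
    have h2 : M.paid h.mono (aliveTimes M R t₀ t₁) ≤ M.paid h.mono (Icc t₀ τ) := by
      refine paid_mono h.mono (fun t ht => ⟨ht.1.1, ?_⟩) Subset.rfl
      by_contra! hcon
      have hm : (τ + t) / 2 ∈ Ioo τ t := ⟨by linarith, by linarith⟩
      exact absurd (ht.2 _ ⟨hτ.1.trans hm.1.le, hm.2⟩)
        (not_lt.2 (hafter _ ⟨hm.1, (hm.2.trans ht.1.2).le⟩))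
    rw [balance_self, balance] at h1
    -- The dividend at the instant of ruin also counts. Admissibility bounds it by the distance to
    -- the critical level, and this is at most the value by slope one.
    have h3 : Function.rightLim L τ - L τ ≤ w (R τ) := by
      refine (had τ hτ hbefore).trans (max_le ?_ (hw.nonneg _))
      rcases le_total (R τ) M.critical with hle | hle
      · linarith [hw.nonneg (R τ)]
      · have := hw.slope _ _ le_rfl hle
        rwa [hw.zero _ le_rfl, sub_zero] at this
    have h4 : Real.exp (-M.δ * τ) * (Function.rightLim L τ - L τ) ≤
        Real.exp (-M.δ * τ) * w (R τ) := mul_le_mul_of_nonneg_left h3 (Real.exp_pos _).le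
    rw [h.integral_claimLoss_eq_of_ruin hw hc hτ hafter,
      hw.zero _ (hafter t₁ ⟨hτ.2, le_rfl⟩)]
    rw [h.paid_Icc hτ.1] at h2
    linarith

end IsReservePath

end

end RiskModel

/-! ### Band strategies between claims: equality and uniqueness of the path. -/

namespace RiskModel

section

variable {Ω : Type*} [MeasurableSpace Ω] {μ : Measure Ω} [IsProbabilityMeasure μ]
  {M : RiskModel μ} {R L : ℝ → ℝ} {t₀ t₁ : ℝ}

namespace IsReservePath

theorem _root_.rightLim_eq_of_eventually_eq {L : ℝ → ℝ} {t : ℝ}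
    (ht : ∀ᶠ s in 𝓝[>] t, L s = L t) : Function.rightLim L t = L t :=
  rightLim_eq_of_tendsto (tendsto_const_nhds.congr' (ht.mono fun _ hu => hu.symm))

theorem rightLim_eq_of_mem_A {A B : Set ℝ} (h : M.IsReservePath R L t₀ t₁) {t : ℝ}
    (ht : t ∈ Ico t₀ t₁) (hr : M.BandRule A B R L t) (hA : R t ∈ A) :
    Function.rightLim L t = L t := by
  refine rightLim_eq_of_tendsto ?_
  have h1 := (h.tendsto_integral_right ht).const_add (L t)
  rw [add_zero] at h1
  refine h1.congr' ?_
  filter_upwards [hr.1 hA] with s hs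
  linarith

/-- The change of the balance at a level of `A` to which the reserve is taken at time `u`. -/
theorem balance_ge_of_eventually_eq (h : M.IsReservePath R L t₀ t₁) {u κ : ℝ}
    (hu : u ∈ Ico t₀ t₁) (hκA : κ ∈ M.bandA M.minSuper)
    (hκ : κ = R u - (Function.rightLim L u - L u)) (hev : ∀ᶠ s in 𝓝[>] u, R s = κ)
    (hw : M.minSuper (R u) = M.minSuper κ + (Function.rightLim L u - L u)) {ε : ℝ} (hε : 0 < ε) :
    ∀ᶠ s in 𝓝[>] u, balance M M.minSuper R h.mono t₀ u ≤
      balance M M.minSuper R h.mono t₀ s + ε * (s - u) := by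
  have hS := M.isSuper_minSuper
  have hc := M.continuous_minSuper
  have hlim : Tendsto R (𝓝[>] u) (𝓝 κ) :=
    tendsto_const_nhds.congr' (hev.mono fun s hs => hs.symm)
  -- While the reserve rests at `κ`, income equals dividends. The derivative at `u` is the
  -- discounted generator at `κ`, which vanishes because `κ` belongs to `𝒜`.
  have hd : HasDerivWithinAt (fun s => Real.exp (-M.δ * s) *
      (M.minSuper κ + ∫ v in u..s, M.drift (R v)) - ∫ v in u..s, M.claimLoss M.minSuper R v)
      0 (Ici u) u := by
    have h1 := (h.hasDerivWithinAt_integral_drift hu hlim).const_add (M.minSuper κ)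
    have h3 := ((hasDerivAt_exp_neg M.δ u).hasDerivWithinAt (s := Ici u)).mul h1
    refine (h3.sub (h.hasDerivWithinAt_integral_claimLoss hS hc hu hlim)).congr_deriv ?_
    have := hκA.2
    rw [generator] at this
    simp only [intervalIntegral.integral_same, add_zero]
    linear_combination Real.exp (-M.δ * u) * this
  have hE := fun s => Real.exp_pos (-M.δ * s)
  obtain ⟨c, hc', hcR⟩ := (mem_nhdsGT_iff_exists_Ioo_subset' hu.2).1 hev
  filter_upwards [eventually_le_of_hasDerivWithinAt hd hε, hev, Ioo_mem_nhdsGT hu.2] with s hs hRs hus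
  have hsb := h.balance_sub hS hc hu.1 hus.1.le hus.2.le
  have hpaid := le_integral_Ico_stieltjes h.mono h.leftCont M.δ_pos.le hus.1
  have hdyn := h.dyn_right ⟨hu.1, hu.2.le⟩ ⟨hu.1.trans hus.1.le, hus.2.le⟩
  rw [← hκ, hRs] at hdyn
  have hs2 := hs.2
  simp only [intervalIntegral.integral_same, add_zero, sub_zero] at hs2
  change _ ≤ M.paid h.mono (Ico u s) at hpaid
  rw [hRs, hw] at hsb
  rw [show L s - Function.rightLim L u = ∫ v in u..s, M.drift (R v) by linarith] at hpaid
  linarith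

/-- Before ruin, a band strategy realizes the value given by the least supersolution. -/
theorem balance_ge (h : M.IsReservePath R L t₀ t₁)
    (hr : ∀ t ∈ Ico t₀ t₁, M.BandRule (M.bandA M.minSuper) (M.bandB M.minSuper) R L t)
    {b : ℝ} (hb : b ∈ Icc t₀ t₁) (hR : ∀ s ∈ Ico t₀ b, M.critical < R s) :
    balance M M.minSuper R h.mono t₀ t₀ ≤ balance M M.minSuper R h.mono t₀ b := by
  have hS := M.isSuper_minSuper
  have hc := M.continuous_minSuper
  have hp := M.isBandPartition_minSuper
  rw [← neg_le_neg_iff]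
  refine le_of_right_dini_nonpos (f := fun s => -balance M M.minSuper R h.mono t₀ s) hb.1
    (fun s hs => (h.balance_leftCont hS hc ⟨hs.1, hs.2.trans hb.2⟩).neg) fun u hu ε hε => ?_
  have huI : u ∈ Ico t₀ t₁ := ⟨hu.1, hu.2.trans_le hb.2⟩
  have hcu : M.critical < R u := hR u hu
  have hκc := h.rightLim_gt_critical hb.2 hR hu
  suffices ∀ᶠ s in 𝓝[>] u, balance M M.minSuper R h.mono t₀ u ≤
      balance M M.minSuper R h.mono t₀ s + ε * (s - u) from
    this.mono fun s hs => by linarith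
  by_cases hA : R u ∈ M.bandA M.minSuper
  · have hj := h.rightLim_eq_of_mem_A huI (hr u huI) hA
    refine h.balance_ge_of_eventually_eq huI hA (by rw [hj]; ring) ?_ (by rw [hj]; ring) hε
    filter_upwards [Ioo_mem_nhdsGT huI.2] with s hs
    exact h.eq_of_mem_A hr ⟨huI.1, huI.2.le⟩ hA s ⟨hs.1.le, hs.2.le⟩
  by_cases hB : R u ∈ M.bandB M.minSuper
  · obtain ⟨x₀, hx₀, hlt, hsub, hj⟩ := (hr u huI).2.1 hB
    have hlim := h.tendsto_right huI
    refine h.balance_ge_of_eventually_eq huI hx₀ (by rw [hj]; ring) ?_ ?_ hε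
    · refine h.eventually_eq_of_mem_B hp hr huI hx₀ hlt hsub hj ?_
      exact (hlim.eventually_const_lt hκc).mono fun _ hs => le_of_lt hs
    · linarith [M.minSuper_sub_eq_of_subset_bandB hlt.le hsub]
  -- In the third band nothing is paid and `minSuper` coincides with its flow solution to the right,
  -- so the estimate of `balance_le` loses nothing.
  · have hL := (hr u huI).2.2 ⟨hcu.le, hA, hB⟩
    have hj := rightLim_eq_of_eventually_eq hL
    obtain ⟨y, hy, -, hf⟩ := M.exists_flow_of_notMem hcu.le hA hB
    have hlim := h.tendsto_right huI
    rw [hj, sub_self, sub_zero] at hlim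
    have hd := eventually_le_of_hasDerivWithinAt
      (h.hasDerivWithinAt_flow hS hc huI hlim hcu) hε
    filter_upwards [hd, hL, hlim.eventually_lt_const hy, Ioo_mem_nhdsGT hu.2] with s hs hLs hys hus
    have hsI : s ∈ Icc t₀ t₁ := ⟨huI.1.trans hus.1.le, hus.2.le.trans hb.2⟩
    have hsb := h.balance_sub hS hc hu.1 hus.1.le hsI.2
    have hdyn := h.dyn_sub ⟨huI.1, huI.2.le⟩ hsI
    rw [hLs, sub_self, sub_zero] at hdyn
    have h0 : 0 ≤ ∫ v in u..s, M.drift (R v) :=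
      intervalIntegral.integral_nonneg hus.1.le fun v hv =>
        M.drift_nonneg (hR v ⟨hu.1.trans hv.1, hv.2.trans_lt hus.2⟩).le
    have hw := hf (R s) ⟨by linarith, hys.le⟩
    have hs2 := hs.2
    simp only [intervalIntegral.integral_same, add_zero, sub_zero, flowCont_self] at hs2
    rw [← hdyn, ← hw] at hs2
    have := paid_nonneg (M := M) h.mono (Ico u s)
    linarith

/-- In an interval without claims, a band strategy realizes the value given by the least
supersolution. -/
theorem le_paid_alive (h : M.IsReservePath R L t₀ t₁)
    (hr : ∀ t ∈ Ico t₀ t₁, M.BandRule (M.bandA M.minSuper) (M.bandB M.minSuper) R L t) :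
    Real.exp (-M.δ * t₀) * M.minSuper (R t₀) + ∫ u in t₀..t₁, M.claimLoss M.minSuper R u ≤
      M.paid h.mono (aliveTimes M R t₀ t₁) + Real.exp (-M.δ * t₁) * M.minSuper (R t₁) := by
  have hS := M.isSuper_minSuper
  have hc := M.continuous_minSuper
  have hp := M.isBandPartition_minSuper
  rcases h.ruin_cases with hR | ⟨τ, hτ, hbefore, hafter, hκ⟩
  · have h1 := h.balance_ge hr (right_mem_Icc.2 h.le) hR
    have h2 : aliveTimes M R t₀ t₁ = Ico t₀ t₁ :=
      Subset.antisymm (fun t ht => ht.1) fun t ht => ⟨ht, fun v hv => hR v ⟨hv.1, hv.2.trans ht.2⟩⟩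
    rw [balance_self, balance] at h1
    rw [h2]
    linarith
  · have h1 := h.balance_ge hr ⟨hτ.1, hτ.2.le⟩ hbefore
    have h2 : M.paid h.mono (Icc t₀ τ) ≤ M.paid h.mono (aliveTimes M R t₀ t₁) := by
      refine paid_mono h.mono (fun t ht => ⟨⟨ht.1, ht.2.trans_lt hτ.2⟩, fun v hv =>
        hbefore v ⟨hv.1, hv.2.trans_le ht.2⟩⟩) (a := t₀) (b := t₁) fun t ht => ⟨ht.1.1, ht.1.2.le⟩
    rw [balance_self, balance] at h1
    -- A band strategy starting above the critical level reaches it between claims only by a lump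
    -- sum whose target is that level. Slope one makes this lump sum equal to the whole value. In
    -- the other two bands there is no lump sum, contrary to `hκ`.
    have h3 : M.minSuper (R τ) ≤ Function.rightLim L τ - L τ := by
      rcases le_or_gt (R τ) M.critical with hle | hgt
      · rw [hS.zero _ hle]
        exact h.rightLim_sub_nonneg τ
      by_cases hA : R τ ∈ M.bandA M.minSuper
      · rw [h.rightLim_eq_of_mem_A hτ (hr τ hτ) hA] at hκ
        linarith
      by_cases hB : R τ ∈ M.bandB M.minSuper
      · obtain ⟨x₀, hx₀, hlt, hsub, hj⟩ := (hr τ hτ).2.1 hB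
        have hx : x₀ = M.critical := le_antisymm (by linarith) hx₀.1
        have := M.minSuper_sub_eq_of_subset_bandB hlt.le hsub
        rw [hx, hS.zero _ le_rfl] at this
        rw [hj, hx]
        linarith
      · rw [rightLim_eq_of_eventually_eq ((hr τ hτ).2.2 ⟨hgt.le, hA, hB⟩)] at hκ
        linarith
    have h4 : Real.exp (-M.δ * τ) * M.minSuper (R τ) ≤
        Real.exp (-M.δ * τ) * (Function.rightLim L τ - L τ) :=
      mul_le_mul_of_nonneg_left h3 (Real.exp_pos _).le
    rw [h.integral_claimLoss_eq_of_ruin hS hc hτ hafter, hS.zero _ (hafter t₁ ⟨hτ.2, le_rfl⟩)]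
    rw [h.paid_Icc hτ.1] at h2
    linarith

/-- When no dividends are paid below the critical level, the reserve does not pass that level
continuously. -/
theorem eventually_critical_le (h : M.IsReservePath R L t₀ t₁)
    (hz : ∀ t ∈ Ico t₀ t₁, R t < M.critical → ∀ᶠ s in 𝓝[>] t, L s = L t) {s : ℝ}
    (hs : s ∈ Ico t₀ t₁) (hκ : M.critical ≤ R s - (Function.rightLim L s - L s)) :
    ∀ᶠ u in 𝓝[>] s, M.critical ≤ R u := by
  have hsI : s ∈ Icc t₀ t₁ := ⟨hs.1, hs.2.le⟩
  -- Below the critical level the income is nonpositive, so the reserve never returns. If the claim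
  -- fails, the reserve is therefore below that level at all times after `s`, nothing is paid, and
  -- `L` is constant there.
  have hbelow : ∀ v ∈ Ioo s t₁, R v < M.critical → ∀ x ∈ Icc v t₁, R x < M.critical := by
    intro v hv hvc x hx
    rcases hx.1.eq_or_lt with rfl | hvx
    · exact hvc
    have hvI : v ∈ Icc t₀ t₁ := ⟨hs.1.trans hv.1.le, hv.2.le⟩
    have hxI : x ∈ Icc t₀ t₁ := ⟨hvI.1.trans hx.1, hx.2⟩
    rw [h.dyn_sub hvI hxI]
    have h1 : ∫ y in v..x, M.drift (R y) ≤ 0 := by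
      rw [intervalIntegral.integral_of_le hx.1]
      refine setIntegral_nonpos measurableSet_Ioc fun y hy => M.drift_nonpos ?_
      exact h.le_critical hvI (by linarith [h.rightLim_sub_nonneg v]) ⟨hy.1, hy.2.trans hxI.2⟩
    linarith [h.mono hx.1]
  by_contra hcon
  have hall : ∀ v ∈ Ioo s t₁, R v < M.critical := by
    intro v hv
    by_contra! hvc
    refine hcon ?_
    filter_upwards [Ioo_mem_nhdsGT hv.1] with u hu
    by_contra! huc
    exact absurd (hbelow u ⟨hu.1, hu.2.trans hv.2⟩ huc v ⟨hu.2.le, hv.2.le⟩) (not_lt.2 hvc)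
  have hu : (s + t₁) / 2 ∈ Ioo s t₁ := ⟨by linarith [hs.2], by linarith [hs.2]⟩
  set u := (s + t₁) / 2
  have hconst : ∀ v ∈ Ioc s u, L u = L v := by
    intro v hv
    refine real_induction (P := fun x => L x = L v) (fun x hx hind => ?_)
      (fun x hx hind => ?_) u ⟨hv.2, le_rfl⟩
    · rcases hx.1.eq_or_lt with rfl | hvx
      · rfl
      · refine tendsto_nhds_unique ((h.leftCont x).mono Iio_subset_Iic_self)
          (tendsto_const_nhds.congr' ?_)
        filter_upwards [Ioo_mem_nhdsLT hvx] with y hy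
        exact (hind y ⟨hy.1.le, hy.2⟩).symm
    · have hxt := hx.2.trans hu.2
      have hsx := hv.1.trans_le hx.1
      filter_upwards [hz x ⟨hs.1.trans hsx.le, hxt⟩ (hall x ⟨hsx, hxt⟩)] with y hy
      rw [hy, hind x ⟨hx.1, le_rfl⟩]
  have hLlim : Function.rightLim L s = L u := by
    refine rightLim_eq_of_tendsto (tendsto_const_nhds.congr' ?_)
    filter_upwards [Ioc_mem_nhdsGT hu.1] with v hv
    exact hconst v hv
  have hsu := h.sub hs.1 hu.1.le hu.2.le
  -- Below the critical level the drift is linear, so the deficit satisfies Grönwall's inequality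
  -- and starts from at most zero. As before, the value at `s` itself is discarded because it
  -- precedes the lump sum.
  set f : ℝ → ℝ := fun v => if v ≤ s then 0 else M.critical - R v with hf
  have hint : IntervalIntegrable (fun v => M.critical - R v) volume s u :=
    hsu.intervalIntegrable_comp (g := fun x => M.critical - x) (by fun_prop)
  have hcongr : ∀ v ∈ Icc s u, EqOn (fun v => M.critical - R v) f (uIoo s v) := by
    intro v hv x hx
    rw [uIoo_of_le hv.1] at hx
    simp only [hf, if_neg (not_le.2 hx.1)]
  have := gronwall_nonpos hu.1.le M.α_pos.le (f := f)
    (hint.congr_uIoo (hcongr u ⟨hu.1.le, le_rfl⟩)) (fun v hv => ?_) u ⟨hu.1.le, le_rfl⟩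
  · simp only [hf, if_neg (not_le.2 hu.1)] at this
    linarith [hall u hu]
  · rcases hv.1.eq_or_lt with rfl | hsv
    · simp [hf]
    · have hvI : v ∈ Icc t₀ t₁ := ⟨hs.1.trans hv.1, hv.2.trans hu.2.le⟩
      rw [← intervalIntegral.integral_congr_uIoo (hcongr v hv),
        ← intervalIntegral.integral_const_mul]
      simp only [hf, if_neg (not_le.2 hsv)]
      have h1 : ∫ x in s..v, -M.drift (R x) ≤ ∫ x in s..v, M.α * (M.critical - R x) := by
        refine intervalIntegral.integral_mono_on_of_le_Ioo hv.1
          (h.integrable_sub hsI hvI).neg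
          ((hint.sub_interval hu.1.le ⟨le_rfl, hu.1.le⟩ hv).const_mul _) fun x hx => ?_
        have hxc := hall x ⟨hx.1, (hx.2.trans_le hv.2).trans hu.2⟩
        have := M.critical_neg
        rw [drift, if_neg (by linarith), mul_sub, M.α_mul_critical]
        linarith
      rw [intervalIntegral.integral_neg] at h1
      linarith [h.dyn_right hsI hvI, hconst v ⟨hsv, hv.2⟩]

variable {A B : Set ℝ}

/-- Two reserves that are driven by the same band strategy and are kept free of dividends below the
critical level coincide. -/
theorem eq_of_bandRule (hp : M.IsBandPartition A B) {R' L' : ℝ → ℝ}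
    (h : M.IsReservePath R L t₀ t₁) (h' : M.IsReservePath R' L' t₀ t₁)
    (hr : ∀ t ∈ Ico t₀ t₁, M.BandRule A B R L t) (hr' : ∀ t ∈ Ico t₀ t₁, M.BandRule A B R' L' t)
    (hz : ∀ t ∈ Ico t₀ t₁, R t < M.critical → ∀ᶠ s in 𝓝[>] t, L s = L t)
    (hz' : ∀ t ∈ Ico t₀ t₁, R' t < M.critical → ∀ᶠ s in 𝓝[>] t, L' s = L' t)
    (h0 : R t₀ = R' t₀) : ∀ s ∈ Icc t₀ t₁, R s = R' s ∧ L s - L t₀ = L' s - L' t₀ := by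
  have key : ∀ s ∈ Icc t₀ t₁, R s = R' s := by
    refine real_induction (fun s hs hind => ?_) (fun s hs hind => ?_)
    · rcases hs.1.eq_or_lt with rfl | h0s
      · exact h0
      · refine tendsto_nhds_unique (h.tendsto_left ⟨h0s, hs.2⟩)
          ((h'.tendsto_left ⟨h0s, hs.2⟩).congr' ?_)
        filter_upwards [Ioo_mem_nhdsLT h0s] with u hu
        exact (hind u ⟨hu.1.le, hu.2⟩).symm
    · have hRs := hind s ⟨hs.1, le_rfl⟩
      have hsI : s ∈ Icc t₀ t₁ := ⟨hs.1, hs.2.le⟩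
      -- As long as neither strategy pays, both reserves solve the same Lipschitz equation from the
      -- same level.
      have hfree : (∀ᶠ u in 𝓝[>] s, L u = L s) → (∀ᶠ u in 𝓝[>] s, L' u = L' s) →
          ∀ᶠ u in 𝓝[>] s, R u = R' u := by
        intro hL hL'
        obtain ⟨b, hb, hgood⟩ := (mem_nhdsGT_iff_exists_Ioo_subset' hs.2).1
          (hL.and (hL'.and (Ioo_mem_nhdsGT hs.2)))
        filter_upwards [Ioo_mem_nhdsGT hb] with u hu
        have hI : ∀ v ∈ Icc s u, v ∈ Icc t₀ t₁ ∧ L v = L s ∧ L' v = L' s := fun v hv => by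
          rcases hv.1.eq_or_lt with rfl | hsv
          · exact ⟨hsI, rfl, rfl⟩
          · obtain ⟨h1, h2, h3⟩ := hgood ⟨hsv, hv.2.trans_lt hu.2⟩
            exact ⟨⟨hs.1.trans hv.1, h3.2.le⟩, h1, h2⟩
        have hsub := h.sub hs.1 hu.1.le (hI u ⟨hu.1.le, le_rfl⟩).1.2
        have hsub' := h'.sub hs.1 hu.1.le (hI u ⟨hu.1.le, le_rfl⟩).1.2
        have hint : IntervalIntegrable (fun v => R v - R' v) volume s u :=
          (hsub.intervalIntegrable_comp continuous_id).sub
            (hsub'.intervalIntegrable_comp continuous_id)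
        have hg := gronwall_nonpos hu.1.le M.α_pos.le (f := fun v => |R v - R' v|) hint.abs
          (fun v hv => ?_) u ⟨hu.1.le, le_rfl⟩
        · exact sub_eq_zero.1 (abs_nonpos_iff.1 hg)
        · have hvI := hI v hv
          have e : R v - R' v = ∫ x in s..v, (M.drift (R x) - M.drift (R' x)) := by
            rw [intervalIntegral.integral_sub (h.integrable_sub hsI hvI.1)
              (h'.integrable_sub hsI hvI.1), h.dyn_sub hsI hvI.1, h'.dyn_sub hsI hvI.1,
              hvI.2.1, hvI.2.2, hRs]
            ring
          rw [← intervalIntegral.integral_const_mul, e]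
          refine (intervalIntegral.abs_integral_le_integral_abs hv.1).trans ?_
          refine intervalIntegral.integral_mono_on hv.1
            ((h.integrable_sub hsI hvI.1).sub (h'.integrable_sub hsI hvI.1)).abs
            ((hint.abs.sub_interval hu.1.le ⟨le_rfl, hu.1.le⟩ hv).const_mul _)
            fun x _ => M.abs_drift_sub_le _ _
      by_cases hA : R s ∈ A
      · filter_upwards [Ioo_mem_nhdsGT hs.2] with u hu
        rw [h.eq_of_mem_A hr hsI hA u ⟨hu.1.le, hu.2.le⟩,
          h'.eq_of_mem_A hr' hsI (hRs ▸ hA) u ⟨hu.1.le, hu.2.le⟩, hRs]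
      by_cases hB : R s ∈ B
      · obtain ⟨x₀, hx₀, hlt, hsub, hj⟩ := (hr s hs).2.1 hB
        obtain ⟨x₁, hx₁, hlt', hsub', hj'⟩ := (hr' s hs).2.1 (hRs ▸ hB)
        have hx : x₁ = x₀ := hp.nearest_unique M hx₁ hlt' hsub' hx₀ (hRs ▸ hlt) (hRs ▸ hsub)
        have h1 := h.eventually_eq_of_mem_B hp hr hs hx₀ hlt hsub hj
          (h.eventually_critical_le hz hs (by linarith [hp.critical_le x₀ hx₀]))
        have h2 := h'.eventually_eq_of_mem_B hp hr' hs hx₁ hlt' hsub' hj'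
          (h'.eventually_critical_le hz' hs (by linarith [hp.critical_le x₁ hx₁]))
        filter_upwards [h1, h2] with u hu hu'
        rw [hu, hu', hx]
      rcases le_or_gt M.critical (R s) with hle | hgt
      · exact hfree ((hr s hs).2.2 ⟨hle, hA, hB⟩) ((hr' s hs).2.2 (hRs ▸ ⟨hle, hA, hB⟩))
      · exact hfree (hz s hs hgt) (hz' s hs (hRs ▸ hgt))
  intro s hs
  refine ⟨key s hs, ?_⟩
  have e : ∫ u in t₀..s, M.drift (R u) = ∫ u in t₀..s, M.drift (R' u) := by
    refine intervalIntegral.integral_congr fun u hu => ?_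
    rw [uIcc_of_le hs.1] at hu
    simp only [key u ⟨hu.1, hu.2.trans hs.2⟩]
  linarith [h.dyn s hs, h'.dyn s hs, key s hs]

end IsReservePath

end

end RiskModel

/-! ### The claim process: regular scenarios and independence. -/

theorem ProbabilityTheory.Indep.sup_left_of_le {Ω : Type*} {m₁ m₂ m₃ m m₀ : MeasurableSpace Ω}
    {μ : Measure[m₀] Ω} [IsProbabilityMeasure μ] (h₁ : m₁ ≤ m₀) (h : m ≤ m₀) (h₂ : m₂ ≤ m)
    (h₃ : m₃ ≤ m) (hi : Indep m₁ m μ) (h23 : Indep m₂ m₃ μ) : Indep (m₁ ⊔ m₂) m₃ μ := by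
  -- The intersections `a ∩ b` form a π-system generating `m₁ ⊔ m₂`. On it the product formula
  -- follows by first splitting off `m₁` from `m`, which contains both `m₂` and `m₃`.
  refine IndepSets.indep (p1 := image2 (· ∩ ·) {s | MeasurableSet[m₁] s} {s | MeasurableSet[m₂] s})
    (p2 := {s | MeasurableSet[m₃] s}) (sup_le h₁ (h₂.trans h)) (h₃.trans h) ?_
    (@MeasurableSpace.isPiSystem_measurableSet Ω m₃) ?_
    (@MeasurableSpace.generateFrom_measurableSet Ω m₃).symm ?_
  · rintro _ ⟨a, ha, b, hb, rfl⟩ _ ⟨a', ha', b', hb', rfl⟩ -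
    exact ⟨a ∩ a', @MeasurableSet.inter _ m₁ _ _ ha ha', b ∩ b', @MeasurableSet.inter _ m₂ _ _ hb hb',
      by simp only [inter_inter_inter_comm]⟩
  · refine le_antisymm (sup_le (fun s hs => ?_) (fun s hs => ?_))
      (MeasurableSpace.generateFrom_le ?_)
    · exact MeasurableSpace.measurableSet_generateFrom
        ⟨s, hs, univ, @MeasurableSet.univ _ m₂, inter_univ s⟩
    · exact MeasurableSpace.measurableSet_generateFrom
        ⟨univ, @MeasurableSet.univ _ m₁, s, hs, univ_inter s⟩
    · rintro _ ⟨a, ha, b, hb, rfl⟩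
      exact @MeasurableSet.inter _ (m₁ ⊔ m₂) _ _ (le_sup_left (a := m₁) _ ha)
        (le_sup_right (b := m₂) _ hb)
  · rw [IndepSets_iff]
    rintro _ c ⟨a, ha, b, hb, rfl⟩ hc
    have e1 := (Indep_iff _ _ _).1 hi a (b ∩ c) ha (@MeasurableSet.inter _ m _ _ (h₂ _ hb) (h₃ _ hc))
    have e2 := (Indep_iff _ _ _).1 h23 b c hb hc
    have e3 := (Indep_iff _ _ _).1 hi a b ha (h₂ _ hb)
    rw [inter_assoc, e1, e2, e3, mul_assoc]

theorem expMeasure_Ioi {r : ℝ} (hr : 0 < r) (c : ℝ) :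
    expMeasure r (Ioi c) = ENNReal.ofReal (Real.exp (-(r * max c 0))) := by
  have := isProbabilityMeasure_expMeasure hr
  rw [← compl_Iic, prob_compl_eq_one_sub measurableSet_Iic, ← ofReal_cdf, cdf_expMeasure_eq hr,
    ← ENNReal.ofReal_one, ← ENNReal.ofReal_sub _ (by
      split_ifs with h
      · rw [sub_nonneg, Real.exp_le_one_iff]; nlinarith
      · exact le_rfl)]
  congr 1
  split_ifs with h
  · rw [max_eq_left h]; ring
  · rw [max_eq_right (not_le.1 h).le]; simp

namespace RiskModel

section

variable {Ω : Type*} [MeasurableSpace Ω] {μ : Measure Ω} [IsProbabilityMeasure μ]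
  (M : RiskModel μ)

/-- The time `0` and the claim epochs. -/
noncomputable def epoch (n : ℕ) (ω : Ω) : ℝ := ∑ k ∈ Finset.range n, M.W k ω

theorem claimTime_eq (n : ℕ) (ω : Ω) : M.claimTime n ω = M.epoch (n + 1) ω := rfl

theorem epoch_zero (ω : Ω) : M.epoch 0 ω = 0 := by simp [epoch]

theorem epoch_succ (n : ℕ) (ω : Ω) : M.epoch (n + 1) ω = M.epoch n ω + M.W n ω :=
  Finset.sum_range_succ _ _

theorem measurable_epoch (n : ℕ) : Measurable (M.epoch n) :=
  Finset.measurable_fun_sum _ fun k _ => M.measurable_W k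

/-- The regular scenarios. -/
structure IsRegular (ω : Ω) : Prop where
  W_pos : ∀ n, 0 < M.W n ω
  U_nonneg : ∀ n, 0 ≤ M.U n ω
  tendsto : Tendsto (fun n => M.epoch n ω) atTop atTop

theorem ae_W_pos (n : ℕ) : ∀ᵐ ω ∂μ, 0 < M.W n ω := by
  have h : expMeasure M.lam (Ioi 0)ᶜ = 0 := by
    have := isProbabilityMeasure_expMeasure M.lam_pos
    rw [prob_compl_eq_zero_iff measurableSet_Ioi, expMeasure_Ioi M.lam_pos]
    simp
  rw [← M.law_W n, Measure.map_apply (M.measurable_W n) measurableSet_Ioi.compl] at h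
  exact h

theorem ae_U_nonneg (n : ℕ) : ∀ᵐ ω ∂μ, 0 ≤ M.U n ω := M.U_nonneg n

theorem integral_exp_epoch (n : ℕ) :
    ∫ ω, Real.exp (-M.epoch n ω) ∂μ = (∫ x, Real.exp (-x) ∂expMeasure M.lam) ^ n := by
  have h1 := M.iIndep_W.mgf_sum M.measurable_W (Finset.range n) (t := -1)
  have h2 : ∀ k, mgf (M.W k) μ (-1) = ∫ x, Real.exp (-x) ∂expMeasure M.lam := fun k => by
    rw [← M.law_W k, integral_map (M.measurable_W k).aemeasurable (by fun_prop)]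
    simp [mgf]
  rw [Finset.prod_congr rfl fun k _ => h2 k, Finset.prod_const, Finset.card_range] at h1
  rw [← h1, mgf]
  simp [epoch, Finset.sum_apply]

theorem integral_exp_expMeasure_lt_one : ∫ x, Real.exp (-x) ∂expMeasure M.lam < 1 := by
  have := isProbabilityMeasure_expMeasure M.lam_pos
  have hpos : ∀ᵐ x ∂expMeasure M.lam, 0 < x := by
    rw [← M.law_W 0]
    exact (ae_map_iff (M.measurable_W 0).aemeasurable measurableSet_Ioi).2 (M.ae_W_pos 0)
  have hint : Integrable (fun x => Real.exp (-x)) (expMeasure M.lam) := by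
    refine Integrable.of_bound (by fun_prop) 1 ?_
    filter_upwards [hpos] with x hx
    rw [Real.norm_of_nonneg (Real.exp_pos _).le, Real.exp_le_one_iff]
    linarith
  have h1 : 0 < ∫ x, (1 - Real.exp (-x)) ∂expMeasure M.lam := by
    rw [integral_pos_iff_support_of_nonneg_ae]
    · rw [pos_iff_ne_zero]
      intro h0
      have hall : ∀ᵐ x ∂expMeasure M.lam, x ∉ Function.support fun x => 1 - Real.exp (-x) :=
        measure_eq_zero_iff_ae_notMem.1 h0
      obtain ⟨x, hx, hx'⟩ := (hpos.and hall).exists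
      refine hx' ?_
      have : Real.exp (-x) < 1 := by
        rw [← Real.exp_zero]; exact Real.exp_lt_exp.2 (by linarith)
      exact (by linarith : (0 : ℝ) < 1 - Real.exp (-x)).ne'
    · filter_upwards [hpos] with x hx
      have : Real.exp (-x) < 1 := by
        rw [← Real.exp_zero]; exact Real.exp_lt_exp.2 (by linarith)
      simp only [Pi.zero_apply]
      linarith
    · exact (integrable_const _).sub hint
  rw [integral_sub (integrable_const _) hint] at h1
  simp at h1
  linarith

/-- By independence the Laplace transform of the `n`th epoch is `ρ ^ n` with `ρ < 1`. Its sum is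
finite, so `exp (-epoch)` is almost surely summable and tends to zero. -/
theorem ae_tendsto_epoch : ∀ᵐ ω ∂μ, Tendsto (fun n => M.epoch n ω) atTop atTop := by
  set ρ := ∫ x, Real.exp (-x) ∂expMeasure M.lam with hρ
  have hρ0 : 0 ≤ ρ := integral_nonneg fun _ => (Real.exp_pos _).le
  have hρ1 : ρ < 1 := M.integral_exp_expMeasure_lt_one
  have hWpos : ∀ᵐ ω ∂μ, ∀ n, 0 < M.W n ω := ae_all_iff.2 M.ae_W_pos
  have hn : ∀ n, ∫⁻ ω, ENNReal.ofReal (Real.exp (-M.epoch n ω)) ∂μ = ENNReal.ofReal (ρ ^ n) := by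
    intro n
    rw [← M.integral_exp_epoch, ofReal_integral_eq_lintegral_ofReal]
    · refine Integrable.of_bound (M.measurable_epoch n).neg.exp.aestronglyMeasurable 1 ?_
      filter_upwards [hWpos] with ω hω
      rw [Real.norm_of_nonneg (Real.exp_pos _).le, Real.exp_le_one_iff, neg_nonpos]
      exact Finset.sum_nonneg fun k _ => (hω k).le
    · exact Eventually.of_forall fun _ => (Real.exp_pos _).le
  have hme : ∀ n, Measurable fun ω => ENNReal.ofReal (Real.exp (-M.epoch n ω)) := fun n =>
    (Real.measurable_exp.comp (M.measurable_epoch n).neg).ennreal_ofReal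
  have hsum : ∫⁻ ω, ∑' n, ENNReal.ofReal (Real.exp (-M.epoch n ω)) ∂μ ≠ ∞ := by
    rw [lintegral_tsum fun n => (hme n).aemeasurable]
    simp_rw [hn]
    rw [← ENNReal.ofReal_tsum_of_nonneg (fun n => pow_nonneg hρ0 n)
      (summable_geometric_of_lt_one hρ0 hρ1)]
    exact ENNReal.ofReal_ne_top
  have hmeas : Measurable fun ω => ∑' n, ENNReal.ofReal (Real.exp (-M.epoch n ω)) :=
    Measurable.tsum hme
  filter_upwards [ae_lt_top hmeas hsum] with ω hω
  have h1 := ENNReal.tendsto_atTop_zero_of_tsum_ne_top hω.ne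
  have h2 : Tendsto (fun n => Real.exp (-M.epoch n ω)) atTop (𝓝 0) := by
    have := (ENNReal.tendsto_toReal ENNReal.zero_ne_top).comp h1
    simpa [Function.comp_def, ENNReal.toReal_ofReal (Real.exp_pos _).le] using this
  have h3 : Tendsto (fun n => -M.epoch n ω) atTop atBot := Real.tendsto_exp_comp_nhds_zero.1 h2
  simpa [Function.comp_def] using tendsto_neg_atBot_atTop.comp h3

theorem ae_isRegular : ∀ᵐ ω ∂μ, M.IsRegular ω := by
  filter_upwards [ae_all_iff.2 M.ae_W_pos, ae_all_iff.2 M.ae_U_nonneg, M.ae_tendsto_epoch]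
    with ω h1 h2 h3
  exact ⟨h1, h2, h3⟩

variable {M}

theorem IsRegular.strictMono_epoch {ω : Ω} (h : M.IsRegular ω) :
    StrictMono fun n => M.epoch n ω :=
  strictMono_nat_of_lt_succ fun n => by
    simp only [M.epoch_succ]
    linarith [h.W_pos n]

theorem IsRegular.epoch_nonneg {ω : Ω} (h : M.IsRegular ω) (n : ℕ) : 0 ≤ M.epoch n ω := by
  rw [← M.epoch_zero ω]
  exact h.strictMono_epoch.monotone (Nat.zero_le n)

theorem IsRegular.exists_mem {ω : Ω} (h : M.IsRegular ω) {t : ℝ} (ht : 0 ≤ t) :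
    ∃ n, t ∈ Ico (M.epoch n ω) (M.epoch (n + 1) ω) := by
  classical
  have hex : ∃ n, t < M.epoch n ω := (h.tendsto.eventually_gt_atTop t).exists
  have hpos : Nat.find hex ≠ 0 := fun h0 => by
    have := Nat.find_spec hex
    rw [h0, M.epoch_zero] at this
    linarith
  obtain ⟨n, hn⟩ := Nat.exists_eq_succ_of_ne_zero hpos
  refine ⟨n, not_lt.1 (Nat.find_min hex (by omega)), ?_⟩
  have := Nat.find_spec hex
  rwa [hn] at this

/-- The claim with index `k` arrives at epoch `k + 1`, so before epoch `n + 1` only the indices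
below `n` can contribute. With the indicators kept, the formula holds for all such `t`, and it shows
that the aggregate claims depend there on the first `n` waiting times and claims only. -/
theorem IsRegular.aggregateClaims_eq {ω : Ω} (h : M.IsRegular ω) {n : ℕ} {t : ℝ}
    (ht : t < M.epoch (n + 1) ω) : M.aggregateClaims t ω =
      ∑ k ∈ Finset.range n, if M.epoch (k + 1) ω ≤ t then M.U k ω else 0 := by
  refine tsum_eq_sum fun k hk => if_neg (not_le.2 ?_)
  rw [M.claimTime_eq]
  exact ht.trans_le (h.strictMono_epoch.monotone (by simp at hk; omega))

theorem IsRegular.aggregateClaims_eq_sum {ω : Ω} (h : M.IsRegular ω) {n : ℕ} {t : ℝ}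
    (ht : t ∈ Ico (M.epoch n ω) (M.epoch (n + 1) ω)) :
    M.aggregateClaims t ω = ∑ k ∈ Finset.range n, M.U k ω := by
  rw [h.aggregateClaims_eq ht.2]
  refine Finset.sum_congr rfl fun k hk => if_pos (le_trans ?_ ht.1)
  exact h.strictMono_epoch.monotone (by simp at hk; omega)

variable (M)

/-- The information contained in the first `n` waiting times and claims. -/
@[reducible]
noncomputable def history (n : ℕ) : MeasurableSpace Ω :=
  (⨆ k ∈ Iio n, MeasurableSpace.comap (M.W k) inferInstance) ⊔
    ⨆ k ∈ Iio n, MeasurableSpace.comap (M.U k) inferInstance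

theorem history_le (n : ℕ) : M.history n ≤ ‹MeasurableSpace Ω› :=
  sup_le (iSup₂_le fun k _ => (M.measurable_W k).comap_le)
    (iSup₂_le fun k _ => (M.measurable_U k).comap_le)

theorem measurable_history_W {n k : ℕ} (hk : k < n) : Measurable[M.history n] (M.W k) :=
  Measurable.of_comap_le ((le_iSup₂ (f := fun k (_ : k ∈ Iio n) =>
    MeasurableSpace.comap (M.W k) inferInstance) k hk).trans le_sup_left)

theorem measurable_history_U {n k : ℕ} (hk : k < n) : Measurable[M.history n] (M.U k) :=
  Measurable.of_comap_le ((le_iSup₂ (f := fun k (_ : k ∈ Iio n) =>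
    MeasurableSpace.comap (M.U k) inferInstance) k hk).trans le_sup_right)

theorem measurable_history_epoch {n k : ℕ} (hk : k ≤ n) : Measurable[M.history n] (M.epoch k) :=
  @Finset.measurable_fun_sum _ _ _ _ _ _ (M.history n) _ _ fun _ hj =>
    M.measurable_history_W ((Finset.mem_range.1 hj).trans_le hk)

theorem comap_seq_eq (X : ℕ → Ω → ℝ) :
    MeasurableSpace.comap (fun ω n => X n ω) MeasurableSpace.pi =
      ⨆ n, MeasurableSpace.comap (X n) inferInstance := by
  simp only [MeasurableSpace.pi, MeasurableSpace.comap_iSup, MeasurableSpace.comap_comp]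
  rfl

theorem iSup_Iio_le (X : ℕ → Ω → ℝ) (n : ℕ) :
    ⨆ k ∈ Iio n, MeasurableSpace.comap (X k) (inferInstance : MeasurableSpace ℝ) ≤
      ⨆ k, MeasurableSpace.comap (X k) inferInstance :=
  iSup₂_le fun k _ => le_iSup (fun k => MeasurableSpace.comap (X k) inferInstance) k

theorem indep_all_W_U : Indep (⨆ n, MeasurableSpace.comap (M.W n) inferInstance)
    (⨆ n, MeasurableSpace.comap (M.U n) inferInstance) μ := by
  have := M.indep_W_U
  rw [IndepFun_iff_Indep, comap_seq_eq, comap_seq_eq] at this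
  exact this

theorem indep_past (X : ℕ → Ω → ℝ) (hX : ∀ n, Measurable (X n)) (hi : iIndepFun X μ) (n : ℕ) :
    Indep (⨆ k ∈ Iio n, MeasurableSpace.comap (X k) (inferInstance : MeasurableSpace ℝ))
      (MeasurableSpace.comap (X n) inferInstance) μ := by
  have := indep_iSup_of_disjoint (fun i => (hX i).comap_le) hi (S := Iio n) (T := {n}) (by simp)
  simpa using this

/-- All claim sizes are adjoined at once, being independent of all waiting times. Only the past
waiting times need independence within their sequence. -/
theorem indep_history_W (n : ℕ) :
    Indep (M.history n) (MeasurableSpace.comap (M.W n) inferInstance) μ := by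
  have h := Indep.sup_left_of_le (iSup_le fun k => (M.measurable_U k).comap_le)
    (iSup_le fun k => (M.measurable_W k).comap_le) (iSup_Iio_le M.W n)
    (le_iSup (fun k => MeasurableSpace.comap (M.W k) inferInstance) n) M.indep_all_W_U.symm
    (indep_past M.W M.measurable_W M.iIndep_W n)
  refine indep_of_indep_of_le_left h ?_
  rw [history, sup_comm]
  exact sup_le_sup_right (iSup_Iio_le M.U n) _

/-- The current waiting time is included, because a predictable quantity at the next epoch depends
on it. -/
theorem indep_history_U (n : ℕ) :
    Indep (M.history n ⊔ MeasurableSpace.comap (M.W n) inferInstance)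
      (MeasurableSpace.comap (M.U n) inferInstance) μ := by
  have h := Indep.sup_left_of_le (iSup_le fun k => (M.measurable_W k).comap_le)
    (iSup_le fun k => (M.measurable_U k).comap_le) (iSup_Iio_le M.U n)
    (le_iSup (fun k => MeasurableSpace.comap (M.U k) inferInstance) n) M.indep_all_W_U
    (indep_past M.U M.measurable_U M.iIndep_U n)
  refine indep_of_indep_of_le_left h ?_
  rw [history]
  refine sup_le (sup_le_sup_right (iSup_Iio_le M.W n) _) (le_trans ?_ le_sup_left)
  exact le_iSup (fun k => MeasurableSpace.comap (M.W k) inferInstance) n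

end

end RiskModel

/-! ### The compensation formula for the claims. -/

/-- The sets that almost surely agree with a set in `H` along the random set `S`. -/
@[reducible]
def MeasurableSpace.agreeAlong {Ω X : Type*} [MeasurableSpace Ω] (μ : Measure Ω) (S : Ω → Set X)
    (H : MeasurableSpace X) : MeasurableSpace X where
  MeasurableSet' E := ∃ E', MeasurableSet[H] E' ∧ ∀ᵐ ω ∂μ, ∀ x ∈ S ω, (x ∈ E ↔ x ∈ E')
  measurableSet_empty := ⟨∅, @MeasurableSet.empty _ H, by simp⟩
  measurableSet_compl := by
    rintro E ⟨E', hE', h⟩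
    refine ⟨E'ᶜ, hE'.compl, ?_⟩
    filter_upwards [h] with ω hω x hx
    simp [hω x hx]
  measurableSet_iUnion := by
    intro f hf
    choose g hg h using hf
    refine ⟨⋃ i, g i, MeasurableSet.iUnion hg, ?_⟩
    filter_upwards [ae_all_iff.2 h] with ω hω x hx
    simp [hω _ x hx]

theorem ProbabilityTheory.IndepFun.lintegral_prodMk {Ω β γ : Type*} [MeasurableSpace Ω]
    [MeasurableSpace β] [MeasurableSpace γ] {μ : Measure Ω} [IsProbabilityMeasure μ]
    {Z : Ω → γ} {X : Ω → β} (hZ : Measurable Z) (hX : Measurable X) (h : IndepFun Z X μ)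
    {φ : γ × β → ℝ≥0∞} (hφ : Measurable φ) :
    ∫⁻ ω, φ (Z ω, X ω) ∂μ = ∫⁻ ω, ∫⁻ y, φ (Z ω, y) ∂(μ.map X) ∂μ := by
  have : IsProbabilityMeasure (μ.map X) := Measure.isProbabilityMeasure_map hX.aemeasurable
  have hp := (indepFun_iff_map_prod_eq_prod_map_map hZ.aemeasurable hX.aemeasurable).1 h
  have h1 := lintegral_map (μ := μ) hφ (hZ.prodMk hX)
  rw [hp, lintegral_prod _ hφ.aemeasurable, lintegral_map hφ.lintegral_prod_right' hZ] at h1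
  exact h1.symm

/-- The exponential law has the constant hazard rate `r`. By Tonelli the right-hand side is the
integral over `t > s` of `h t` times `r P(W ≥ t - s)`, and this factor is the density of `s + W` at
`t`. -/
theorem lintegral_expMeasure_add {r : ℝ} (hr : 0 < r) (s : ℝ) {h : ℝ → ℝ≥0∞} (hh : Measurable h) :
    ∫⁻ w, h (s + w) ∂expMeasure r =
      ENNReal.ofReal r * ∫⁻ w, (∫⁻ t in Ioc s (s + w), h t) ∂expMeasure r := by
  have := isProbabilityMeasure_expMeasure hr
  have hs : MeasurableSet {q : ℝ × ℝ | s < q.2 ∧ q.2 ≤ s + q.1} :=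
    (measurableSet_lt measurable_const measurable_snd).inter
      (measurableSet_le measurable_snd (measurable_const.add measurable_fst))
  have e1 : ∀ w, ∫⁻ t in Ioc s (s + w), h t =
      ∫⁻ t, {q : ℝ × ℝ | s < q.2 ∧ q.2 ≤ s + q.1}.indicator (fun q => h q.2) (w, t) := fun w => by
    rw [← lintegral_indicator measurableSet_Ioc]
    rfl
  rw [lintegral_congr e1, lintegral_lintegral_swap (f := fun w t =>
    {q : ℝ × ℝ | s < q.2 ∧ q.2 ≤ s + q.1}.indicator (fun q => h q.2) (w, t))
    ((hh.comp measurable_snd).indicator hs).aemeasurable]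
  have e2 : ∀ t, ∫⁻ w, {q : ℝ × ℝ | s < q.2 ∧ q.2 ≤ s + q.1}.indicator (fun q => h q.2) (w, t)
      ∂expMeasure r = (Ioi s).indicator (fun t => h t * ENNReal.ofReal (Real.exp (-(r * (t - s))))) t := by
    intro t
    by_cases ht : s < t
    · rw [indicator_of_mem (show t ∈ Ioi s from ht)]
      have : ∀ w, {q : ℝ × ℝ | s < q.2 ∧ q.2 ≤ s + q.1}.indicator (fun q => h q.2) (w, t) =
          (Ici (t - s)).indicator (fun _ => h t) w := fun w => by
        simp only [indicator, mem_ofPred_eq, mem_Ici, ht, true_and, tsub_le_iff_left]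
      simp_rw [this]
      rw [lintegral_indicator_const measurableSet_Ici]
      congr 1
      have hab : expMeasure r (Ici (t - s)) = expMeasure r (Ioi (t - s)) :=
        measure_congr (Ioi_ae_eq_Ici' ((withDensity_absolutelyContinuous _ _) (by simp))).symm
      rw [hab, expMeasure_Ioi hr, max_eq_left (by linarith)]
    · rw [indicator_of_notMem (show t ∉ Ioi s from ht)]
      simp [indicator, ht]
  rw [lintegral_congr e2, lintegral_indicator measurableSet_Ioi, expMeasure, gammaMeasure,
    lintegral_withDensity_eq_lintegral_mul (f := gammaPDF 1 r) volume
      (measurable_gammaPDFReal 1 r).ennreal_ofReal (g := fun w => h (s + w))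
      (hh.comp (measurable_const_add s)), ← lintegral_const_mul' _ _ ENNReal.ofReal_ne_top,
    ← lintegral_indicator measurableSet_Ioi]
  conv_rhs => rw [← lintegral_add_left_eq_self (μ := volume) _ s]
  refine lintegral_congr_ae ?_
  filter_upwards [measure_eq_zero_iff_ae_notMem.1 (measure_singleton (μ := volume) (0 : ℝ))] with w hw
  rcases lt_or_gt_of_ne (show w ≠ 0 from hw) with hw | hw
  · simp [gammaPDF, gammaPDFReal, hw.le, not_le.2 hw]
  · simp [gammaPDF, gammaPDFReal, hw, hw.le, ENNReal.ofReal_mul hr.le]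
    ring

/-- Stated for an arbitrary measurable space so that it can be applied to `Ω` with the smaller
σ-algebra of the history; the same holds for the next two lemmas. -/
theorem measurable_indicator_toNNReal {γ : Type*} [MeasurableSpace γ] {E : Set (ℝ≥0 × γ)}
    (hE : MeasurableSet E) :
    Measurable fun q : ℝ × γ => E.indicator (fun _ => (1 : ℝ≥0∞)) (q.1.toNNReal, q.2) :=
  (measurable_const.indicator hE).comp
    ((measurable_real_toNNReal.comp measurable_fst).prodMk measurable_snd)

theorem measurableSet_preimage_toNNReal {γ : Type*} [MeasurableSpace γ] {f g : γ → ℝ}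
    (hf : Measurable f) (hg : Measurable g) {E : Set (ℝ≥0 × γ)} (hE : MeasurableSet E) :
    MeasurableSet {y | ((f y + g y).toNNReal, y) ∈ E} :=
  ((hf.add hg).real_toNNReal.prodMk measurable_id) hE

theorem ProbabilityTheory.IndepFun.lintegral_exp_add {Ω γ : Type*} [MeasurableSpace Ω]
    [MeasurableSpace γ] {μ : Measure Ω} [IsProbabilityMeasure μ] {Z : Ω → γ} {X : Ω → ℝ} {r : ℝ}
    (hr : 0 < r) (hZ : Measurable Z) (hX : Measurable X) (hlaw : μ.map X = expMeasure r)
    (h : IndepFun Z X μ) {s : γ → ℝ} (hs : Measurable s) {g : ℝ × γ → ℝ≥0∞} (hg : Measurable g) :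
    ∫⁻ ω, g (s (Z ω) + X ω, Z ω) ∂μ =
      ENNReal.ofReal r * ∫⁻ ω, (∫⁻ t in Ioc (s (Z ω)) (s (Z ω) + X ω), g (t, Z ω)) ∂μ := by
  have := isProbabilityMeasure_expMeasure hr
  have h1 := h.lintegral_prodMk hZ hX (φ := fun q => g (s q.1 + q.2, q.1)) (by fun_prop)
  have hS : MeasurableSet {q : (γ × ℝ) × ℝ | s q.1.1 < q.2 ∧ q.2 ≤ s q.1.1 + q.1.2} :=
    (measurableSet_lt (f := fun q : (γ × ℝ) × ℝ => s q.1.1) (g := fun q => q.2) (by fun_prop)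
      (by fun_prop)).inter (measurableSet_le (f := fun q : (γ × ℝ) × ℝ => q.2)
      (g := fun q => s q.1.1 + q.1.2) (by fun_prop) (by fun_prop))
  have e : ∀ q : γ × ℝ, ∫⁻ t in Ioc (s q.1) (s q.1 + q.2), g (t, q.1) =
      ∫⁻ t, {q : (γ × ℝ) × ℝ | s q.1.1 < q.2 ∧ q.2 ≤ s q.1.1 + q.1.2}.indicator
        (fun q => g (q.2, q.1.1)) (q, t) := fun q => by
    rw [← lintegral_indicator measurableSet_Ioc]
    rfl
  have hm : Measurable fun q : γ × ℝ => ∫⁻ t in Ioc (s q.1) (s q.1 + q.2), g (t, q.1) := by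
    simp_rw [e]
    exact Measurable.lintegral_prod_right' (Measurable.indicator (by fun_prop) hS)
  have h2 := h.lintegral_prodMk hZ hX hm
  simp only at h1 h2
  rw [h1, h2, hlaw, ← lintegral_const_mul' _ _ ENNReal.ofReal_ne_top]
  exact lintegral_congr fun ω =>
    lintegral_expMeasure_add hr (s (Z ω)) (h := fun t => g (t, Z ω)) (by fun_prop)

namespace RiskModel

section

variable {Ω : Type*} [MeasurableSpace Ω] {μ : Measure Ω} [IsProbabilityMeasure μ]
  (M : RiskModel μ)

/-- Before epoch `n + 1` no information beyond the first `n` waiting times and claims has been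
revealed. The sets that agree with a set of the history on this event form a σ-algebra, so it
suffices to check the generators. -/
theorem exists_history_of_measurableSet_filtration [μ.IsComplete] (n : ℕ) (i : ℝ≥0) {A : Set Ω}
    (hA : MeasurableSet[M.filtration i] A) : ∃ A', MeasurableSet[M.history n] A' ∧
      ∀ᵐ ω ∂μ, (i : ℝ) < M.epoch (n + 1) ω → (ω ∈ A ↔ ω ∈ A') := by
  have key : M.filtration i ≤ MeasurableSpace.agreeAlong μ
      (fun ω => {ω' | ω' = ω ∧ (i : ℝ) < M.epoch (n + 1) ω}) (M.history n) := by
    refine sup_le (iSup_le fun s => ?_) (MeasurableSpace.generateFrom_le fun N hN => ?_)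
    · rintro _ ⟨D, hD, rfl⟩
      have hm : Measurable[M.history n] fun ω => ∑ k ∈ Finset.range n,
          if M.epoch (k + 1) ω ≤ ((s : ℝ≥0) : ℝ) then M.U k ω else 0 := by
        refine @Finset.measurable_fun_sum _ _ _ _ _ _ (M.history n) _ _ fun k hk => ?_
        have hk := Finset.mem_range.1 hk
        have hset : MeasurableSet[M.history n] {ω | M.epoch (k + 1) ω ≤ ((s : ℝ≥0) : ℝ)} :=
          M.measurable_history_epoch (Nat.succ_le_of_lt hk) measurableSet_Iic
        exact @Measurable.ite Ω ℝ (M.U k) (fun _ => 0) (M.history n) _ _ _ hset (M.measurable_history_U hk)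
          (@measurable_const _ _ _ (M.history n) _)
      refine ⟨_, hm hD, ?_⟩
      filter_upwards [M.ae_isRegular] with ω hω
      rintro _ ⟨rfl, hi⟩
      have hs : ((s : ℝ≥0) : ℝ) ≤ (i : ℝ) := NNReal.coe_le_coe.2 s.2
      simp only [mem_preimage, hω.aggregateClaims_eq (hs.trans_lt hi)]
    · refine ⟨∅, @MeasurableSet.empty _ (M.history n), ?_⟩
      filter_upwards [measure_eq_zero_iff_ae_notMem.1 hN] with ω hω
      rintro _ ⟨rfl, -⟩
      simp [hω]
  obtain ⟨A', hA', h⟩ := key A hA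
  refine ⟨A', hA', ?_⟩
  filter_upwards [h] with ω hω hi
  exact hω ω ⟨rfl, hi⟩

/-- Between two claims a predictable set is determined by the past claims. -/
theorem exists_history_of_predictable [μ.IsComplete] (n : ℕ) {E : Set (ℝ≥0 × Ω)}
    (hE : MeasurableSet[M.filtration.predictable] E) :
    ∃ E', MeasurableSet[@Prod.instMeasurableSpace _ _ inferInstance (M.history n)] E' ∧
      ∀ᵐ ω ∂μ, ∀ t : ℝ≥0, (t : ℝ) ∈ Ioc (M.epoch n ω) (M.epoch (n + 1) ω) →
        ((t, ω) ∈ E ↔ (t, ω) ∈ E') := by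
  have key : M.filtration.predictable ≤ MeasurableSpace.agreeAlong μ
      (fun ω => {x : ℝ≥0 × Ω | x.2 = ω ∧ (x.1 : ℝ) ∈ Ioc (M.epoch n ω) (M.epoch (n + 1) ω)})
      (@Prod.instMeasurableSpace _ _ inferInstance (M.history n)) := by
    refine measurableSpace_le_predictable_of_measurableSet (fun A hA => ?_) (fun i A hA => ?_)
    · refine ⟨∅, @MeasurableSet.empty _ (_), ?_⟩
      filter_upwards [M.ae_isRegular] with ω hω
      rintro ⟨t, _⟩ ⟨rfl, ht⟩
      have h0 : 0 < t := NNReal.coe_pos.1 ((hω.epoch_nonneg n).trans_lt ht.1)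
      simp [h0.ne']
    · obtain ⟨A', hA', h⟩ := M.exists_history_of_measurableSet_filtration n i hA
      refine ⟨Ioi i ×ˢ A', @MeasurableSet.prod _ _ _ (M.history n) _ _ measurableSet_Ioi hA', ?_⟩
      filter_upwards [h] with ω hω
      rintro ⟨t, _⟩ ⟨rfl, ht⟩
      simp only [mem_prod, mem_Ioi]
      refine and_congr_right fun hi => hω ?_
      exact (NNReal.coe_lt_coe.2 hi).trans_le ht.2
  obtain ⟨E', hE', h⟩ := key E hE
  refine ⟨E', hE', ?_⟩
  filter_upwards [h] with ω hω t ht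
  exact hω (t, ω) ⟨rfl, ht⟩

theorem measure_next_epoch_history (n : ℕ) {E : Set (ℝ≥0 × Ω)}
    (hE : MeasurableSet[@Prod.instMeasurableSpace _ _ inferInstance (M.history n)] E) :
    μ {ω | ((M.epoch (n + 1) ω).toNNReal, ω) ∈ E} = ENNReal.ofReal M.lam *
      ∫⁻ ω, (∫⁻ t in Ioc (M.epoch n ω) (M.epoch (n + 1) ω),
        E.indicator (fun _ => 1) (t.toNNReal, ω)) ∂μ := by
  -- The frozen variable is the identity map into `Ω` with the σ-algebra of the history, so every
  -- quantity determined by the past is a function of it.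
  have hind : @IndepFun Ω Ω ℝ _ (M.history n) _ id (M.W n) μ := by
    refine (@IndepFun_iff_Indep Ω Ω ℝ _ (M.history n) _ id (M.W n) μ).2 ?_
    rw [MeasurableSpace.comap_id]
    exact M.indep_history_W n
  have hid : @Measurable Ω Ω _ (M.history n) id := measurable_id'' (M.history_le n)
  have hg : @Measurable _ _ (@Prod.instMeasurableSpace ℝ Ω inferInstance (M.history n)) _
      fun q => E.indicator (fun _ => (1 : ℝ≥0∞)) (q.1.toNNReal, q.2) :=
    @measurable_indicator_toNNReal Ω (M.history n) E hE
  have h := @ProbabilityTheory.IndepFun.lintegral_exp_add Ω Ω _ (M.history n) μ ‹_› id (M.W n)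
    M.lam M.lam_pos hid (M.measurable_W n) (M.law_W n) hind (M.epoch n)
    (M.measurable_history_epoch le_rfl) _ hg
  simp only [id, ← M.epoch_succ] at h
  rw [← h, ← lintegral_indicator_one₀]
  · rfl
  · have h1 : Measurable fun ω => ((M.epoch (n + 1) ω).toNNReal, ω) :=
      (M.measurable_epoch (n + 1)).real_toNNReal.prodMk measurable_id
    have h2 : MeasurableSet E :=
      (sup_le_sup_left (MeasurableSpace.comap_mono (M.history_le n)) _ : _ ≤ _) E hE
    exact (h1 h2).nullMeasurableSet

/-- The compensation formula for the marked point process of the claims, on predictable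
rectangles. -/
theorem measure_next_epoch_predictable [μ.IsComplete] (n : ℕ) {E : Set (ℝ≥0 × Ω)}
    (hE : MeasurableSet[M.filtration.predictable] E) {D : Set ℝ} (hD : MeasurableSet D) :
    μ {ω | ((M.epoch (n + 1) ω).toNNReal, ω) ∈ E ∧ M.U n ω ∈ D} = (ENNReal.ofReal M.lam *
      ∫⁻ ω, (∫⁻ t in Ioc (M.epoch n ω) (M.epoch (n + 1) ω),
        E.indicator (fun _ => 1) (t.toNNReal, ω)) ∂μ) * M.claimLaw D := by
  obtain ⟨E', hE', h⟩ := M.exists_history_of_predictable n hE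
  have e1 : ∫⁻ ω, (∫⁻ t in Ioc (M.epoch n ω) (M.epoch (n + 1) ω),
        E.indicator (fun _ => (1 : ℝ≥0∞)) (t.toNNReal, ω)) ∂μ =
      ∫⁻ ω, (∫⁻ t in Ioc (M.epoch n ω) (M.epoch (n + 1) ω),
        E'.indicator (fun _ => 1) (t.toNNReal, ω)) ∂μ := by
    refine lintegral_congr_ae ?_
    filter_upwards [h, M.ae_isRegular] with ω hω hr
    refine setLIntegral_congr_fun measurableSet_Ioc fun t ht => ?_
    have ht0 : 0 ≤ t := (hr.epoch_nonneg n).trans ht.1.le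
    have := hω t.toNNReal (by rwa [Real.coe_toNNReal _ ht0])
    by_cases hE : (t.toNNReal, ω) ∈ E
    · simp [hE, this.1 hE]
    · simp [hE, mt this.2 hE]
  have e2 : μ {ω | ((M.epoch (n + 1) ω).toNNReal, ω) ∈ E ∧ M.U n ω ∈ D} =
      μ ({ω | ((M.epoch (n + 1) ω).toNNReal, ω) ∈ E'} ∩ M.U n ⁻¹' D) := by
    refine measure_congr ?_
    filter_upwards [h, M.ae_isRegular] with ω hω hr
    have := hω (M.epoch (n + 1) ω).toNNReal (by
      rw [Real.coe_toNNReal _ (hr.epoch_nonneg _)]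
      exact ⟨hr.strictMono_epoch (Nat.lt_succ_self n), le_rfl⟩)
    exact propext (and_congr_left fun _ => this)
  have hP : MeasurableSet[M.history n ⊔ MeasurableSpace.comap (M.W n) inferInstance]
      {ω | ((M.epoch (n + 1) ω).toNNReal, ω) ∈ E'} := by
    have h0 := @measurableSet_preimage_toNNReal Ω
      (M.history n ⊔ MeasurableSpace.comap (M.W n) inferInstance) (M.epoch n) (M.W n)
      ((M.measurable_history_epoch le_rfl).mono le_sup_left le_rfl)
      ((comap_measurable (M.W n)).mono le_sup_right le_rfl) E'
      ((sup_le_sup_left (MeasurableSpace.comap_mono le_sup_left) _ : _ ≤ _) E' hE')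
    simpa only [M.epoch_succ] using h0
  rw [e1, e2, (Indep_iff _ _ _).1 (M.indep_history_U n) _ _ hP ⟨D, hD, rfl⟩,
    M.measure_next_epoch_history n hE', claimLaw,
    ← (M.identDistrib_U n).map_eq, Measure.map_apply (M.measurable_U n) hD]

variable [μ.IsComplete]

theorem predictable_le : M.filtration.predictable ≤ (inferInstance : MeasurableSpace (ℝ≥0 × Ω)) :=
  measurableSpace_le_predictable_of_measurableSet
    (fun A hA => (measurableSet_singleton _).prod (M.filtration.le _ A hA))
    (fun i A hA => measurableSet_Ioi.prod (M.filtration.le i A hA))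

theorem measurable_predictable_fst :
    Measurable[M.filtration.predictable] (Prod.fst : ℝ≥0 × Ω → ℝ≥0) := by
  let _ : MeasurableSpace (ℝ≥0 × Ω) := M.filtration.predictable
  refine measurable_of_Ioi fun i => ?_
  have := measurableSet_predictable_Ioi_prod (𝓕 := M.filtration) (i := i)
    (@MeasurableSet.univ _ (M.filtration i))
  rwa [prod_univ] at this

theorem measurableSet_setOf_mem_Ioc_epoch (n : ℕ) :
    MeasurableSet {q : Ω × ℝ | q.2 ∈ Ioc (M.epoch n q.1) (M.epoch (n + 1) q.1)} :=
  (measurableSet_lt ((M.measurable_epoch n).comp measurable_fst) measurable_snd).inter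
    (measurableSet_le measurable_snd ((M.measurable_epoch (n + 1)).comp measurable_fst))

theorem setLIntegral_Ioc_epoch (n : ℕ) (f : Ω → ℝ → ℝ≥0∞) (ω : Ω) :
    ∫⁻ t in Ioc (M.epoch n ω) (M.epoch (n + 1) ω), f ω t =
      ∫⁻ t, {q : Ω × ℝ | q.2 ∈ Ioc (M.epoch n q.1) (M.epoch (n + 1) q.1)}.indicator
        (fun q => f q.1 q.2) (ω, t) := by
  rw [← lintegral_indicator measurableSet_Ioc]
  rfl

/-- The compensation formula for the marked point process of the claims. -/
theorem lintegral_next_epoch (n : ℕ) {v : ℝ≥0 × Ω → ℝ} (hv : Measurable[M.filtration.predictable] v)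
    {φ : (ℝ≥0 × ℝ) × ℝ → ℝ≥0∞} (hφ : Measurable φ) :
    ∫⁻ ω, φ (((M.epoch (n + 1) ω).toNNReal, v ((M.epoch (n + 1) ω).toNNReal, ω)), M.U n ω) ∂μ =
      ENNReal.ofReal M.lam * ∫⁻ ω, (∫⁻ t in Ioc (M.epoch n ω) (M.epoch (n + 1) ω),
        ∫⁻ u, φ ((t.toNNReal, v (t.toNNReal, ω)), u) ∂M.claimLaw) ∂μ := by
  set S := {q : Ω × ℝ | q.2 ∈ Ioc (M.epoch n q.1) (M.epoch (n + 1) q.1)} with hS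
  have hSm : MeasurableSet S := M.measurableSet_setOf_mem_Ioc_epoch n
  have hv' : Measurable v := hv.mono M.predictable_le le_rfl
  have hH : Measurable[M.filtration.predictable] fun q : ℝ≥0 × Ω => (q.1, v q) := by
    let _ : MeasurableSpace (ℝ≥0 × Ω) := M.filtration.predictable
    exact Measurable.prodMk M.measurable_predictable_fst hv
  have hH' : Measurable fun q : ℝ≥0 × Ω => (q.1, v q) := measurable_fst.prodMk hv'
  have hT : Measurable fun q : Ω × ℝ => (q.2.toNNReal, q.1) :=
    (measurable_real_toNNReal.comp measurable_snd).prodMk measurable_fst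
  set ν : Measure (ℝ≥0 × ℝ) := ENNReal.ofReal M.lam •
    ((μ.prod volume).restrict S).map (fun q => (q.2.toNNReal, v (q.2.toNNReal, q.1))) with hν
  have hlint : ∀ g : ℝ≥0 × ℝ → ℝ≥0∞, Measurable g → ∫⁻ y, g y ∂ν = ENNReal.ofReal M.lam *
      ∫⁻ ω, (∫⁻ t in Ioc (M.epoch n ω) (M.epoch (n + 1) ω),
        g (t.toNNReal, v (t.toNNReal, ω))) ∂μ := by
    intro g hg
    have hgm : Measurable fun q : Ω × ℝ => g (q.2.toNNReal, v (q.2.toNNReal, q.1)) :=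
      hg.comp (hH'.comp hT)
    have hHT : Measurable fun q : Ω × ℝ => (q.2.toNNReal, v (q.2.toNNReal, q.1)) := hH'.comp hT
    rw [hν, lintegral_smul_measure, lintegral_map hg hHT, ← lintegral_indicator hSm,
      lintegral_prod _ (hgm.indicator hSm).aemeasurable, smul_eq_mul]
    congr 1
    exact lintegral_congr fun ω => (M.setLIntegral_Ioc_epoch n
      (fun ω t => g (t.toNNReal, v (t.toNNReal, ω))) ω).symm
  -- On rectangles the law of the epoch, the predictable value and the claim size is a product. It
  -- remains to pass from rectangles to all integrands.
  have hrect : ∀ B : Set (ℝ≥0 × ℝ), ∀ D : Set ℝ, MeasurableSet B → MeasurableSet D →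
      μ.map (fun ω => (((M.epoch (n + 1) ω).toNNReal, v ((M.epoch (n + 1) ω).toNNReal, ω)),
        M.U n ω)) (B ×ˢ D) = ν B * M.claimLaw D := by
    intro B D hB hD
    have h1 := M.measure_next_epoch_predictable n (hH hB) hD
    rw [Measure.map_apply _ (hB.prod hD), ← lintegral_indicator_one hB,
      hlint _ (measurable_one.indicator hB)]
    · exact h1
    · exact (hH'.comp ((M.measurable_epoch (n + 1)).real_toNNReal.prodMk measurable_id)).prodMk
        (M.measurable_U n)
  have hm : Measurable fun ω => (((M.epoch (n + 1) ω).toNNReal,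
      v ((M.epoch (n + 1) ω).toNNReal, ω)), M.U n ω) :=
    (hH'.comp ((M.measurable_epoch (n + 1)).real_toNNReal.prodMk measurable_id)).prodMk
        (M.measurable_U n)
  -- Total mass one comes from the full rectangle. It supplies the σ-finiteness needed for
  -- uniqueness of the product measure.
  have : IsProbabilityMeasure ν := by
    constructor
    have := hrect univ univ MeasurableSet.univ MeasurableSet.univ
    rw [univ_prod_univ, Measure.map_apply hm MeasurableSet.univ] at this
    simpa using this.symm
  have hprod := Measure.prod_eq hrect
  rw [← hlint _ hφ.lintegral_prod_right', ← lintegral_prod _ hφ.aemeasurable, hprod,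
    lintegral_map hφ hm]

end

end RiskModel

/-! ### Predictable processes. -/

section

variable {Ω : Type*} {m : MeasurableSpace Ω} {𝓕 : Filtration ℝ≥0 m}

/-- The left limits of an adapted process form a predictable process. -/
theorem MeasureTheory.Filtration.measurable_predictable_of_tendsto_left {X : ℝ≥0 → Ω → ℝ}
    {Z : ℝ≥0 × Ω → ℝ} (hX : ∀ t, Measurable[𝓕 t] (X t)) (hZ0 : Measurable[𝓕 0] fun ω => Z (0, ω))
    (hZ : ∀ ω t, 0 < t → Tendsto (fun s => X s ω) (𝓝[<] t) (𝓝 (Z (t, ω)))) :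
    Measurable[𝓕.predictable] Z := by
  -- The largest grid point `k / (n + 1)` strictly below `t`. The ceiling minus one, rather than the
  -- floor, gives the strict inequality and makes the approximation constant in time index on
  -- intervals `(k / (n + 1), (k + 1) / (n + 1)]`.
  let g : ℕ → ℝ≥0 → ℝ≥0 := fun n t => ((⌈t * (n + 1)⌉₊ - 1 : ℕ) : ℝ≥0) / (n + 1)
  let Zn : ℕ → ℝ≥0 × Ω → ℝ := fun n q => if q.1 = 0 then Z q else X (g n q.1) q.2
  have hn0 : ∀ n : ℕ, (0 : ℝ≥0) < n + 1 := fun n => by positivity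
  have hm : ∀ n, Measurable[𝓕.predictable] (Zn n) := by
    intro n D hD
    have e : Zn n ⁻¹' D = ({0} ×ˢ ((fun ω => Z (0, ω)) ⁻¹' D)) ∪
        ⋃ k : ℕ, Ioc ((k : ℝ≥0) / (n + 1)) (((k + 1 : ℕ) : ℝ≥0) / (n + 1)) ×ˢ
          (X ((k : ℝ≥0) / (n + 1)) ⁻¹' D) := by
      ext ⟨t, ω⟩
      have hk : ∀ k : ℕ, t ∈ Ioc ((k : ℝ≥0) / (n + 1)) (((k + 1 : ℕ) : ℝ≥0) / (n + 1)) ↔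
          ⌈t * (n + 1)⌉₊ = k + 1 := fun k => by
        rw [Nat.ceil_eq_iff (by omega), mem_Ioc, div_lt_iff₀ (hn0 n), le_div_iff₀ (hn0 n)]
        simp
      simp only [mem_preimage, mem_union, mem_prod, mem_singleton_iff, mem_iUnion, hk]
      by_cases ht : t = 0
      · subst ht
        simp [Zn]
      · have hc : ⌈t * (n + 1)⌉₊ ≠ 0 := by
          rw [Ne, Nat.ceil_eq_zero, not_le]
          exact mul_pos (pos_iff_ne_zero.2 ht) (hn0 n)
        obtain ⟨j, hj⟩ := Nat.exists_eq_succ_of_ne_zero hc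
        simp only [Zn, ht, if_false, false_and, false_or, g]
        constructor
        · intro h
          exact ⟨j, hj, by simpa [hj] using h⟩
        · rintro ⟨k, hk', h⟩
          simpa [hk'] using h
    rw [e]
    refine @MeasurableSet.union _ 𝓕.predictable _ _ ?_ (@MeasurableSet.iUnion _ _ 𝓕.predictable _ _
      fun k => ?_)
    · exact measurableSet_predictable_singleton_bot_prod (hZ0 hD)
    · exact measurableSet_predictable_Ioc_prod _ _ (hX _ hD)
  have hlim : Tendsto Zn atTop (𝓝 Z) := by
    rw [tendsto_pi_nhds]
    rintro ⟨t, ω⟩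
    by_cases ht : t = 0
    · simp [Zn, ht]
    · have ht0 : 0 < t := pos_iff_ne_zero.2 ht
      simp only [Zn, ht, if_false]
      have hg : ∀ n : ℕ, g n t < t := fun n => by
        have hc : 0 < ⌈t * (n + 1)⌉₊ := Nat.ceil_pos.2 (mul_pos ht0 (hn0 n))
        rw [div_lt_iff₀ (hn0 n)]
        exact Nat.lt_ceil.1 (Nat.sub_lt hc one_pos)
      have hg' : ∀ n : ℕ, t - 1 / ((n : ℝ≥0) + 1) ≤ g n t := fun n => by
        rw [tsub_le_iff_right, ← add_div, le_div_iff₀ (hn0 n)]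
        have h : ⌈t * (n + 1)⌉₊ ≤ (⌈t * (n + 1)⌉₊ - 1) + 1 := by omega
        exact (Nat.le_ceil _).trans (by exact_mod_cast h)
      have h1 : Tendsto (fun n : ℕ => t - 1 / ((n : ℝ≥0) + 1)) atTop (𝓝 t) := by
        simpa using (tendsto_const_nhds (x := t)).sub tendsto_one_div_add_atTop_nhds_zero_nat
      exact (hZ ω t ht0).comp (tendsto_nhdsWithin_iff.2 ⟨tendsto_of_tendsto_of_tendsto_of_le_of_le
        h1 tendsto_const_nhds hg' fun n => (hg n).le, Eventually.of_forall hg⟩)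
  let _ : MeasurableSpace (ℝ≥0 × Ω) := 𝓕.predictable
  exact measurable_of_tendsto_metrizable hm hlim

/-- A contraction of time looks only into the past, and so it preserves predictability, jointly in
the parameter. -/
theorem MeasureTheory.Filtration.measurable_predictable_mul {γ : Type*} [MeasurableSpace γ]
    {c : γ → ℝ≥0} (hc : Measurable c) (h0 : ∀ y, 0 < c y) (h1 : ∀ y, c y ≤ 1) :
    @Measurable _ _ (@Prod.instMeasurableSpace γ (ℝ≥0 × Ω) _ 𝓕.predictable) 𝓕.predictable
      fun q => (c q.1 * q.2.1, q.2.2) := by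
  let _ : MeasurableSpace (ℝ≥0 × Ω) := 𝓕.predictable
  refine measurable_generateFrom ?_
  rintro E (⟨A, hA, rfl⟩ | ⟨i, A, hA, rfl⟩)
  · have e : (fun q : γ × ℝ≥0 × Ω => (c q.1 * q.2.1, q.2.2)) ⁻¹' ({⊥} ×ˢ A) =
        univ ×ˢ ({⊥} ×ˢ A) := by
      ext ⟨y, t, ω⟩
      simp [(h0 y).ne']
    rw [e]
    exact MeasurableSet.univ.prod (measurableSet_predictable_singleton_bot_prod hA)
  · have e : (fun q : γ × ℝ≥0 × Ω => (c q.1 * q.2.1, q.2.2)) ⁻¹' (Ioi i ×ˢ A) =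
        -- A rational between `i / c y` and `t` separates the parameter from the time. Since `c y ≤
        -- 1`, also `t > i`, so the event from time `i` is already known.
        ⋃ k : ℚ, {y | i ≤ c y * (k : ℝ).toNNReal} ×ˢ (Ioi (max i (k : ℝ).toNNReal) ×ˢ A) := by
      ext ⟨y, t, ω⟩
      simp only [mem_preimage, mem_prod, mem_Ioi, mem_iUnion, mem_ofPred_eq, sup_lt_iff]
      constructor
      · rintro ⟨h, hω⟩
        have h2 : i / c y < t := (div_lt_iff₀ (h0 y)).2 (by rwa [mul_comm] at h)
        obtain ⟨k, hk1, hk2⟩ := exists_rat_btwn (NNReal.coe_lt_coe.2 h2)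
        have hk : i / c y ≤ (k : ℝ).toNNReal := NNReal.le_toNNReal_of_coe_le hk1.le
        have hk' : (k : ℝ).toNNReal < t := (Real.toNNReal_lt_iff_lt_coe
          ((NNReal.coe_nonneg _).trans hk1.le)).2 hk2
        refine ⟨k, ?_, ⟨?_, hk'⟩, hω⟩
        · rwa [div_le_iff₀ (h0 y), mul_comm] at hk
        · refine h.trans_le ?_
          simpa using mul_le_mul_left (h1 y) t
      · rintro ⟨k, hk, ⟨-, hkt⟩, hω⟩
        exact ⟨hk.trans_lt (mul_lt_mul_of_pos_left hkt (h0 y)), hω⟩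
    rw [e]
    refine MeasurableSet.iUnion fun k => (measurableSet_le measurable_const
      (hc.mul measurable_const)).prod (measurableSet_predictable_Ioi_prod ?_)
    exact 𝓕.mono (le_max_left _ _) _ hA

/-- Scaling turns the integral up to `t` into `t` times an integral over the fixed interval `(0, 1]`
of the time-contracted integrand, and Fubini measurability applies to the latter. -/
theorem MeasureTheory.Filtration.measurable_predictable_integral {g : ℝ≥0 × Ω → ℝ}
    (hg : Measurable[𝓕.predictable] g) : Measurable[𝓕.predictable] fun q : ℝ≥0 × Ω =>
      ∫ s in (0 : ℝ)..q.1, g (s.toNNReal, q.2) := by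
  classical
  -- Outside the range of integration the factor is set to `1`, only to have `0 < c ≤ 1` everywhere.
  let c : ℝ → ℝ≥0 := fun s => if s ∈ Ioc (0 : ℝ) 1 then s.toNNReal else 1
  have hc : Measurable c := Measurable.ite measurableSet_Ioc measurable_real_toNNReal measurable_const
  have h0 : ∀ y, 0 < c y := fun y => by
    simp only [c]; split_ifs with h
    · exact Real.toNNReal_pos.2 h.1
    · exact one_pos
  have h1 : ∀ y, c y ≤ 1 := fun y => by
    simp only [c]; split_ifs with h
    · exact Real.toNNReal_le_one.2 h.2
    · exact le_rfl
  have e : ∀ q : ℝ≥0 × Ω, ∫ s in (0 : ℝ)..q.1, g (s.toNNReal, q.2) =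
      q.1 * ∫ s in Ioc (0 : ℝ) 1, g (c s * q.1, q.2) := by
    intro q
    have := intervalIntegral.smul_integral_comp_mul_left (a := 0) (b := 1)
      (fun s : ℝ => g (s.toNNReal, q.2)) (q.1 : ℝ)
    rw [mul_zero, mul_one] at this
    rw [← this, intervalIntegral.integral_of_le zero_le_one, smul_eq_mul]
    congr 1
    refine setIntegral_congr_fun measurableSet_Ioc fun s hs => ?_
    simp only [c, hs, if_true]
    rw [mul_comm, Real.toNNReal_mul hs.1.le, Real.toNNReal_coe]
  have hcomp := hg.comp (measurable_predictable_mul hc h0 h1)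
  have hfst : Measurable[𝓕.predictable] fun q : ℝ≥0 × Ω => (q.1 : ℝ) := by
    let _ : MeasurableSpace (ℝ≥0 × Ω) := 𝓕.predictable
    refine measurable_coe_nnreal_real.comp (measurable_of_Ioi fun i => ?_)
    have := measurableSet_predictable_Ioi_prod (𝓕 := 𝓕) (i := i) (@MeasurableSet.univ _ (𝓕 i))
    rwa [prod_univ] at this
  simp_rw [e]
  let _ : MeasurableSpace (ℝ≥0 × Ω) := 𝓕.predictable
  refine hfst.mul (StronglyMeasurable.measurable ?_)
  exact StronglyMeasurable.integral_prod_left' (μ := volume.restrict (Ioc (0 : ℝ) 1))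
    (f := fun q : ℝ × (ℝ≥0 × Ω) => g (c q.1 * q.2.1, q.2.2)) hcomp.stronglyMeasurable

end

/-! ### A predictable version of the reserve. -/

namespace RiskModel

section

variable {Ω : Type*} [MeasurableSpace Ω] {μ : Measure Ω} [IsProbabilityMeasure μ]
  (M : RiskModel μ)

variable {M} in
/-- Convergence of the Picard iteration for the reserve. -/
theorem tendsto_picard {x T : ℝ} {R Z : ℝ → ℝ} {J : ℕ → ℝ → ℝ} (hT : 0 ≤ T)
    (hR : IntervalIntegrable (fun u => M.drift (R u)) volume 0 T)
    (hZ : Measurable Z) (hJ : ∀ k, Measurable (J k)) (h0 : ∀ t, J 0 t = 0)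
    (hrec : ∀ k, ∀ t ∈ Icc 0 T, J (k + 1) t = ∫ u in (0 : ℝ)..t, M.drift (x + J k u - Z u))
    (hRZ : ∀ᵐ u, u ∈ Icc 0 T → R u = x + (∫ s in (0 : ℝ)..u, M.drift (R s)) - Z u) :
    Tendsto (fun k => J k T) atTop (𝓝 (∫ u in (0 : ℝ)..T, M.drift (R u))) := by
  set I : ℝ → ℝ := fun t => ∫ u in (0 : ℝ)..t, M.drift (R u) with hI
  have hIc : ContinuousOn I (Icc 0 T) := by
    have := intervalIntegral.continuousOn_primitive_interval (μ := volume)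
      (f := fun u => M.drift (R u)) (a := 0) (b := T)
      ((intervalIntegrable_iff_integrableOn_Icc_of_le hT).1 hR |>.mono_set (by rw [uIcc_of_le hT]))
    rwa [uIcc_of_le hT] at this
  obtain ⟨K, hK⟩ := isCompact_Icc.exists_bound_of_continuousOn hIc
  have hK0 : 0 ≤ K := (norm_nonneg _).trans (hK 0 ⟨le_rfl, hT⟩)
  have hα := M.α_pos
  have hsub : ∀ t ∈ Icc 0 T, IntervalIntegrable (fun u => M.drift (R u)) volume 0 t := fun t ht =>
    hR.mono_set (by rw [uIcc_of_le ht.1, uIcc_of_le hT]; exact Icc_subset_Icc_right ht.2)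
  -- In the norm weighted by `exp (2 α t)` the iteration contracts by `1 / 2`, because the integral
  -- of `α exp (2 α u)` up to `t` is at most half of `exp (2 α t)`.
  have key : ∀ k, ∀ t ∈ Icc 0 T, |J k t - I t| ≤ K * (1 / 2) ^ k * Real.exp (2 * M.α * t) := by
    intro k
    induction k with
    | zero =>
      intro t ht
      rw [h0, zero_sub, abs_neg, pow_zero, mul_one]
      exact (hK t ht).trans (le_mul_of_one_le_right hK0 (Real.one_le_exp (by
        have := ht.1; positivity)))
    | succ k ih =>
      intro t ht
      have hbound : ∀ᵐ u, u ∈ Ioc 0 t → ‖M.drift (x + J k u - Z u) - M.drift (R u)‖ ≤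
          M.α * (K * (1 / 2) ^ k * Real.exp (2 * M.α * u)) := by
        filter_upwards [hRZ] with u hu hut
        have hu' : u ∈ Icc 0 T := ⟨hut.1.le, hut.2.trans ht.2⟩
        rw [hu hu', Real.norm_eq_abs]
        refine (M.abs_drift_sub_le _ _).trans (mul_le_mul_of_nonneg_left ?_ hα.le)
        have := ih u hu'
        rwa [show x + J k u - Z u - (x + (∫ s in (0 : ℝ)..u, M.drift (R s)) - Z u) =
          J k u - I u by simp only [hI]; ring]
      have hgi : IntervalIntegrable (fun u => M.α * (K * (1 / 2) ^ k * Real.exp (2 * M.α * u)))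
          volume 0 t := (by fun_prop : Continuous _).intervalIntegrable _ _
      have hm : AEStronglyMeasurable (fun u => M.drift (x + J k u - Z u) - M.drift (R u))
          (volume.restrict (uIoc 0 t)) := by
        rw [uIoc_of_le ht.1]
        exact ((M.continuous_drift.measurable.comp ((measurable_const.add (hJ k)).sub
          hZ)).aestronglyMeasurable).sub (hsub t ht).aestronglyMeasurable
      have hdi : IntervalIntegrable (fun u => M.drift (x + J k u - Z u) - M.drift (R u))
          volume 0 t := by
        refine hgi.mono_fun hm ?_
        rw [uIoc_of_le ht.1]
        filter_upwards [(ae_restrict_iff' measurableSet_Ioc).2 hbound] with u hu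
        exact hu.trans (le_abs_self _)
      have e : J (k + 1) t - I t =
          ∫ u in (0 : ℝ)..t, (M.drift (x + J k u - Z u) - M.drift (R u)) := by
        rw [hrec k t ht, hI, ← intervalIntegral.integral_sub _ (hsub t ht)]
        have := hdi.add (hsub t ht)
        simpa using this
      rw [e, ← Real.norm_eq_abs]
      refine (intervalIntegral.norm_integral_le_of_norm_le ht.1 hbound hgi).trans ?_
      have hd : ∀ u ∈ uIcc 0 t, HasDerivAt (fun u => K * (1 / 2) ^ (k + 1) * Real.exp (2 * M.α * u))
          (M.α * (K * (1 / 2) ^ k * Real.exp (2 * M.α * u))) u := fun u _ => by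
        have := (((hasDerivAt_id u).const_mul (2 * M.α)).exp).const_mul (K * (1 / 2) ^ (k + 1))
        exact this.congr_deriv (by simp only [id, pow_succ]; ring)
      rw [intervalIntegral.integral_eq_sub_of_hasDerivAt hd hgi]
      have : 0 ≤ K * (1 / 2) ^ (k + 1) * Real.exp (2 * M.α * 0) := by positivity
      linarith
  have hlim : Tendsto (fun k : ℕ => K * (1 / 2 : ℝ) ^ k * Real.exp (2 * M.α * T)) atTop (𝓝 0) := by
    simpa using ((tendsto_pow_atTop_nhds_zero_of_lt_one (by norm_num : (0 : ℝ) ≤ 1 / 2)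
      (by norm_num)).const_mul K).mul_const (Real.exp (2 * M.α * T))
  rw [tendsto_iff_norm_sub_tendsto_zero]
  exact squeeze_zero (fun _ => norm_nonneg _) (fun k => key k T ⟨hT, le_rfl⟩) hlim

/-- The aggregate claims strictly before `t`. -/
noncomputable def priorClaims (t : ℝ) (ω : Ω) : ℝ :=
  ∑' n, if M.claimTime n ω < t then M.U n ω else 0

variable {M} in
theorem IsRegular.priorClaims_eq {ω : Ω} (h : M.IsRegular ω) {n : ℕ} {t : ℝ}
    (ht : t ∈ Ioc (M.epoch n ω) (M.epoch (n + 1) ω)) :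
    M.priorClaims t ω = ∑ k ∈ Finset.range n, M.U k ω := by
  rw [priorClaims, tsum_eq_sum (s := Finset.range n)]
  · refine Finset.sum_congr rfl fun k hk => if_pos (lt_of_le_of_lt ?_ ht.1)
    exact h.strictMono_epoch.monotone (by simp at hk; omega)
  · intro k hk
    refine if_neg (not_lt.2 (ht.2.trans ?_))
    exact h.strictMono_epoch.monotone (by simp at hk; omega)

variable {M} in
theorem IsRegular.exists_mem_Ioc {ω : Ω} (h : M.IsRegular ω) {t : ℝ} (ht : 0 < t) :
    ∃ n, t ∈ Ioc (M.epoch n ω) (M.epoch (n + 1) ω) := by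
  obtain ⟨n, hn⟩ := h.exists_mem ht.le
  rcases hn.1.eq_or_lt with h1 | h1
  · cases n with
    | zero => rw [M.epoch_zero] at h1; linarith
    | succ n => exact ⟨n, by rw [← h1]; exact h.strictMono_epoch (Nat.lt_succ_self n), h1.ge⟩
  · exact ⟨n, h1, hn.2.le⟩

variable {M} in
theorem IsRegular.tendsto_aggregateClaims_left {ω : Ω} (h : M.IsRegular ω) {t : ℝ} (ht : 0 < t) :
    Tendsto (fun s => M.aggregateClaims s ω) (𝓝[<] t) (𝓝 (M.priorClaims t ω)) := by
  obtain ⟨n, hn⟩ := h.exists_mem_Ioc ht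
  refine tendsto_nhds_of_eventually_eq ?_
  filter_upwards [Ioo_mem_nhdsLT hn.1] with s hs
  rw [h.priorClaims_eq hn, h.aggregateClaims_eq_sum ⟨hs.1.le, hs.2.trans_le hn.2⟩]

variable [μ.IsComplete]

theorem measurableSet_filtration_of_null (t : ℝ≥0) {N : Set Ω} (hN : μ N = 0) :
    MeasurableSet[M.filtration t] N :=
  (le_sup_right : MeasurableSpace.generateFrom {N : Set Ω | μ N = 0} ≤ M.filtration t) _
    (MeasurableSpace.measurableSet_generateFrom hN)

theorem measurableSet_filtration_of_ae (t : ℝ≥0) {P : Ω → Prop} (hP : ∀ᵐ ω ∂μ, P ω) :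
    MeasurableSet[M.filtration t] {ω | P ω} :=
  @MeasurableSet.of_compl _ _ (M.filtration t) (M.measurableSet_filtration_of_null t hP)

theorem measurableSet_predictable_of_ae {P : Ω → Prop} (hP : ∀ᵐ ω ∂μ, P ω) :
    MeasurableSet[M.filtration.predictable] {q : ℝ≥0 × Ω | P q.2} := by
  have h1 := measurableSet_predictable_singleton_bot_prod (M.measurableSet_filtration_of_ae ⊥ hP)
  have h2 := measurableSet_predictable_Ioi_prod (M.measurableSet_filtration_of_ae 0 hP)
  convert @MeasurableSet.union _ M.filtration.predictable _ _ h1 h2 using 1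
  ext ⟨t, ω⟩
  rcases eq_or_ne t 0 with rfl | ht
  · simp
  · simp [ht, pos_iff_ne_zero]

theorem measurable_filtration_aggregateClaims {s t : ℝ≥0} (hst : s ≤ t) :
    Measurable[M.filtration t] (M.aggregateClaims s) := by
  refine Measurable.of_comap_le (le_trans ?_ le_sup_left)
  exact le_iSup (fun s : Iic t =>
    MeasurableSpace.comap (M.aggregateClaims ((s : ℝ≥0) : ℝ)) inferInstance) ⟨s, hst⟩

/-- Null sets belong to every `ℱ_t`, so on the exceptional scenarios both processes may be replaced
by zero. -/
theorem measurable_predictable_of_ae_tendsto_left {X : ℝ≥0 → Ω → ℝ}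
    {Z : ℝ≥0 × Ω → ℝ} (hX : ∀ t, Measurable[M.filtration t] (X t)) (hZ0 : ∀ᵐ ω ∂μ, Z (0, ω) = 0)
    (hZ : ∀ᵐ ω ∂μ, ∀ t, 0 < t → Tendsto (fun s => X s ω) (𝓝[<] t) (𝓝 (Z (t, ω)))) :
    ∃ Z' : ℝ≥0 × Ω → ℝ, Measurable[M.filtration.predictable] Z' ∧
      ∀ᵐ ω ∂μ, ∀ t, Z' (t, ω) = Z (t, ω) := by
  classical
  set P : Ω → Prop := fun ω => Z (0, ω) = 0 ∧
    ∀ t, 0 < t → Tendsto (fun s => X s ω) (𝓝[<] t) (𝓝 (Z (t, ω))) with hPdef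
  have hP : ∀ᵐ ω ∂μ, P ω := hZ0.and hZ
  refine ⟨fun q => if P q.2 then Z q else 0,
    MeasureTheory.Filtration.measurable_predictable_of_tendsto_left
      (X := fun t ω => if P ω then X t ω else 0) (fun t => ?_) ?_ (fun ω t ht => ?_), ?_⟩
  · exact @Measurable.ite Ω ℝ (X t) (fun _ => 0) (M.filtration t) _ _ _
      (M.measurableSet_filtration_of_ae t hP) (hX t) (@measurable_const _ _ _ (M.filtration t) _)
  · have : (fun ω => if P ω then Z (0, ω) else 0) = fun _ => 0 := by
      funext ω
      by_cases h : P ω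
      · rw [if_pos h, h.1]
      · rw [if_neg h]
    simp only [this]
    exact @measurable_const _ _ _ (M.filtration 0) _
  · by_cases h : P ω
    · simpa only [h, if_true] using h.2 t ht
    · simp only [h, if_false]
      exact tendsto_const_nhds
  · filter_upwards [hP] with ω hω t
    simp only [hω, if_true]

theorem exists_predictable_priorClaims : ∃ Z : ℝ≥0 × Ω → ℝ,
    Measurable[M.filtration.predictable] Z ∧
      ∀ᵐ ω ∂μ, ∀ t : ℝ≥0, Z (t, ω) = M.priorClaims t ω := by
  refine M.measurable_predictable_of_ae_tendsto_left (X := fun t => M.aggregateClaims t)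
    (Z := fun q => M.priorClaims q.1 q.2)
    (fun t => M.measurable_filtration_aggregateClaims le_rfl) ?_ ?_
  · filter_upwards [M.ae_isRegular] with ω hω
    have : ∀ n, ¬ M.claimTime n ω < 0 := fun n => not_lt.2 (hω.epoch_nonneg _)
    simp [priorClaims, this]
  · filter_upwards [M.ae_isRegular] with ω hω t ht
    refine (hω.tendsto_aggregateClaims_left (NNReal.coe_pos.2 ht)).comp ?_
    refine tendsto_nhdsWithin_iff.2 ⟨(NNReal.continuous_coe.tendsto t).mono_left
      nhdsWithin_le_nhds, ?_⟩
    filter_upwards [self_mem_nhdsWithin] with s hs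
    exact NNReal.coe_lt_coe.2 hs

/-- The reserve just before a possible claim has a predictable version. -/
theorem Strategy.exists_predictable_reserve {M : RiskModel μ} {x : ℝ} (S : M.Strategy x) :
    ∃ v : ℝ≥0 × Ω → ℝ, Measurable[M.filtration.predictable] v ∧ ∀ᵐ ω ∂μ, ∀ t : ℝ≥0,
      v (t, ω) = x + (∫ u in (0 : ℝ)..t, M.drift (S.R u ω)) - M.priorClaims t ω - S.L t ω := by
  classical
  obtain ⟨Y, hY, hY'⟩ := M.exists_predictable_priorClaims
  set Z : ℝ≥0 × Ω → ℝ := fun q => Y q + S.L q.1 q.2 with hZdef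
  have hZ : Measurable[M.filtration.predictable] Z := by
    let _ : MeasurableSpace (ℝ≥0 × Ω) := M.filtration.predictable
    exact hY.add S.predictable.measurable
  -- The reserve of a strategy is not assumed to be measurable in the scenario. The Picard iterates
  -- of its equation are predictable by induction and converge to the true cumulated income.
  let J : ℕ → ℝ≥0 × Ω → ℝ := fun k => Nat.rec (fun _ => 0) (fun _ J q =>
    ∫ s in (0 : ℝ)..q.1, M.drift (x + J (s.toNNReal, q.2) - Z (s.toNNReal, q.2))) k
  have hJ : ∀ k, Measurable[M.filtration.predictable] (J k) := by
    intro k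
    induction k with
    | zero => exact @measurable_const _ _ _ M.filtration.predictable _
    | succ k ih =>
      refine MeasureTheory.Filtration.measurable_predictable_integral
        (g := fun q => M.drift (x + J k q - Z q)) ?_
      let _ : MeasurableSpace (ℝ≥0 × Ω) := M.filtration.predictable
      exact M.continuous_drift.measurable.comp ((measurable_const.add ih).sub hZ)
  have hsec : ∀ f : ℝ≥0 × Ω → ℝ, Measurable[M.filtration.predictable] f → ∀ ω,
      Measurable fun s : ℝ => f (s.toNNReal, ω) := fun f hf ω =>
    (hf.mono M.predictable_le le_rfl).comp (measurable_real_toNNReal.prodMk measurable_const)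
  set P : Ω → Prop := fun ω => ∀ t : ℝ≥0, Tendsto (fun k => J k (t, ω)) atTop
    (𝓝 (∫ u in (0 : ℝ)..t, M.drift (S.R u ω))) with hPdef
  have hP : ∀ᵐ ω ∂μ, P ω := by
    filter_upwards [M.ae_isRegular, S.dynamics, hY'] with ω hω hdyn hYω t
    have := M.tendsto_picard (x := x) (T := t) (R := fun s => S.R s ω)
      (Z := fun s => Z (s.toNNReal, ω)) (J := fun k s => J k (s.toNNReal, ω)) t.2
      (hdyn t t.2).1 (hsec Z hZ ω) (fun k => hsec _ (hJ k) ω) (fun _ => rfl) ?_ ?_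
    · simpa only [Real.toNNReal_coe] using this
    · intro k s hs
      simp only [J, Real.coe_toNNReal s hs.1]
    · have hcount : (range fun n => M.epoch n ω).Countable := countable_range _
      filter_upwards [measure_eq_zero_iff_ae_notMem.1 (hcount.measure_zero volume)] with u hu hut
      have h1 := (hdyn u hut.1).2
      rw [h1]
      simp only [hZdef, hYω, Real.coe_toNNReal u hut.1]
      have hu0 : 0 < u := hut.1.lt_of_ne fun h0 => hu ⟨0, by simp [M.epoch_zero, h0]⟩
      obtain ⟨n, hn⟩ := hω.exists_mem_Ioc hu0
      rw [hω.priorClaims_eq hn, hω.aggregateClaims_eq_sum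
        ⟨hn.1.le, hn.2.lt_of_ne fun h0 => hu ⟨n + 1, h0.symm⟩⟩]
      ring
  refine ⟨fun q => x + (if P q.2 then ∫ u in (0 : ℝ)..q.1, M.drift (S.R u q.2) else 0) - Z q, ?_, ?_⟩
  · let _ : MeasurableSpace (ℝ≥0 × Ω) := M.filtration.predictable
    refine (measurable_const.add ?_).sub hZ
    refine measurable_of_tendsto_metrizable (f := fun k q => if P q.2 then J k q else 0)
      (fun k => Measurable.ite (M.measurableSet_predictable_of_ae hP) (hJ k) measurable_const)
      (tendsto_pi_nhds.2 fun q => ?_)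
    by_cases h : P q.2
    · simpa only [h, if_true] using h q.1
    · simp only [h, if_false]
      exact tendsto_const_nhds
  · filter_upwards [hP, hY'] with ω h1 h2 t
    simp only [h1, if_true, hZdef, h2]
    ring

end

end RiskModel

/-! ### Reserve paths across the claims. -/

namespace RiskModel

section

variable {Ω : Type*} [MeasurableSpace Ω] {μ : Measure Ω} [IsProbabilityMeasure μ]

/-- In the scenario `ω`, `R` is the reserve that results from the initial reserve `x` and the
dividends `L`, and `v t` is the reserve at time `t` before a possible claim at `t`. -/
structure IsClaimPath (M : RiskModel μ) (ω : Ω) (x : ℝ) (R L v : ℝ → ℝ) : Prop where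
  regular : M.IsRegular ω
  mono : Monotone L
  leftCont : ∀ t, ContinuousWithinAt L (Iic t) t
  eq_zero : L 0 = 0
  integrable : ∀ t, 0 ≤ t → IntervalIntegrable (fun u => M.drift (R u)) volume 0 t
  dyn : ∀ t, 0 ≤ t → R t = x + (∫ u in (0 : ℝ)..t, M.drift (R u)) - M.aggregateClaims t ω - L t
  before : ∀ t, 0 ≤ t → v t = x + (∫ u in (0 : ℝ)..t, M.drift (R u)) - M.priorClaims t ω - L t

variable {M : RiskModel μ} {ω : Ω} {x : ℝ} {R L v : ℝ → ℝ}

theorem IsRegular.aggregateClaims_mono (h : M.IsRegular ω) :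
    Monotone fun t => M.aggregateClaims t ω := by
  intro s t hst
  obtain ⟨n, hn⟩ := (h.tendsto.comp (tendsto_add_atTop_nat 1)).eventually_gt_atTop t |>.exists
  simp only [h.aggregateClaims_eq hn, h.aggregateClaims_eq (hst.trans_lt hn)]
  refine Finset.sum_le_sum fun k _ => ?_
  split_ifs with h1 h2 h2
  · exact le_rfl
  · exact absurd (h1.trans hst) h2
  · exact h.U_nonneg k
  · exact le_rfl

theorem IsRegular.aggregateClaims_nonneg (h : M.IsRegular ω) (t : ℝ) :
    0 ≤ M.aggregateClaims t ω := tsum_nonneg fun n => by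
  split_ifs
  · exact h.U_nonneg n
  · exact le_rfl

theorem IsRegular.priorClaims_nonneg (h : M.IsRegular ω) (t : ℝ) :
    0 ≤ M.priorClaims t ω := tsum_nonneg fun n => by
  split_ifs
  · exact h.U_nonneg n
  · exact le_rfl

theorem IsRegular.aggregateClaims_zero (h : M.IsRegular ω) : M.aggregateClaims 0 ω = 0 := by
  have := h.aggregateClaims_eq_sum (n := 0) (t := 0) ⟨(M.epoch_zero ω).le, by
    rw [M.epoch_succ, M.epoch_zero, zero_add]; exact h.W_pos 0⟩
  simpa using this

namespace IsClaimPath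

theorem nonneg (h : M.IsClaimPath ω x R L v) {t : ℝ} (ht : 0 ≤ t) : 0 ≤ L t :=
  h.eq_zero ▸ h.mono ht

theorem integrable_sub (h : M.IsClaimPath ω x R L v) {s t : ℝ} (hs : 0 ≤ s) (ht : 0 ≤ t) :
    IntervalIntegrable (fun u => M.drift (R u)) volume s t :=
  (h.integrable s hs).symm.trans (h.integrable t ht)

theorem apply_zero (h : M.IsClaimPath ω x R L v) : R 0 = x := by
  rw [h.dyn 0 le_rfl, h.eq_zero, h.regular.aggregateClaims_zero]
  simp

theorem reserve_eq_before (h : M.IsClaimPath ω x R L v) {n : ℕ} {t : ℝ}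
    (ht : t ∈ Ioo (M.epoch n ω) (M.epoch (n + 1) ω)) : R t = v t := by
  have h0 : 0 ≤ t := (h.regular.epoch_nonneg n).trans ht.1.le
  rw [h.dyn t h0, h.before t h0, h.regular.aggregateClaims_eq_sum ⟨ht.1.le, ht.2⟩,
    h.regular.priorClaims_eq ⟨ht.1, ht.2.le⟩]

theorem reserve_epoch_succ (h : M.IsClaimPath ω x R L v) (n : ℕ) :
    R (M.epoch (n + 1) ω) = v (M.epoch (n + 1) ω) - M.U n ω := by
  have hlt := h.regular.strictMono_epoch (Nat.lt_succ_self n)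
  have hlt' := h.regular.strictMono_epoch (Nat.lt_succ_self (n + 1))
  rw [h.dyn _ (h.regular.epoch_nonneg _), h.before _ (h.regular.epoch_nonneg _),
    h.regular.aggregateClaims_eq_sum ⟨le_rfl, hlt'⟩, h.regular.priorClaims_eq ⟨hlt, le_rfl⟩,
    Finset.sum_range_succ]
  ring

theorem integral_update (R : ℝ → ℝ) (b c s t : ℝ) :
    ∫ u in s..t, M.drift (Function.update R b c u) = ∫ u in s..t, M.drift (R u) := by
  refine intervalIntegral.integral_congr_ae ?_
  filter_upwards [measure_eq_zero_iff_ae_notMem.1 (measure_singleton (μ := volume) b)] with u hu _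
  rw [Function.update_of_ne (by simpa using hu)]

theorem intervalIntegrable_update {R : ℝ → ℝ} (b c : ℝ) {s t : ℝ}
    (h : IntervalIntegrable (fun u => M.drift (R u)) volume s t) :
    IntervalIntegrable (fun u => M.drift (Function.update R b c u)) volume s t := by
  refine h.congr_ae (ae_restrict_of_ae ?_)
  filter_upwards [measure_eq_zero_iff_ae_notMem.1 (measure_singleton (μ := volume) b)] with u hu
  rw [Function.update_of_ne (by simpa using hu)]

/-- The path between two claims, continued up to the time just before the second one. -/
theorem isReservePath (h : M.IsClaimPath ω x R L v) (n : ℕ) :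
    M.IsReservePath (Function.update R (M.epoch (n + 1) ω) (v (M.epoch (n + 1) ω))) L
      (M.epoch n ω) (M.epoch (n + 1) ω) := by
  have hlt := h.regular.strictMono_epoch (Nat.lt_succ_self n)
  have h0 := h.regular.epoch_nonneg n
  have h1 := h.regular.epoch_nonneg (n + 1)
  refine ⟨h.mono, h.leftCont, hlt.le, intervalIntegrable_update _ _ (h.integrable_sub h0 h1), ?_⟩
  intro s hs
  have hs0 : 0 ≤ s := h0.trans hs.1
  have hI : ∫ u in (M.epoch n ω)..s, M.drift (R u) =
      (∫ u in (0 : ℝ)..s, M.drift (R u)) - ∫ u in (0 : ℝ)..(M.epoch n ω), M.drift (R u) :=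
    (intervalIntegral.integral_interval_sub_left (h.integrable s hs0) (h.integrable _ h0)).symm
  rw [integral_update, hI, Function.update_of_ne hlt.ne, h.dyn _ h0,
    h.regular.aggregateClaims_eq_sum ⟨le_rfl, hlt⟩]
  rcases hs.2.eq_or_lt with rfl | hs2
  · rw [Function.update_self, h.before _ h1, h.regular.priorClaims_eq ⟨hlt, le_rfl⟩]
    ring
  · rw [Function.update_of_ne hs2.ne, h.dyn _ hs0, h.regular.aggregateClaims_eq_sum ⟨hs.1, hs2⟩]
    ring

/-- After ruin the reserve stays at or below the critical level. -/
theorem le_critical_of_le (h : M.IsClaimPath ω x R L v) {a : ℝ} (ha : 0 ≤ a)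
    (hR : R a ≤ M.critical) {t : ℝ} (ht : a ≤ t) : R t ≤ M.critical := by
  have hα := M.α_pos
  have hi := h.integrable_sub ha (ha.trans ht)
  -- Grönwall is applied to the positive part of the drift, whose integrability is part of the data;
  -- a reserve with nonpositive drift is at or below the critical level.
  have hpos : IntervalIntegrable (fun u => max (M.drift (R u)) 0) volume a t :=
    ⟨hi.1.pos_part, hi.2.pos_part⟩
  have key := gronwall_nonpos ht hα.le hpos (fun s hs => ?_) t ⟨ht, le_rfl⟩
  · by_contra! hcon
    exact absurd ((le_max_left _ _).trans key) (not_le.2 (M.drift_pos hcon))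
  · have hs0 : 0 ≤ s := ha.trans hs.1
    have hsub : uIcc a s ⊆ uIcc a t := by
      rw [uIcc_of_le hs.1, uIcc_of_le ht]; exact Icc_subset_Icc_right hs.2
    have h1 : R s ≤ M.critical + ∫ u in a..s, M.drift (R u) := by
      have hI := intervalIntegral.integral_interval_sub_left (h.integrable s hs0) (h.integrable a ha)
      have e1 := h.dyn s hs0
      have e2 := h.dyn a ha
      have e3 := h.mono hs.1
      have e4 := h.regular.aggregateClaims_mono hs.1
      simp only at e4
      linarith
    have h2 : ∫ u in a..s, M.drift (R u) ≤ ∫ u in a..s, max (M.drift (R u)) 0 :=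
      intervalIntegral.integral_mono_on hs.1 (hi.mono_set hsub) (hpos.mono_set hsub)
        fun u _ => le_max_left _ _
    have h3 : 0 ≤ ∫ u in a..s, max (M.drift (R u)) 0 :=
      intervalIntegral.integral_nonneg hs.1 fun u _ => le_max_right _ _
    refine max_le ?_ (by positivity)
    have h4 : M.drift (R s) ≤ M.drift (M.critical + ∫ u in a..s, max (M.drift (R u)) 0) :=
      M.monotone_drift (by linarith)
    have h5 := M.abs_drift_sub_le (M.critical + ∫ u in a..s, max (M.drift (R u)) 0) M.critical
    rw [M.drift_critical, sub_zero, add_sub_cancel_left, abs_of_nonneg h3] at h5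
    exact h4.trans ((le_abs_self _).trans h5)

/-- The reserve grows at most exponentially, at the rate of credit interest. -/
theorem integral_drift_le (h : M.IsClaimPath ω x R L v) {t : ℝ} (ht : 0 ≤ t) :
    x + ∫ u in (0 : ℝ)..t, M.drift (R u) ≤ (x + M.p / M.r) * Real.exp (M.r * t) - M.p / M.r := by
  have hr := M.r_pos
  set I : ℝ → ℝ := fun s => ∫ u in (0 : ℝ)..s, M.drift (R u) with hI
  have hIc : ContinuousOn I (Icc 0 t) := continuousOn_primitive_of_le ht (h.integrable t ht)
  have hII : IntervalIntegrable I volume 0 t :=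
    ContinuousOn.intervalIntegrable (by rwa [uIcc_of_le ht])
  have hE : ∀ s, IntervalIntegrable (fun u => (x + M.p / M.r) * (Real.exp (M.r * u) - 1)) volume 0 s :=
    fun s => (by fun_prop : Continuous _).intervalIntegrable _ _
  -- The function subtracted from `I` is the solution of `I' = p + r (x + I)`, `I 0 = 0`: income at
  -- the credit rate without claims and dividends.
  have key := gronwall_nonpos ht hr.le
    (f := fun s => I s - (x + M.p / M.r) * (Real.exp (M.r * s) - 1)) (hII.sub (hE t))
    (fun s hs => ?_) t ⟨ht, le_rfl⟩
  · simp only [hI] at key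
    linarith
  · have hsub : uIcc 0 s ⊆ uIcc 0 t := by
      rw [uIcc_of_le hs.1, uIcc_of_le ht]; exact Icc_subset_Icc_right hs.2
    have hIs := hII.mono_set hsub
    have h1 : I s ≤ ∫ u in (0 : ℝ)..s, (M.p + M.r * (x + I u)) := by
      refine intervalIntegral.integral_mono_on hs.1 (h.integrable s hs.1)
        ((intervalIntegrable_const).add ((intervalIntegrable_const.add hIs).const_mul _))
        fun u hu => ?_
      refine (M.drift_le_r _).trans ?_
      have := h.dyn u hu.1
      have e1 := h.regular.aggregateClaims_nonneg u
      have e2 := h.nonneg hu.1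
      have : R u ≤ x + I u := by simp only [hI]; linarith
      nlinarith
    rw [intervalIntegral.integral_sub hIs (hE s)]
    have h2 : ∫ u in (0 : ℝ)..s, (M.p + M.r * (x + I u)) =
        (M.p + M.r * x) * s + M.r * ∫ u in (0 : ℝ)..s, I u := by
      have : ∀ u, M.p + M.r * (x + I u) = (M.p + M.r * x) + M.r * I u := fun u => by ring
      simp_rw [this]
      rw [intervalIntegral.integral_add intervalIntegrable_const (hIs.const_mul _)]
      simp
      ring
    have h3 : M.r * ∫ u in (0 : ℝ)..s, (x + M.p / M.r) * (Real.exp (M.r * u) - 1) =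
        (x + M.p / M.r) * (Real.exp (M.r * s) - 1) - (M.p + M.r * x) * s := by
      have hd : ∀ u ∈ uIcc 0 s, HasDerivAt (fun u => (x + M.p / M.r) * (Real.exp (M.r * u) / M.r - u))
          ((x + M.p / M.r) * (Real.exp (M.r * u) - 1)) u := fun u _ => by
        have := ((((hasDerivAt_id u).const_mul M.r).exp.div_const M.r).sub
          (hasDerivAt_id u)).const_mul (x + M.p / M.r)
        exact this.congr_deriv (by simp only [id]; field_simp)
      rw [intervalIntegral.integral_eq_sub_of_hasDerivAt hd (hE s)]
      simp
      field_simp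
      ring
    linarith

/-- Linear growth of the value meets growth `exp (r t)` of the reserve and discounting by `exp (-δ
t)`. As `r < δ`, the product decays, which is the transversality condition. -/
theorem discounted_le (h : M.IsClaimPath ω x R L v) {C : ℝ} (hC : 0 ≤ C)
    (hW : ∀ y, M.critical ≤ y → M.minSuper y ≤ C * (y - M.critical + 1)) {t y : ℝ} (ht : 0 ≤ t)
    (hy : y ≤ x + ∫ u in (0 : ℝ)..t, M.drift (R u)) :
    Real.exp (-M.δ * t) * M.minSuper y ≤
      C * (|x| + M.p / M.r - M.critical + 1) * Real.exp (-(M.δ - M.r) * t) := by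
  have hr := M.r_pos
  have hp := M.p_pos
  have hc := M.critical_neg
  have hpr : 0 < M.p / M.r := div_pos hp hr
  have hx0 := abs_nonneg x
  rcases lt_or_ge y M.critical with hy' | hy'
  · rw [M.isSuper_minSuper.zero _ hy'.le, mul_zero]
    have : 0 ≤ |x| + M.p / M.r - M.critical + 1 := by linarith
    positivity
  · have h1 := h.integral_drift_le ht
    have he : 1 ≤ Real.exp (M.r * t) := Real.one_le_exp (by positivity)
    have h2 : y - M.critical + 1 ≤ (|x| + M.p / M.r - M.critical + 1) * Real.exp (M.r * t) := by
      have := le_abs_self x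
      nlinarith
    have h3 : M.minSuper y ≤ C * ((|x| + M.p / M.r - M.critical + 1) * Real.exp (M.r * t)) :=
      (hW y hy').trans (mul_le_mul_of_nonneg_left h2 hC)
    calc Real.exp (-M.δ * t) * M.minSuper y ≤ Real.exp (-M.δ * t) *
          (C * ((|x| + M.p / M.r - M.critical + 1) * Real.exp (M.r * t))) :=
          mul_le_mul_of_nonneg_left h3 (Real.exp_pos _).le
      _ = _ := by
          rw [show -(M.δ - M.r) * t = -M.δ * t + M.r * t by ring, Real.exp_add]
          ring

end IsClaimPath

end

end RiskModel

/-! ### Summation over the claims. -/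

section Telescope

variable {Ω : Type*} [MeasurableSpace Ω] {μ : Measure Ω} {A C D E P : ℕ → Ω → ℝ≥0∞}

theorem sum_tsub_add_of_antitone {a : ℕ → ℝ≥0∞} (ha : ∀ n, a (n + 1) ≤ a n) (n : ℕ) :
    ∑ k ∈ Finset.range n, (a k - a (k + 1)) + a n = a 0 := by
  induction n with
  | zero => simp
  | succ n ih => rw [Finset.sum_range_succ, add_assoc, tsub_add_cancel_of_le (ha n), ih]

/-- `P n` stands for the dividends between two claims, `A n` and `E n` for the values at the start
and just before the next claim, `C n` and `D n` for their compensators. In expectation `E` cancels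
`C`, and `D` turns into the next `A`. No measurability of `P` is assumed: it is compared with the
measurable residual `A + C - (E + D)`. -/
theorem lintegral_tsum_telescope (hA : ∀ n, AEMeasurable (A n) μ) (hC : ∀ n, AEMeasurable (C n) μ)
    (hD : ∀ n, AEMeasurable (D n) μ) (hE : ∀ n, AEMeasurable (E n) μ)
    (hEC : ∀ n, ∫⁻ ω, E n ω ∂μ = ∫⁻ ω, C n ω ∂μ)
    (hAD : ∀ n, ∫⁻ ω, A (n + 1) ω ∂μ = ∫⁻ ω, D n ω ∂μ)
    (hEfin : ∀ n, ∫⁻ ω, E n ω ∂μ ≠ ∞) (hAfin : ∀ n, ∫⁻ ω, A n ω ∂μ ≠ ∞)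
    (h : ∀ᵐ ω ∂μ, ∀ n, P n ω + (E n ω + D n ω) ≤ A n ω + C n ω) :
    (∀ n, ∫⁻ ω, A (n + 1) ω ∂μ ≤ ∫⁻ ω, A n ω ∂μ) ∧
    ∫⁻ ω, ∑' n, (A n ω + C n ω - (E n ω + D n ω)) ∂μ =
      ∑' n, (∫⁻ ω, A n ω ∂μ - ∫⁻ ω, A (n + 1) ω ∂μ) ∧
    ∀ᵐ ω ∂μ, ∀ n, E n ω + D n ω ≠ ∞ := by
  have hDfin : ∀ n, ∫⁻ ω, D n ω ∂μ ≠ ∞ := fun n => hAD n ▸ hAfin (n + 1)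
  have hle : ∀ n, ∀ᵐ ω ∂μ, E n ω + D n ω ≤ A n ω + C n ω := fun n => by
    filter_upwards [h] with ω hω
    exact le_add_self.trans (hω n)
  have hED : ∀ n, ∫⁻ ω, (E n ω + D n ω) ∂μ = ∫⁻ ω, C n ω ∂μ + ∫⁻ ω, A (n + 1) ω ∂μ := fun n => by
    rw [lintegral_add_left' (hE n), hEC, hAD]
  have hAC : ∀ n, ∫⁻ ω, (A n ω + C n ω) ∂μ = ∫⁻ ω, C n ω ∂μ + ∫⁻ ω, A n ω ∂μ := fun n => by
    rw [lintegral_add_left' (hA n), add_comm]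
  have hfin : ∀ n, ∫⁻ ω, (E n ω + D n ω) ∂μ ≠ ∞ := fun n => by
    rw [lintegral_add_left' (hE n)]
    exact ENNReal.add_ne_top.2 ⟨hEfin n, hDfin n⟩
  refine ⟨fun n => ?_, ?_, ae_all_iff.2 fun n => ?_⟩
  · have := lintegral_mono_ae (hle n)
    rw [hED, hAC] at this
    exact (ENNReal.add_le_add_iff_left (hEC n ▸ hEfin n)).1 this
  · rw [lintegral_tsum (f := fun n ω => A n ω + C n ω - (E n ω + D n ω)) fun n => ((hA n).add (hC n)).sub ((hE n).add (hD n))]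
    refine tsum_congr fun n => ?_
    rw [lintegral_sub' (g := fun ω => E n ω + D n ω) ((hE n).add (hD n)) (hfin n) (hle n), hED, hAC]
    exact ENNReal.add_sub_add_eq_sub_left (hEC n ▸ hEfin n)
  · filter_upwards [ae_lt_top' ((hE n).add (hD n)) (hfin n)] with ω hω
    exact hω.ne

theorem lintegral_tsum_le_of_telescope (hA : ∀ n, AEMeasurable (A n) μ)
    (hC : ∀ n, AEMeasurable (C n) μ)
    (hD : ∀ n, AEMeasurable (D n) μ) (hE : ∀ n, AEMeasurable (E n) μ)
    (hEC : ∀ n, ∫⁻ ω, E n ω ∂μ = ∫⁻ ω, C n ω ∂μ)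
    (hAD : ∀ n, ∫⁻ ω, A (n + 1) ω ∂μ = ∫⁻ ω, D n ω ∂μ)
    (hEfin : ∀ n, ∫⁻ ω, E n ω ∂μ ≠ ∞) (hAfin : ∀ n, ∫⁻ ω, A n ω ∂μ ≠ ∞)
    (h : ∀ᵐ ω ∂μ, ∀ n, P n ω + (E n ω + D n ω) ≤ A n ω + C n ω) :
    ∫⁻ ω, ∑' n, P n ω ∂μ ≤ ∫⁻ ω, A 0 ω ∂μ := by
  obtain ⟨h1, h2, h3⟩ := lintegral_tsum_telescope hA hC hD hE hEC hAD hEfin hAfin h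
  calc ∫⁻ ω, ∑' n, P n ω ∂μ ≤ ∫⁻ ω, ∑' n, (A n ω + C n ω - (E n ω + D n ω)) ∂μ := by
        refine lintegral_mono_ae ?_
        filter_upwards [h, h3] with ω hω hω3
        exact ENNReal.tsum_le_tsum fun n => ENNReal.le_sub_of_add_le_right (hω3 n) (hω n)
    _ = _ := h2
    _ ≤ _ := by
        rw [ENNReal.tsum_eq_iSup_nat]
        refine iSup_le fun n => ?_
        rw [← sum_tsub_add_of_antitone h1 n]
        exact le_self_add

theorem lintegral_tsum_eq_of_telescope (hA : ∀ n, AEMeasurable (A n) μ)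
    (hC : ∀ n, AEMeasurable (C n) μ)
    (hD : ∀ n, AEMeasurable (D n) μ) (hE : ∀ n, AEMeasurable (E n) μ)
    (hEC : ∀ n, ∫⁻ ω, E n ω ∂μ = ∫⁻ ω, C n ω ∂μ)
    (hAD : ∀ n, ∫⁻ ω, A (n + 1) ω ∂μ = ∫⁻ ω, D n ω ∂μ)
    (hEfin : ∀ n, ∫⁻ ω, E n ω ∂μ ≠ ∞) (hAfin : ∀ n, ∫⁻ ω, A n ω ∂μ ≠ ∞)
    (h : ∀ᵐ ω ∂μ, ∀ n, P n ω + (E n ω + D n ω) = A n ω + C n ω)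
    (hlim : Tendsto (fun n => ∫⁻ ω, A n ω ∂μ) atTop (𝓝 0)) :
    ∫⁻ ω, ∑' n, P n ω ∂μ = ∫⁻ ω, A 0 ω ∂μ := by
  refine le_antisymm (lintegral_tsum_le_of_telescope hA hC hD hE hEC hAD hEfin hAfin
    (h.mono fun ω hω n => (hω n).le)) ?_
  obtain ⟨h1, h2, h3⟩ := lintegral_tsum_telescope hA hC hD hE hEC hAD hEfin hAfin
    (h.mono fun ω hω n => (hω n).le)
  have e : ∫⁻ ω, ∑' n, P n ω ∂μ = ∫⁻ ω, ∑' n, (A n ω + C n ω - (E n ω + D n ω)) ∂μ := by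
    refine lintegral_congr_ae ?_
    filter_upwards [h, h3] with ω hω hω3
    refine tsum_congr fun n => ?_
    rw [← hω n, ENNReal.add_sub_cancel_right (hω3 n)]
  rw [e, h2]
  have hadd : Tendsto (fun n => ∑' n, (∫⁻ ω, A n ω ∂μ - ∫⁻ ω, A (n + 1) ω ∂μ) + ∫⁻ ω, A n ω ∂μ)
      atTop (𝓝 (∑' n, (∫⁻ ω, A n ω ∂μ - ∫⁻ ω, A (n + 1) ω ∂μ) + 0)) := hlim.const_add _
  rw [add_zero] at hadd
  refine ge_of_tendsto' hadd fun n => ?_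
  rw [← sum_tsub_add_of_antitone h1 n]
  gcongr
  exact ENNReal.sum_le_tsum _

end Telescope

/-! ### The account of a single scenario. -/

namespace RiskModel

section

variable {Ω : Type*} [MeasurableSpace Ω] {μ : Measure Ω} [IsProbabilityMeasure μ]
  {M : RiskModel μ} {ω : Ω} {x : ℝ} {R L v : ℝ → ℝ}

/-- The times up to which ruin has not occurred. -/
def solventTimes (M : RiskModel μ) (R : ℝ → ℝ) : Set ℝ :=
  {t | 0 ≤ t ∧ ∀ s ∈ Ico 0 t, M.critical < R s}

theorem measurableSet_solventTimes : MeasurableSet (M.solventTimes R) :=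
  OrdConnected.measurableSet ⟨fun _ ha _ hb _ ht =>
    ⟨ha.1.trans ht.1, fun v hv => hb.2 v ⟨hv.1, hv.2.trans_le ht.2⟩⟩⟩

theorem BandRule.update {A B : Set ℝ} {t b c : ℝ} (h : M.BandRule A B R L t) (hb : t ≠ b) :
    M.BandRule A B (Function.update R b c) L t := by
  unfold BandRule at *
  simp only [Function.update_of_ne hb, IsClaimPath.integral_update]
  exact h

theorem lintegral_exp_stieltjes (hL : Monotone L) {s : Set ℝ} {a b : ℝ} (hs : s ⊆ Icc a b) :
    ∫⁻ t in s, ENNReal.ofReal (Real.exp (-M.δ * t)) ∂hL.stieltjesFunction.measure =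
      ENNReal.ofReal (M.paid hL s) :=
  (ofReal_integral_eq_lintegral_ofReal ((integrableOn_exp_stieltjes hL M.δ a b).mono_set hs)
    (Eventually.of_forall fun _ => (Real.exp_pos _).le)).symm

namespace IsClaimPath

theorem solventTimes_inter_subset (n : ℕ) :
    M.solventTimes R ∩ Ico (M.epoch n ω) (M.epoch (n + 1) ω) ⊆
      Icc (M.epoch n ω) (M.epoch (n + 1) ω) := fun _ ht => ⟨ht.2.1, ht.2.2.le⟩

/-- The balance of the discounted value between two claims. -/
theorem paid_le_and_le (h : M.IsClaimPath ω x R L v) (n : ℕ) :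
    ((∀ t, 0 ≤ t → (∀ s ∈ Ico 0 t, M.critical < R s) →
      Function.rightLim L t - L t ≤ max (R t - M.critical) 0) →
      M.paid h.mono (M.solventTimes R ∩ Ico (M.epoch n ω) (M.epoch (n + 1) ω)) +
        Real.exp (-M.δ * M.epoch (n + 1) ω) * M.minSuper (v (M.epoch (n + 1) ω)) ≤
      Real.exp (-M.δ * M.epoch n ω) * M.minSuper (R (M.epoch n ω)) +
        ∫ u in (M.epoch n ω)..(M.epoch (n + 1) ω), M.claimLoss M.minSuper v u) ∧
    ((∀ t, 0 ≤ t → M.BandRule (M.bandA M.minSuper) (M.bandB M.minSuper) R L t) →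
      Real.exp (-M.δ * M.epoch n ω) * M.minSuper (R (M.epoch n ω)) +
        ∫ u in (M.epoch n ω)..(M.epoch (n + 1) ω), M.claimLoss M.minSuper v u ≤
      M.paid h.mono (M.solventTimes R ∩ Ico (M.epoch n ω) (M.epoch (n + 1) ω)) +
        Real.exp (-M.δ * M.epoch (n + 1) ω) * M.minSuper (v (M.epoch (n + 1) ω))) := by
  set a := M.epoch n ω with ha
  set b := M.epoch (n + 1) ω with hb
  have hab : a < b := h.regular.strictMono_epoch (Nat.lt_succ_self n)
  have ha0 : 0 ≤ a := h.regular.epoch_nonneg n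
  have hp := h.isReservePath n
  rw [← ha, ← hb] at hp
  set R' := Function.update R b (v b) with hR'
  have hRR' : ∀ t, t ≠ b → R' t = R t := fun t ht => Function.update_of_ne ht _ _
  have hvR' : ∀ t ∈ Ioc a b, v t = R' t := fun t ht => by
    rcases ht.2.eq_or_lt with rfl | h2
    · simp [hR']
    · rw [hRR' _ h2.ne, h.reserve_eq_before ⟨ht.1, h2⟩]
  have hint : ∫ u in a..b, M.claimLoss M.minSuper v u =
      ∫ u in a..b, M.claimLoss M.minSuper R' u := by
    refine intervalIntegral.integral_congr_ae (Eventually.of_forall fun u hu => ?_)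
    rw [uIoc_of_le hab.le] at hu
    simp only [claimLoss, hvR' u hu]
  have hS := M.isSuper_minSuper
  have hc := M.continuous_minSuper
  by_cases halive : ∀ s ∈ Ico 0 a, M.critical < R s
  · have hset : M.solventTimes R ∩ Ico a b = IsReservePath.aliveTimes M R' a b := by
      ext t
      constructor
      · rintro ⟨ht, ht'⟩
        exact ⟨ht', fun s hs => by
          rw [hRR' s (hs.2.trans ht'.2).ne]; exact ht.2 s ⟨ha0.trans hs.1, hs.2⟩⟩
      · rintro ⟨ht', ht⟩
        refine ⟨⟨ha0.trans ht'.1, fun s hs => ?_⟩, ht'⟩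
        rcases lt_or_ge s a with hsa | hsa
        · exact halive s ⟨hs.1, hsa⟩
        · rw [← hRR' s (hs.2.trans ht'.2).ne]; exact ht s ⟨hsa, hs.2⟩
    have hRa : R a = R' a := (hRR' a hab.ne).symm
    have hRb : v b = R' b := by simp [hR']
    rw [hset, hint, hRa, hRb]
    constructor
    · intro had
      refine hp.paid_alive_le hS hc fun t ht hal => ?_
      rw [hRR' t ht.2.ne]
      refine had t (ha0.trans ht.1) fun s hs => ?_
      rcases lt_or_ge s a with hsa | hsa
      · exact halive s ⟨hs.1, hsa⟩
      · rw [← hRR' s (hs.2.trans ht.2).ne]; exact hal s ⟨hsa, hs.2⟩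
    · intro hband
      exact hp.le_paid_alive fun t ht => (hband t (ha0.trans ht.1)).update ht.2.ne
  -- Ruin has occurred before this interval. No time counts, and both values and the claim loss
  -- vanish, so either inequality reads `0 ≤ 0`.
  · push Not at halive
    obtain ⟨s, hs, hRs⟩ := halive
    have hdead : ∀ t, s ≤ t → R t ≤ M.critical := fun t ht => h.le_critical_of_le hs.1 hRs ht
    have hset : M.solventTimes R ∩ Ico a b = ∅ := by
      refine eq_empty_of_forall_notMem fun t ht => ?_
      exact absurd (ht.1.2 s ⟨hs.1, hs.2.trans_le ht.2.1⟩) (not_lt.2 hRs)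
    have hvb : v b ≤ M.critical := by
      have hl := hp.tendsto_left (s := b) ⟨hab, le_rfl⟩
      rw [show R' b = v b by simp [hR']] at hl
      refine le_of_tendsto hl ?_
      filter_upwards [Ioo_mem_nhdsLT hab] with t ht
      rw [hRR' t ht.2.ne]
      exact hdead t (hs.2.le.trans ht.1.le)
    have hz : ∫ u in a..b, M.claimLoss M.minSuper R' u = 0 := by
      refine intervalIntegral.integral_zero_ae (Eventually.of_forall fun u hu => ?_)
      rw [uIoc_of_le hab.le] at hu
      refine claimLoss_eq_zero hS ?_
      rcases hu.2.eq_or_lt with rfl | h2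
      · simpa [hR'] using hvb
      · rw [hRR' u h2.ne]
        exact hdead u (hs.2.le.trans hu.1.le)
    rw [hset, hint, hz, hS.zero _ hvb, hS.zero _ (hdead a hs.2.le)]
    simp [paid]

theorem lintegral_discounted (h : M.IsClaimPath ω x R L v) (n : ℕ) {g : ℝ → ℝ} (hg : Continuous g)
    (hg0 : ∀ y, 0 ≤ g y) :
    IntervalIntegrable (fun t => Real.exp (-M.δ * t) * g (v t)) volume (M.epoch n ω)
      (M.epoch (n + 1) ω) ∧
    ∫⁻ t in Ioc (M.epoch n ω) (M.epoch (n + 1) ω), ENNReal.ofReal (Real.exp (-M.δ * t) * g (v t)) =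
      ENNReal.ofReal (∫ t in (M.epoch n ω)..(M.epoch (n + 1) ω), Real.exp (-M.δ * t) * g (v t)) := by
  have hab : M.epoch n ω < M.epoch (n + 1) ω := h.regular.strictMono_epoch (Nat.lt_succ_self n)
  have hi : IntervalIntegrable (fun t => Real.exp (-M.δ * t) * g (v t)) volume (M.epoch n ω)
      (M.epoch (n + 1) ω) := by
    have h1 := ((h.isReservePath n).intervalIntegrable_comp hg).continuousOn_mul
      (by fun_prop : Continuous fun s => Real.exp (-M.δ * s)).continuousOn
    refine h1.congr fun t ht => ?_
    rw [uIoc_of_le hab.le] at ht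
    rcases ht.2.eq_or_lt with h2 | h2
    · rw [h2, Function.update_self]
    · rw [Function.update_of_ne h2.ne, h.reserve_eq_before ⟨ht.1, h2⟩]
  refine ⟨hi, ?_⟩
  rw [intervalIntegral.integral_of_le hab.le]
  exact (ofReal_integral_eq_lintegral_ofReal hi.1 (Eventually.of_forall fun t =>
    mul_nonneg (Real.exp_pos _).le (hg0 _))).symm

/-- The balance of `paid_le_and_le` with claims on both sides of the account. -/
theorem lintegral_paid_le_and_eq (h : M.IsClaimPath ω x R L v) (n : ℕ)
    (had : ∀ t, 0 ≤ t → (∀ s ∈ Ico 0 t, M.critical < R s) →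
      Function.rightLim L t - L t ≤ max (R t - M.critical) 0) :
    (∫⁻ t in M.solventTimes R ∩ Ico (M.epoch n ω) (M.epoch (n + 1) ω),
        ENNReal.ofReal (Real.exp (-M.δ * t)) ∂h.mono.stieltjesFunction.measure +
      (ENNReal.ofReal (Real.exp (-M.δ * M.epoch (n + 1) ω) * M.minSuper (v (M.epoch (n + 1) ω))) +
        ENNReal.ofReal M.lam * ∫⁻ t in Ioc (M.epoch n ω) (M.epoch (n + 1) ω),
          ENNReal.ofReal (Real.exp (-M.δ * t) * M.afterClaim M.minSuper (v t))) ≤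
      ENNReal.ofReal (Real.exp (-M.δ * M.epoch n ω) * M.minSuper (R (M.epoch n ω))) +
        ENNReal.ofReal M.lam * ∫⁻ t in Ioc (M.epoch n ω) (M.epoch (n + 1) ω),
          ENNReal.ofReal (Real.exp (-M.δ * t) * M.minSuper (v t))) ∧
    ((∀ t, 0 ≤ t → M.BandRule (M.bandA M.minSuper) (M.bandB M.minSuper) R L t) →
      ∫⁻ t in M.solventTimes R ∩ Ico (M.epoch n ω) (M.epoch (n + 1) ω),
        ENNReal.ofReal (Real.exp (-M.δ * t)) ∂h.mono.stieltjesFunction.measure +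
      (ENNReal.ofReal (Real.exp (-M.δ * M.epoch (n + 1) ω) * M.minSuper (v (M.epoch (n + 1) ω))) +
        ENNReal.ofReal M.lam * ∫⁻ t in Ioc (M.epoch n ω) (M.epoch (n + 1) ω),
          ENNReal.ofReal (Real.exp (-M.δ * t) * M.afterClaim M.minSuper (v t))) =
      ENNReal.ofReal (Real.exp (-M.δ * M.epoch n ω) * M.minSuper (R (M.epoch n ω))) +
        ENNReal.ofReal M.lam * ∫⁻ t in Ioc (M.epoch n ω) (M.epoch (n + 1) ω),
          ENNReal.ofReal (Real.exp (-M.δ * t) * M.minSuper (v t))) := by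
  have hS := M.isSuper_minSuper
  have hc := M.continuous_minSuper
  have hab : M.epoch n ω < M.epoch (n + 1) ω := h.regular.strictMono_epoch (Nat.lt_succ_self n)
  have hI0 := afterClaim_nonneg (M := M) hS.nonneg
  obtain ⟨hi1, e1⟩ := h.lintegral_discounted n hc hS.nonneg
  obtain ⟨hi2, e2⟩ := h.lintegral_discounted n
    (continuous_afterClaim (M := M) hS.monotone hS.nonneg hc) hI0
  have hloss : ∫ u in (M.epoch n ω)..(M.epoch (n + 1) ω), M.claimLoss M.minSuper v u =
      M.lam * (∫ t in (M.epoch n ω)..(M.epoch (n + 1) ω), Real.exp (-M.δ * t) * M.minSuper (v t)) -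
      M.lam * ∫ t in (M.epoch n ω)..(M.epoch (n + 1) ω),
        Real.exp (-M.δ * t) * M.afterClaim M.minSuper (v t) := by
    rw [← mul_sub, ← intervalIntegral.integral_sub hi1 hi2, ← intervalIntegral.integral_const_mul]
    refine intervalIntegral.integral_congr fun t _ => ?_
    simp only [claimLoss]
    ring
  have hl := M.lam_pos.le
  have hn1 : 0 ≤ ∫ t in (M.epoch n ω)..(M.epoch (n + 1) ω), Real.exp (-M.δ * t) * M.minSuper (v t) :=
    intervalIntegral.integral_nonneg hab.le fun t _ => mul_nonneg (Real.exp_pos _).le (hS.nonneg _)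
  have hn2 : 0 ≤ ∫ t in (M.epoch n ω)..(M.epoch (n + 1) ω),
      Real.exp (-M.δ * t) * M.afterClaim M.minSuper (v t) :=
    intervalIntegral.integral_nonneg hab.le fun t _ => mul_nonneg (Real.exp_pos _).le (hI0 _)
  have hp0 := IsReservePath.paid_nonneg (M := M) h.mono
    (M.solventTimes R ∩ Ico (M.epoch n ω) (M.epoch (n + 1) ω))
  have hx0 := mul_nonneg (Real.exp_pos (-M.δ * M.epoch n ω)).le (hS.nonneg (R (M.epoch n ω)))
  have hx1 := mul_nonneg (Real.exp_pos (-M.δ * M.epoch (n + 1) ω)).le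
    (hS.nonneg (v (M.epoch (n + 1) ω)))
  rw [e1, e2, lintegral_exp_stieltjes h.mono (solventTimes_inter_subset n),
    ← ENNReal.ofReal_mul hl, ← ENNReal.ofReal_mul hl, ← ENNReal.ofReal_add hx1 (mul_nonneg hl hn2),
    ← ENNReal.ofReal_add hp0 (add_nonneg hx1 (mul_nonneg hl hn2)),
    ← ENNReal.ofReal_add hx0 (mul_nonneg hl hn1)]
  have h1 := (h.paid_le_and_le n).1 had
  rw [hloss] at h1
  refine ⟨ENNReal.ofReal_le_ofReal (by linarith), fun hband => ?_⟩
  have h2 := (h.paid_le_and_le n).2 hband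
  rw [hloss] at h2
  congr 1
  linarith

theorem lintegral_solventTimes (h : M.IsClaimPath ω x R L v) :
    ∫⁻ t in M.solventTimes R, ENNReal.ofReal (Real.exp (-M.δ * t))
        ∂h.mono.stieltjesFunction.measure =
      ∑' n, ∫⁻ t in M.solventTimes R ∩ Ico (M.epoch n ω) (M.epoch (n + 1) ω),
        ENNReal.ofReal (Real.exp (-M.δ * t)) ∂h.mono.stieltjesFunction.measure := by
  have e : M.solventTimes R =
      ⋃ n, M.solventTimes R ∩ Ico (M.epoch n ω) (M.epoch (n + 1) ω) := by
    ext t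
    rw [mem_iUnion]
    refine ⟨fun ht => ?_, fun ⟨n, hn⟩ => hn.1⟩
    obtain ⟨n, hn⟩ := h.regular.exists_mem ht.1
    exact ⟨n, ht, hn⟩
  conv_lhs => rw [e]
  refine lintegral_iUnion (fun n => measurableSet_solventTimes.inter measurableSet_Ico) ?_ _
  have := h.regular.strictMono_epoch.monotone.pairwise_disjoint_on_Ico_succ
  exact this.mono fun i j hij => hij.mono inter_subset_right inter_subset_right

end IsClaimPath

end

end RiskModel

/-! ### The return of a strategy. -/

namespace RiskModel

section

variable {Ω : Type*} [MeasurableSpace Ω] {μ : Measure Ω} [IsProbabilityMeasure μ] [μ.IsComplete]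
  {M : RiskModel μ} {x : ℝ}

namespace Strategy

theorem setOf_le_ruinTime (S : M.Strategy x) (ω : Ω) :
    {t : ℝ | 0 ≤ t ∧ ENNReal.ofReal t ≤ S.ruinTime ω} = M.solventTimes fun t => S.R t ω := by
  ext t
  refine and_congr_right fun ht => ?_
  rw [ruinTime, le_iInf₂_iff]
  constructor
  · intro h s hs
    by_contra! hcon
    have := (ENNReal.ofReal_le_ofReal_iff hs.1).1 (h s ⟨hs.1, hcon⟩)
    exact absurd hs.2 (not_lt.2 this)
  · rintro h s ⟨hs, hR⟩
    refine ENNReal.ofReal_le_ofReal ?_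
    by_contra! hcon
    exact absurd (h s ⟨hs, hcon⟩) (not_lt.2 hR)

theorem exists_isClaimPath (S : M.Strategy x) : ∃ v : ℝ≥0 × Ω → ℝ,
    Measurable[M.filtration.predictable] v ∧ ∀ᵐ ω ∂μ,
      M.IsClaimPath ω x (fun t => S.R t ω) (fun t => S.L t ω) fun t => v (t.toNNReal, ω) := by
  obtain ⟨v, hv, h⟩ := S.exists_predictable_reserve
  refine ⟨v, hv, ?_⟩
  filter_upwards [M.ae_isRegular, S.dynamics, h] with ω h1 h2 h3
  refine ⟨h1, S.mono ω, S.leftCont ω, S.eq_zero ω 0 le_rfl, fun t ht => (h2 t ht).1,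
    fun t ht => (h2 t ht).2, fun t ht => ?_⟩
  rw [h3, Real.coe_toNNReal t ht]

/-- The account of discounted values of a strategy. -/
theorem exists_account (S : M.Strategy x) : ∃ A C D E : ℕ → Ω → ℝ≥0∞,
    (∀ n, AEMeasurable (A n) μ) ∧ (∀ n, AEMeasurable (C n) μ) ∧ (∀ n, AEMeasurable (D n) μ) ∧
    (∀ n, AEMeasurable (E n) μ) ∧ (∀ n, ∫⁻ ω, E n ω ∂μ = ∫⁻ ω, C n ω ∂μ) ∧
    (∀ n, ∫⁻ ω, A (n + 1) ω ∂μ = ∫⁻ ω, D n ω ∂μ) ∧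
    (∀ n, ∫⁻ ω, E n ω ∂μ ≠ ∞) ∧ (∀ n, ∫⁻ ω, A n ω ∂μ ≠ ∞) ∧
    Tendsto (fun n => ∫⁻ ω, A n ω ∂μ) atTop (𝓝 0) ∧
    (∀ ω, A 0 ω = ENNReal.ofReal (M.minSuper x)) ∧
    ∀ᵐ ω ∂μ, ∃ v, ∃ _ : M.IsClaimPath ω x (fun t => S.R t ω) (fun t => S.L t ω) v, ∀ n,
      A n ω = ENNReal.ofReal (Real.exp (-M.δ * M.epoch n ω) * M.minSuper (S.R (M.epoch n ω) ω)) ∧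
      E n ω = ENNReal.ofReal
        (Real.exp (-M.δ * M.epoch (n + 1) ω) * M.minSuper (v (M.epoch (n + 1) ω))) ∧
      C n ω = ENNReal.ofReal M.lam * ∫⁻ t in Ioc (M.epoch n ω) (M.epoch (n + 1) ω),
        ENNReal.ofReal (Real.exp (-M.δ * t) * M.minSuper (v t)) ∧
      D n ω = ENNReal.ofReal M.lam * ∫⁻ t in Ioc (M.epoch n ω) (M.epoch (n + 1) ω),
        ENNReal.ofReal (Real.exp (-M.δ * t) * M.afterClaim M.minSuper (v t)) := by
  obtain ⟨v, hv, hpath⟩ := S.exists_isClaimPath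
  have hS := M.isSuper_minSuper
  have hc := M.continuous_minSuper
  have hIc := continuous_afterClaim (M := M) hS.monotone hS.nonneg hc
  have hvm : Measurable v := hv.mono M.predictable_le le_rfl
  have hσ : ∀ n, Measurable fun ω => ((M.epoch n ω).toNNReal, ω) := fun n =>
    (M.measurable_epoch n).real_toNNReal.prodMk measurable_id
  have hvσ : ∀ n, Measurable fun ω => v ((M.epoch n ω).toNNReal, ω) := fun n => hvm.comp (hσ n)
  have hT : Measurable fun q : Ω × ℝ => v (q.2.toNNReal, q.1) :=
    hvm.comp ((measurable_real_toNNReal.comp measurable_snd).prodMk measurable_fst)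
  -- The value after a claim is expressed by the predictable reserve before the claim and the claim
  -- size. This makes it measurable and puts it into the form of the compensation formula.
  let A : ℕ → Ω → ℝ≥0∞ := fun n ω => Nat.casesOn n (ENNReal.ofReal (M.minSuper x)) fun n =>
    ENNReal.ofReal (Real.exp (-M.δ * ((M.epoch (n + 1) ω).toNNReal : ℝ)) *
      M.minSuper (v ((M.epoch (n + 1) ω).toNNReal, ω) - M.U n ω))
  let E : ℕ → Ω → ℝ≥0∞ := fun n ω => ENNReal.ofReal
    (Real.exp (-M.δ * ((M.epoch (n + 1) ω).toNNReal : ℝ)) *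
      M.minSuper (v ((M.epoch (n + 1) ω).toNNReal, ω)))
  let C : ℕ → Ω → ℝ≥0∞ := fun n ω => ENNReal.ofReal M.lam *
    ∫⁻ t in Ioc (M.epoch n ω) (M.epoch (n + 1) ω),
      ENNReal.ofReal (Real.exp (-M.δ * (t.toNNReal : ℝ)) * M.minSuper (v (t.toNNReal, ω)))
  let D : ℕ → Ω → ℝ≥0∞ := fun n ω => ENNReal.ofReal M.lam *
    ∫⁻ t in Ioc (M.epoch n ω) (M.epoch (n + 1) ω), ENNReal.ofReal
      (Real.exp (-M.δ * (t.toNNReal : ℝ)) * M.afterClaim M.minSuper (v (t.toNNReal, ω)))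
  have hmeas : ∀ (g : ℝ → ℝ) (n : ℕ), Continuous g → Measurable fun ω => ENNReal.ofReal M.lam *
      ∫⁻ t in Ioc (M.epoch n ω) (M.epoch (n + 1) ω),
        ENNReal.ofReal (Real.exp (-M.δ * (t.toNNReal : ℝ)) * g (v (t.toNNReal, ω))) := by
    intro g n hg
    simp_rw [M.setLIntegral_Ioc_epoch n
      fun ω t => ENNReal.ofReal (Real.exp (-M.δ * (t.toNNReal : ℝ)) * g (v (t.toNNReal, ω)))]
    refine Measurable.const_mul (Measurable.lintegral_prod_right'
      (Measurable.indicator ?_ (M.measurableSet_setOf_mem_Ioc_epoch n))) _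
    have : Measurable fun q : Ω × ℝ => g (v (q.2.toNNReal, q.1)) := hg.measurable.comp hT
    fun_prop
  have hA : ∀ n, Measurable (A n) := fun n => by
    cases n with
    | zero => exact measurable_const
    | succ n =>
      have h1 := M.measurable_epoch (n + 1)
      have h2 := hc.measurable.comp ((hvσ (n + 1)).sub (M.measurable_U n))
      have h3 : Measurable fun ω => Real.exp (-M.δ * ((M.epoch (n + 1) ω).toNNReal : ℝ)) := by
        fun_prop
      exact (h3.mul h2).ennreal_ofReal
  have hE : ∀ n, Measurable (E n) := fun n => by
    have h1 := M.measurable_epoch (n + 1)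
    have h2 := hc.measurable.comp (hvσ (n + 1))
    have h3 : Measurable fun ω => Real.exp (-M.δ * ((M.epoch (n + 1) ω).toNNReal : ℝ)) := by
      fun_prop
    exact (h3.mul h2).ennreal_ofReal
  have hid : ∀ᵐ ω ∂μ, ∃ v, ∃ _ : M.IsClaimPath ω x (fun t => S.R t ω) (fun t => S.L t ω) v, ∀ n,
      A n ω = ENNReal.ofReal (Real.exp (-M.δ * M.epoch n ω) * M.minSuper (S.R (M.epoch n ω) ω)) ∧
      E n ω = ENNReal.ofReal
        (Real.exp (-M.δ * M.epoch (n + 1) ω) * M.minSuper (v (M.epoch (n + 1) ω))) ∧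
      C n ω = ENNReal.ofReal M.lam * ∫⁻ t in Ioc (M.epoch n ω) (M.epoch (n + 1) ω),
        ENNReal.ofReal (Real.exp (-M.δ * t) * M.minSuper (v t)) ∧
      D n ω = ENNReal.ofReal M.lam * ∫⁻ t in Ioc (M.epoch n ω) (M.epoch (n + 1) ω),
        ENNReal.ofReal (Real.exp (-M.δ * t) * M.afterClaim M.minSuper (v t)) := by
    filter_upwards [hpath] with ω hω
    refine ⟨_, hω, fun n => ⟨?_, ?_, ?_, ?_⟩⟩
    · cases n with
      | zero =>
        have := hω.apply_zero
        simp only [M.epoch_zero, this, mul_zero, Real.exp_zero, one_mul]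
        rfl
      | succ n =>
        have := hω.reserve_epoch_succ n
        simp only [A, this, Real.coe_toNNReal _ (hω.regular.epoch_nonneg (n + 1))]
    · simp only [E, Real.coe_toNNReal _ (hω.regular.epoch_nonneg (n + 1))]
    · simp only [C]
      congr 1
      refine setLIntegral_congr_fun measurableSet_Ioc fun t ht => ?_
      simp only [Real.coe_toNNReal t ((hω.regular.epoch_nonneg n).trans ht.1.le)]
    · simp only [D]
      congr 1
      refine setLIntegral_congr_fun measurableSet_Ioc fun t ht => ?_
      simp only [Real.coe_toNNReal t ((hω.regular.epoch_nonneg n).trans ht.1.le)]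
  obtain ⟨K₀, hK₀, hW⟩ := M.exists_minSuper_le
  set K := K₀ * (|x| + M.p / M.r - M.critical + 1) with hK
  have hrδ : 0 < M.δ - M.r := sub_pos.2 M.r_lt_δ
  have hKpos : 0 ≤ K := by
    have := M.critical_neg
    have := M.p_pos
    have := M.r_pos
    have : 0 ≤ M.p / M.r := by positivity
    have := abs_nonneg x
    exact mul_nonneg hK₀.le (by linarith)
  have hAb : ∀ᵐ ω ∂μ, ∀ n, A n ω ≤
      ENNReal.ofReal (K * Real.exp (-(M.δ - M.r) * M.epoch n ω)) := by
    filter_upwards [hid] with ω ⟨v, hω, h⟩ n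
    rw [(h n).1]
    refine ENNReal.ofReal_le_ofReal (hω.discounted_le hK₀.le hW (hω.regular.epoch_nonneg n) ?_)
    rw [hω.dyn _ (hω.regular.epoch_nonneg n)]
    linarith [hω.nonneg (hω.regular.epoch_nonneg n),
      hω.regular.aggregateClaims_nonneg (M.epoch n ω)]
  have hEb : ∀ᵐ ω ∂μ, ∀ n, E n ω ≤
      ENNReal.ofReal (K * Real.exp (-(M.δ - M.r) * M.epoch (n + 1) ω)) := by
    filter_upwards [hid] with ω ⟨v, hω, h⟩ n
    rw [(h n).2.1]
    refine ENNReal.ofReal_le_ofReal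
      (hω.discounted_le hK₀.le hW (hω.regular.epoch_nonneg (n + 1)) ?_)
    rw [hω.before _ (hω.regular.epoch_nonneg (n + 1))]
    linarith [hω.nonneg (hω.regular.epoch_nonneg (n + 1)),
      hω.regular.priorClaims_nonneg (M.epoch (n + 1) ω)]
  have hexp : ∀ᵐ ω ∂μ, ∀ n, ENNReal.ofReal (K * Real.exp (-(M.δ - M.r) * M.epoch n ω)) ≤
      ENNReal.ofReal K := by
    filter_upwards [M.ae_isRegular] with ω hω n
    refine ENNReal.ofReal_le_ofReal (mul_le_of_le_one_right hKpos ?_)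
    rw [Real.exp_le_one_iff]
    nlinarith [hω.epoch_nonneg n]
  have hfin : ∀ f : Ω → ℝ≥0∞, (∀ᵐ ω ∂μ, f ω ≤ ENNReal.ofReal K) → ∫⁻ ω, f ω ∂μ ≠ ∞ := by
    intro f hf
    refine ((lintegral_mono_ae hf).trans_lt ?_).ne
    simp
  refine ⟨A, C, D, E, fun n => (hA n).aemeasurable, fun n => (hmeas _ n hc).aemeasurable,
    fun n => (hmeas _ n hIc).aemeasurable, fun n => (hE n).aemeasurable, fun n => ?_, fun n => ?_,
    fun n => hfin _ ?_, fun n => hfin _ ?_, ?_, fun ω => rfl, hid⟩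
  -- An integrand that does not depend on the claim size gives the compensator of the value just
  -- before the claim. In the next case the claim is deducted, and integration over its law produces
  -- `afterClaim`.
  · have := M.lintegral_next_epoch n hv (φ := fun q => ENNReal.ofReal
      (Real.exp (-M.δ * (q.1.1 : ℝ)) * M.minSuper q.1.2)) (by
        have := hc.measurable
        fun_prop)
    simp only [lintegral_const, measure_univ, mul_one] at this
    simp only [E, C]
    rw [this, lintegral_const_mul' _ _ ENNReal.ofReal_ne_top]
  · have := M.lintegral_next_epoch n hv (φ := fun q => ENNReal.ofReal
      (Real.exp (-M.δ * (q.1.1 : ℝ)) * M.minSuper (q.1.2 - q.2))) (by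
        have := hc.measurable
        fun_prop)
    simp only [A, D]
    rw [this, lintegral_const_mul' _ _ ENNReal.ofReal_ne_top]
    congr 1
    refine lintegral_congr fun ω => lintegral_congr fun t => ?_
    rw [afterClaim, ← integral_const_mul, ofReal_integral_eq_lintegral_ofReal
      ((integrable_afterClaim hS.monotone hS.nonneg _).const_mul _)
      (Eventually.of_forall fun u => mul_nonneg (Real.exp_pos _).le (hS.nonneg _))]
  · filter_upwards [hEb, hexp] with ω h1 h2
    exact (h1 n).trans (h2 (n + 1))
  · filter_upwards [hAb, hexp] with ω h1 h2
    exact (h1 n).trans (h2 n)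
  · have hlim : Tendsto (fun n => ∫⁻ ω, A n ω ∂μ) atTop (𝓝 (∫⁻ _, 0 ∂μ)) := by
      refine tendsto_lintegral_of_dominated_convergence (fun _ => ENNReal.ofReal K) hA
        (fun n => ?_) (by simp) ?_
      · filter_upwards [hAb, hexp] with ω h1 h2
        exact (h1 n).trans (h2 n)
      · filter_upwards [hAb, M.ae_isRegular] with ω h1 h2
        refine tendsto_of_tendsto_of_tendsto_of_le_of_le tendsto_const_nhds ?_
          (fun _ => zero_le) h1
        rw [← ENNReal.ofReal_zero]
        refine ENNReal.tendsto_ofReal ?_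
        rw [← mul_zero K]
        refine Tendsto.const_mul K (Real.tendsto_exp_atBot.comp ?_)
        exact h2.tendsto.const_mul_atTop_of_neg (by linarith)
    simpa using hlim

/-- No strategy has a return higher than the minimal supersolution. -/
theorem payoff_le (S : M.Strategy x) : S.payoff ≤ ENNReal.ofReal (M.minSuper x) := by
  obtain ⟨A, C, D, E, hA, hC, hD, hE, hEC, hAD, hEfin, hAfin, -, hA0, hid⟩ := S.exists_account
  have key := lintegral_tsum_le_of_telescope (P := fun n ω =>
    ∫⁻ t in M.solventTimes (fun t => S.R t ω) ∩ Ico (M.epoch n ω) (M.epoch (n + 1) ω),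
      ENNReal.ofReal (Real.exp (-M.δ * t)) ∂(S.mono ω).stieltjesFunction.measure)
    hA hC hD hE hEC hAD hEfin hAfin ?_
  · simp only [hA0, lintegral_const, measure_univ, mul_one] at key
    refine le_trans (lintegral_mono_ae ?_) key
    filter_upwards [hid] with ω ⟨v, hω, _⟩
    rw [setOf_le_ruinTime]
    exact hω.lintegral_solventTimes.le
  · filter_upwards [hid, S.no_ruin] with ω ⟨v, hω, h⟩ had n
    obtain ⟨h1, h2, h3, h4⟩ := h n
    rw [h1, h2, h3, h4]
    exact (hω.lintegral_paid_le_and_eq n had).1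

/-- Under the band rule each pathwise account balances exactly, and the expected discounted value
after the `n`th claim tends to zero, so the telescoping sum has no remainder. -/
theorem payoff_eq_of_bandRule (S : M.Strategy x) (hband : ∀ᵐ ω ∂μ, ∀ t, 0 ≤ t →
    M.BandRule (M.bandA M.minSuper) (M.bandB M.minSuper) (fun t => S.R t ω) (fun t => S.L t ω) t) :
    S.payoff = ENNReal.ofReal (M.minSuper x) := by
  obtain ⟨A, C, D, E, hA, hC, hD, hE, hEC, hAD, hEfin, hAfin, hlim, hA0, hid⟩ := S.exists_account
  have key := lintegral_tsum_eq_of_telescope (P := fun n ω =>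
    ∫⁻ t in M.solventTimes (fun t => S.R t ω) ∩ Ico (M.epoch n ω) (M.epoch (n + 1) ω),
      ENNReal.ofReal (Real.exp (-M.δ * t)) ∂(S.mono ω).stieltjesFunction.measure)
    hA hC hD hE hEC hAD hEfin hAfin ?_ hlim
  · simp only [hA0, lintegral_const, measure_univ, mul_one] at key
    rw [← key]
    refine lintegral_congr_ae ?_
    filter_upwards [hid] with ω ⟨v, hω, _⟩
    rw [setOf_le_ruinTime]
    exact hω.lintegral_solventTimes
  · filter_upwards [hid, S.no_ruin, hband] with ω ⟨v, hω, h⟩ had hb n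
    obtain ⟨h1, h2, h3, h4⟩ := h n
    rw [h1, h2, h3, h4]
    exact (hω.lintegral_paid_le_and_eq n had).2 hb

end Strategy

end

end RiskModel

/-! ### The flow without dividends, in closed form. -/

namespace RiskModel

section

variable {Ω : Type*} [MeasurableSpace Ω] {μ : Measure Ω} (M : RiskModel μ)

/-- A coordinate of the reserve levels that grows at the constant relative rate `α` along the
flow without dividends and claims. -/
noncomputable def flowCoord (y : ℝ) : ℝ :=
  -- Along the flow the drift grows at relative rate `α` below `0` and `r` above `0`; the power `α /
  -- r` turns the second rate into the first.
  if y < 0 then M.drift y / M.p else (M.drift y / M.p) ^ (M.α / M.r)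

/-- The reserve level with a given coordinate `flowCoord`. -/
noncomputable def flowLevel (m : ℝ) : ℝ :=
  if m ≤ 1 then M.p / M.α * (m - 1) else M.p / M.r * (m ^ (M.r / M.α) - 1)

/-- The reserve at time `t` that results from the reserve `y` at time `0` without dividends and
claims. -/
noncomputable def flow (t y : ℝ) : ℝ := M.flowLevel (M.flowCoord y * Real.exp (M.α * t))

theorem flowLevel_of_one_le {m : ℝ} (h : 1 ≤ m) :
    M.flowLevel m = M.p / M.r * (m ^ (M.r / M.α) - 1) := by
  rcases h.eq_or_lt with rfl | h
  · simp [flowLevel]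
  · rw [flowLevel, if_neg (not_le.2 h)]

theorem flowLevel_nonneg {m : ℝ} (h : 1 ≤ m) : 0 ≤ M.flowLevel m := by
  have := M.p_pos
  have := M.r_pos
  have := M.α_pos
  rw [M.flowLevel_of_one_le h]
  have : 1 ≤ m ^ (M.r / M.α) := Real.one_le_rpow h (by positivity)
  exact mul_nonneg (by positivity) (by linarith)

theorem flowLevel_flowCoord (y : ℝ) : M.flowLevel (M.flowCoord y) = y := by
  have hp := M.p_pos
  have hr := M.r_pos
  have hα := M.α_pos
  rcases lt_or_ge y 0 with h | h
  · have h1 : M.flowCoord y = 1 + M.α * y / M.p := by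
      rw [flowCoord, if_pos h, drift, if_neg (not_le.2 h)]
      field_simp
    have h2 : M.α * y / M.p ≤ 0 := div_nonpos_of_nonpos_of_nonneg (by nlinarith) hp.le
    rw [h1, flowLevel, if_pos (by linarith)]
    field_simp
    ring
  · have h0 : M.drift y / M.p = 1 + M.r * y / M.p := by
      rw [drift, if_pos h]
      field_simp
    have h2 : 0 ≤ M.r * y / M.p := by positivity
    rw [flowCoord, if_neg (not_lt.2 h), h0,
      M.flowLevel_of_one_le (Real.one_le_rpow (by linarith) (by positivity)),
      ← Real.rpow_mul (by linarith), show M.α / M.r * (M.r / M.α) = 1 by field_simp, Real.rpow_one]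
    field_simp
    ring

theorem continuous_flowLevel : Continuous M.flowLevel := by
  refine Continuous.if_le (by fun_prop) ?_ continuous_id continuous_const ?_
  · have := Real.continuous_rpow_const (div_pos M.r_pos M.α_pos).le
    fun_prop
  · rintro m rfl
    simp

theorem drift_flowLevel_of_lt {m : ℝ} (h : m < 1) : M.drift (M.flowLevel m) = M.p * m := by
  have hp := M.p_pos
  have hα := M.α_pos
  have h1 : M.p / M.α * (m - 1) < 0 := mul_neg_of_pos_of_neg (by positivity) (by linarith)
  rw [flowLevel, if_pos h.le, drift, if_neg (not_le.2 h1)]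
  field_simp
  ring

theorem drift_flowLevel_of_one_le {m : ℝ} (h : 1 ≤ m) :
    M.drift (M.flowLevel m) = M.p * m ^ (M.r / M.α) := by
  have hr := M.r_pos
  rw [drift, if_pos (M.flowLevel_nonneg h), M.flowLevel_of_one_le h]
  field_simp
  ring

/-- Right derivatives suffice for the fundamental theorem of calculus, and they avoid matching the
two branches of the flow at level `0`. -/
theorem hasDerivWithinAt_flow_right (t y : ℝ) :
    HasDerivWithinAt (fun t => M.flow t y) (M.drift (M.flow t y)) (Ici t) t := by
  have hp := M.p_pos
  have hr := M.r_pos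
  have hα := M.α_pos
  have hm : HasDerivAt (fun t => M.flowCoord y * Real.exp (M.α * t))
      (M.α * (M.flowCoord y * Real.exp (M.α * t))) t :=
    ((((hasDerivAt_id t).const_mul M.α).exp).const_mul (M.flowCoord y)).congr_deriv
      (by simp only [id]; ring)
  set m := M.flowCoord y * Real.exp (M.α * t) with hmdef
  rcases lt_or_ge m 1 with h | h
  · have h1 : HasDerivAt M.flowLevel (M.p / M.α) m := by
      have : HasDerivAt (fun m => M.p / M.α * (m - 1)) (M.p / M.α) m :=
        (((hasDerivAt_id m).sub_const 1).const_mul (M.p / M.α)).congr_deriv (mul_one _)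
      refine this.congr_of_eventuallyEq ?_
      filter_upwards [Iio_mem_nhds h] with s hs
      exact if_pos (le_of_lt hs)
    refine ((h1.comp t hm).congr_deriv ?_).hasDerivWithinAt
    rw [flow, ← hmdef, M.drift_flowLevel_of_lt h]
    field_simp
  · have h0 : 0 < m := by linarith
    have h1 : HasDerivWithinAt M.flowLevel (M.p / M.r * (M.r / M.α * m ^ (M.r / M.α - 1))) (Ici m) m := by
      have : HasDerivAt (fun m => M.p / M.r * (m ^ (M.r / M.α) - 1))
          (M.p / M.r * (M.r / M.α * m ^ (M.r / M.α - 1))) m :=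
        ((Real.hasDerivAt_rpow_const (Or.inl h0.ne')).sub_const 1).const_mul _
      exact this.hasDerivWithinAt.congr (fun s hs => M.flowLevel_of_one_le (h.trans hs))
        (M.flowLevel_of_one_le h)
    have hK : 0 < M.flowCoord y := by
      by_contra! hK
      exact absurd h0 (not_lt.2 (mul_nonpos_of_nonpos_of_nonneg hK (Real.exp_pos _).le))
    refine ((h1.comp t hm.hasDerivWithinAt fun s hs => ?_).congr_deriv ?_)
    · exact mul_le_mul_of_nonneg_left (Real.exp_le_exp.2
        (mul_le_mul_of_nonneg_left hs hα.le)) hK.le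
    · rw [flow, ← hmdef, M.drift_flowLevel_of_one_le h, Real.rpow_sub_one h0.ne']
      field_simp

theorem continuous_flow (y : ℝ) : Continuous fun t => M.flow t y :=
  M.continuous_flowLevel.comp (by fun_prop)

theorem measurable_flow : Measurable fun q : ℝ × ℝ => M.flow q.1 q.2 := by
  have hd := M.continuous_drift.measurable
  have : Measurable M.flowCoord :=
    Measurable.ite measurableSet_Iio (by fun_prop) ((hd.div_const _).pow_const _)
  exact M.continuous_flowLevel.measurable.comp (by fun_prop)

theorem flow_zero (y : ℝ) : M.flow 0 y = y := by
  simp [flow, M.flowLevel_flowCoord]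

theorem flow_lt_critical {y : ℝ} (hy : y < M.critical) (t : ℝ) : M.flow t y < M.critical := by
  have hp := M.p_pos
  have hα := M.α_pos
  have hc := M.critical_neg
  have h1 : M.flowCoord y < 0 := by
    rw [flowCoord, if_pos (by linarith), drift, if_neg (by linarith)]
    refine div_neg_of_neg_of_pos ?_ hp
    have := M.α_mul_critical
    nlinarith
  have h2 : M.flowCoord y * Real.exp (M.α * t) < 0 := mul_neg_of_neg_of_pos h1 (Real.exp_pos _)
  rw [flow, flowLevel, if_pos (by linarith), critical, mul_sub, mul_one]
  have := mul_neg_of_pos_of_neg (div_pos hp hα) h2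
  linarith

theorem critical_le_flow {y : ℝ} (hy : M.critical ≤ y) (t : ℝ) : M.critical ≤ M.flow t y := by
  have hp := M.p_pos
  have hα := M.α_pos
  have hc := M.critical_neg
  have h1 : 0 ≤ M.flowCoord y := by
    have := div_nonneg (M.drift_nonneg hy) hp.le
    rw [flowCoord]
    split_ifs
    · exact this
    · exact Real.rpow_nonneg this _
  have h2 : 0 ≤ M.flowCoord y * Real.exp (M.α * t) := mul_nonneg h1 (Real.exp_pos _).le
  rcases le_total (M.flowCoord y * Real.exp (M.α * t)) 1 with h | h
  · rw [flow, flowLevel, if_pos h, critical, mul_sub, mul_one]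
    have := mul_nonneg (div_pos hp hα).le h2
    linarith
  · exact hc.le.trans (M.flowLevel_nonneg h)

theorem integral_drift_flow {s t : ℝ} (hst : s ≤ t) (y : ℝ) :
    ∫ u in s..t, M.drift (M.flow u y) = M.flow t y - M.flow s y :=
  intervalIntegral.integral_eq_sub_of_hasDeriv_right_of_le hst
    (M.continuous_flow y).continuousOn
    (fun u _ => (M.hasDerivWithinAt_flow_right u y).mono Ioi_subset_Ici_self)
    ((M.continuous_drift.comp (M.continuous_flow y)).intervalIntegrable _ _)

theorem monotone_flow {y : ℝ} (hy : M.critical ≤ y) : Monotone fun t => M.flow t y := by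
  intro s t hst
  have := M.integral_drift_flow hst y
  have h0 : 0 ≤ ∫ u in s..t, M.drift (M.flow u y) :=
    intervalIntegral.integral_nonneg hst fun u _ => M.drift_nonneg (M.critical_le_flow hy u)
  simp only
  linarith

end

end RiskModel

/-! ### The band strategy between two claims. -/

namespace RiskModel

section

variable {Ω : Type*} [MeasurableSpace Ω] {μ : Measure Ω} (M : RiskModel μ) (A B : Set ℝ)

/-- The lowest point of `A` at or above `y`. -/
noncomputable def barrier (A : Set ℝ) (y : ℝ) : EReal := ⨅ a ∈ A ∩ Ici y, (a : EReal)

/-- The highest point of `A` at or below `y`. -/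
noncomputable def lumpTarget (y : ℝ) : ℝ := sSup (A ∩ Iic (max y M.critical))

open Classical in
/-- The reserve at time `t` that results from the reserve `y` at time `0` under the band strategy
when no claims occur. -/
noncomputable def bandFlow (t y : ℝ) : ℝ :=
  if y ∈ B then (if t ≤ 0 then y else M.lumpTarget A y)
  else (min (M.flow t y : EReal) (barrier A y)).toReal

open Classical in
/-- The rate at which dividends are paid under the band strategy. -/
noncomputable def bandRate (t y : ℝ) : ℝ :=
  if barrier A y ≤ M.flow t y then M.drift (barrier A y).toReal else 0

open Classical in
/-- The dividends that are paid up to time `t` under the band strategy when no claims occur and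
the reserve at time `0` is `y`. -/
noncomputable def bandDividends (t y : ℝ) : ℝ :=
  if y ∈ B then (if t ≤ 0 then 0 else (y - M.lumpTarget A y) + M.drift (M.lumpTarget A y) * t)
  else ∫ u in (0 : ℝ)..max t 0, M.bandRate A u y

theorem measurable_barrier : Measurable (barrier A) :=
  Monotone.measurable fun _ _ hxy => biInf_mono fun _ ha => ⟨ha.1, hxy.trans ha.2⟩

variable {M A B}

/-- The truncation at the critical level keeps the set nonempty for every `y`, so the supremum is
monotone in `y`. -/
theorem measurable_lumpTarget (h : M.critical ∈ A) : Measurable (M.lumpTarget A) := by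
  refine Monotone.measurable fun x y hxy => csSup_le_csSup ⟨max y M.critical, fun a ha => ha.2⟩
    ⟨M.critical, h, mem_Iic.2 (le_max_right x M.critical)⟩ fun a ha => ⟨ha.1, ha.2.trans (max_le_max_right _ hxy)⟩

variable (M A) in
theorem measurable_bandRate : Measurable fun q : ℝ × ℝ => M.bandRate A q.1 q.2 := by
  have h1 := measurable_barrier A
  have h2 := M.measurable_flow
  have h3 := M.continuous_drift.measurable
  refine Measurable.ite (measurableSet_le (h1.comp measurable_snd) h2.coe_real_ereal) ?_
    measurable_const
  exact h3.comp (h1.ereal_toReal.comp measurable_snd)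

theorem measurable_bandFlow (h : M.critical ∈ A) (hB : MeasurableSet B) :
    Measurable fun q : ℝ × ℝ => M.bandFlow A B q.1 q.2 := by
  have h1 := measurable_barrier A
  have h2 := M.measurable_flow
  refine Measurable.ite (measurable_snd hB) (Measurable.ite
    (measurableSet_le measurable_fst measurable_const) measurable_snd
    ((measurable_lumpTarget h).comp measurable_snd)) ?_
  exact (h2.coe_real_ereal.min (h1.comp measurable_snd)).ereal_toReal

theorem measurable_bandDividends (h : M.critical ∈ A) (hB : MeasurableSet B) :
    Measurable fun q : ℝ × ℝ => M.bandDividends A B q.1 q.2 := by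
  have h1 := M.continuous_drift.measurable
  have h2 : Measurable fun q : ℝ × ℝ => M.lumpTarget A q.2 :=
    (measurable_lumpTarget h).comp measurable_snd
  refine Measurable.ite (measurable_snd hB) (Measurable.ite
    (measurableSet_le measurable_fst measurable_const) measurable_const
    ((measurable_snd.sub h2).add ((h1.comp h2).mul measurable_fst))) ?_
  have hS : MeasurableSet {q : (ℝ × ℝ) × ℝ | q.2 ∈ Ioc 0 (max q.1.1 0)} :=
    (measurableSet_lt measurable_const measurable_snd).inter
      (measurableSet_le measurable_snd (g := fun q : (ℝ × ℝ) × ℝ => max q.1.1 0) (by fun_prop))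
  have e : ∀ q : ℝ × ℝ, ∫ u in (0 : ℝ)..max q.1 0, M.bandRate A u q.2 =
      ∫ u, {q : (ℝ × ℝ) × ℝ | q.2 ∈ Ioc 0 (max q.1.1 0)}.indicator
        (fun q => M.bandRate A q.2 q.1.2) (q, u) := fun q => by
    rw [intervalIntegral.integral_of_le (le_max_right _ _), ← integral_indicator measurableSet_Ioc]
    rfl
  simp_rw [e]
  have hm : Measurable fun q : (ℝ × ℝ) × ℝ => M.bandRate A q.2 q.1.2 :=
    (M.measurable_bandRate A).comp (measurable_snd.prodMk (measurable_snd.comp measurable_fst))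
  exact (StronglyMeasurable.integral_prod_right'
    (hm.indicator hS).stronglyMeasurable).measurable

theorem barrier_cases (h : M.IsBandPartition A B) (y : ℝ) :
    (barrier A y = ⊤ ∧ ∀ a ∈ A, a < y) ∨
      ∃ a ∈ A, y ≤ a ∧ barrier A y = a ∧ ∀ a' ∈ A, y ≤ a' → a ≤ a' := by
  rcases (A ∩ Ici y).eq_empty_or_nonempty with he | hne
  · refine Or.inl ⟨by simp [barrier, he], fun a ha => ?_⟩
    by_contra! hya
    exact (he ▸ (⟨ha, hya⟩ : a ∈ A ∩ Ici y) : a ∈ (∅ : Set ℝ))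
  · have hbdd : BddBelow (A ∩ Ici y) := ⟨y, fun a ha => ha.2⟩
    have hmem := (h.isClosed.inter isClosed_Ici).csInf_mem hne hbdd
    refine Or.inr ⟨_, hmem.1, hmem.2, le_antisymm (iInf₂_le _ hmem) ?_, fun a' ha' hya =>
      csInf_le hbdd ⟨ha', hya⟩⟩
    exact le_iInf₂ fun a ha => EReal.coe_le_coe_iff.2 (csInf_le hbdd ha)

theorem lumpTarget_eq (h : M.IsBandPartition A B) {y x₀ : ℝ} (hx : x₀ ∈ A) (hlt : x₀ < y)
    (hsub : Ioc x₀ y ⊆ B) : M.lumpTarget A y = x₀ := by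
  have hc : M.critical ≤ y := (h.critical_le _ hx).trans hlt.le
  rw [lumpTarget, max_eq_left hc]
  refine IsGreatest.csSup_eq ⟨⟨hx, hlt.le⟩, fun a ha => ?_⟩
  by_contra! hcon
  exact h.disjoint a ha.1 (hsub ⟨hcon, ha.2⟩)

theorem continuous_bandFlow (h : M.IsBandPartition A B) {y : ℝ} (hy : y ∉ B) :
    Continuous fun t => M.bandFlow A B t y := by
  have hc := M.continuous_flow y
  rcases barrier_cases h y with ⟨h1, -⟩ | ⟨a, -, -, h1, -⟩
  · simpa [bandFlow, hy, h1] using hc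
  · simp only [bandFlow, hy, h1, if_false]
    have : ∀ t, (min (M.flow t y : EReal) (a : EReal)).toReal = min (M.flow t y) a := fun t => by
      rcases le_total (M.flow t y) a with h | h
      · rw [min_eq_left h, min_eq_left (EReal.coe_le_coe_iff.2 h), EReal.toReal_coe]
      · rw [min_eq_right h, min_eq_right (EReal.coe_le_coe_iff.2 h), EReal.toReal_coe]
    simp_rw [this]
    exact hc.min continuous_const

/-- Below the barrier the band strategy follows the flow without dividends. -/
theorem bandFlow_of_lt {t y : ℝ} (hy : y ∉ B) (ht : M.flow t y < barrier A y) :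
    M.bandFlow A B t y = M.flow t y ∧ M.bandRate A t y = 0 := by
  simp [bandFlow, bandRate, hy, min_eq_left ht.le, not_le.2 ht]

theorem eventually_flow_lt_barrier {t y : ℝ} (ht : M.flow t y < barrier A y) :
    ∀ᶠ s in 𝓝 t, (M.flow s y : EReal) < barrier A y :=
  ((continuous_coe_real_ereal.comp (M.continuous_flow y)).tendsto t).eventually_lt_const ht

/-- At the barrier all income is paid out. -/
theorem bandFlow_of_le (h : M.IsBandPartition A B) {t y : ℝ} (hy : y ∉ B)
    (ht : barrier A y ≤ M.flow t y) : ∃ a ∈ A, ∀ s, t ≤ s →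
      M.bandFlow A B s y = a ∧ M.bandRate A s y = M.drift a := by
  rcases barrier_cases h y with ⟨h1, -⟩ | ⟨a, ha, hya, h1, -⟩
  · rw [h1] at ht
    exact absurd ht (by simp)
  · refine ⟨a, ha, fun s hs => ?_⟩
    rw [h1, EReal.coe_le_coe_iff] at ht
    have hc : M.critical ≤ y := by
      by_contra! hcon
      linarith [M.flow_lt_critical hcon t, h.critical_le a ha]
    have has : (a : EReal) ≤ M.flow s y := EReal.coe_le_coe_iff.2 (ht.trans (M.monotone_flow hc hs))
    simp [bandFlow, bandRate, hy, h1, has]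

/-- Points of `A` are excluded by the barrier. A point of `B` on the way would have its nearest
point of `A` either below the start, which would put the start into `B`, or at or above it, which
contradicts the barrier. -/
theorem notMem_of_lt_barrier (h : M.IsBandPartition A B) {t y : ℝ} (hy : y ∉ B) (hc : M.critical ≤ y)
    (h0 : 0 ≤ t) (ht : M.flow t y < barrier A y) : M.flow t y ∉ A ∧ M.flow t y ∉ B := by
  have hle : y ≤ M.flow t y := by
    have := M.monotone_flow hc h0
    simpa only [M.flow_zero] using this
  have hno : ∀ a ∈ A, y ≤ a → M.flow t y < a := fun a ha hya =>
    EReal.coe_lt_coe_iff.1 (ht.trans_le (iInf₂_le a ⟨ha, hya⟩))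
  refine ⟨fun hA => (hno _ hA hle).false, fun hB => ?_⟩
  obtain ⟨x₀, hx₀, hlt, hsub⟩ := h.nearest _ hB
  rcases lt_or_ge x₀ y with h1 | h1
  · exact hy (hsub ⟨h1, hle⟩)
  · exact absurd (hno x₀ hx₀ h1) (not_lt.2 hlt.le)

theorem bandRate_nonneg (h : M.IsBandPartition A B) (t y : ℝ) : 0 ≤ M.bandRate A t y := by
  rw [bandRate]
  split_ifs with ht
  · rcases barrier_cases h y with ⟨h1, -⟩ | ⟨a, ha, hya, h1, -⟩
    · rw [h1] at ht
      exact absurd ht (by simp)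
    · rw [h1, EReal.toReal_coe]
      exact M.drift_nonneg (h.critical_le a ha)
  · exact le_rfl

theorem intervalIntegrable_bandRate (s t y : ℝ) :
    IntervalIntegrable (fun u => M.bandRate A u y) volume s t := by
  refine (intervalIntegrable_const (c := |M.drift (barrier A y).toReal|)).mono_fun
    ((M.measurable_bandRate A).comp (measurable_id.prodMk measurable_const)).aestronglyMeasurable
    (Eventually.of_forall fun u => ?_)
  simp only [bandRate, Real.norm_eq_abs, abs_abs]
  split_ifs
  · exact le_rfl
  · simp

theorem bandDividends_of_nonpos {t : ℝ} (ht : t ≤ 0) (y : ℝ) : M.bandDividends A B t y = 0 := by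
  simp [bandDividends, ht]

theorem bandFlow_zero (y : ℝ) : M.bandFlow A B 0 y = y := by
  by_cases hy : y ∈ B
  · simp [bandFlow, hy]
  · have : (y : EReal) ≤ barrier A y := le_iInf₂ fun a ha => EReal.coe_le_coe_iff.2 ha.2
    simp [bandFlow, hy, M.flow_zero, min_eq_left this]

theorem bandDividends_sub {y : ℝ} (hy : y ∉ B) {s t : ℝ} (hs : 0 ≤ s) (ht : 0 ≤ t) :
    M.bandDividends A B t y - M.bandDividends A B s y = ∫ u in s..t, M.bandRate A u y := by
  simp only [bandDividends, hy, if_false, max_eq_left hs, max_eq_left ht]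
  exact intervalIntegral.integral_interval_sub_left (intervalIntegrable_bandRate _ _ _)
    (intervalIntegrable_bandRate _ _ _)

theorem monotone_bandDividends (h : M.IsBandPartition A B) (y : ℝ) :
    Monotone fun t => M.bandDividends A B t y := by
  intro s t hst
  by_cases hy : y ∈ B
  · obtain ⟨x₀, hx₀, hlt, hsub⟩ := h.nearest y hy
    have hd := M.drift_nonneg (h.critical_le _ hx₀)
    simp only [bandDividends, hy, if_true, lumpTarget_eq h hx₀ hlt hsub]
    split_ifs with h1 h2 h2
    · exact le_rfl
    · nlinarith
    · linarith
    · nlinarith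
  · have e : ∀ t, M.bandDividends A B t y = M.bandDividends A B (max t 0) y := fun t => by
      simp [bandDividends, hy]
    simp only
    rw [e t, e s, ← sub_nonneg, bandDividends_sub hy (le_max_right _ _) (le_max_right _ _)]
    exact intervalIntegral.integral_nonneg (max_le_max_right _ hst) fun u _ => bandRate_nonneg h u y

theorem leftCont_bandDividends (y t : ℝ) :
    ContinuousWithinAt (fun t => M.bandDividends A B t y) (Iic t) t := by
  by_cases hy : y ∈ B
  · rcases le_or_gt t 0 with ht | ht
    · refine (continuousWithinAt_const (b := (0 : ℝ))).congr (fun s hs => ?_) ?_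
      · exact bandDividends_of_nonpos (le_trans hs ht) y
      · exact bandDividends_of_nonpos ht y
    · refine ContinuousAt.continuousWithinAt (ContinuousAt.congr
        (f := fun t => (y - M.lumpTarget A y) + M.drift (M.lumpTarget A y) * t) (by fun_prop) ?_)
      filter_upwards [Ioi_mem_nhds ht] with s hs
      simp [bandDividends, hy, not_le.2 (mem_Ioi.1 hs)]
  · have hcont := intervalIntegral.continuous_primitive (f := fun u => M.bandRate A u y)
      (μ := volume) (fun _ _ => intervalIntegrable_bandRate _ _ _) 0
    have : Continuous fun t => M.bandDividends A B t y := by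
      simp only [bandDividends, hy, if_false]
      exact hcont.comp (continuous_id.max continuous_const)
    exact this.continuousWithinAt

theorem intervalIntegrable_drift_bandFlow (h : M.IsBandPartition A B) (y : ℝ) {t : ℝ} (ht : 0 ≤ t) :
    IntervalIntegrable (fun u => M.drift (M.bandFlow A B u y)) volume 0 t := by
  by_cases hy : y ∈ B
  · refine (intervalIntegrable_const (c := M.drift (M.lumpTarget A y))).congr fun u hu => ?_
    rw [uIoc_of_le ht] at hu
    simp [bandFlow, hy, not_le.2 hu.1]
  · exact (M.continuous_drift.comp (continuous_bandFlow h hy)).intervalIntegrable _ _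

/-- Outside `B` the right derivative of the path is the drift minus the dividend rate, both before
and after the barrier is reached, and the path is continuous. -/
theorem bandFlow_eq (h : M.IsBandPartition A B) (y : ℝ) {t : ℝ} (ht : 0 ≤ t) :
    M.bandFlow A B t y = y + (∫ u in (0 : ℝ)..t, M.drift (M.bandFlow A B u y)) -
      M.bandDividends A B t y := by
  by_cases hy : y ∈ B
  · rcases ht.eq_or_lt with rfl | ht
    · simp [bandFlow_zero, bandDividends_of_nonpos]
    · have e : ∫ u in (0 : ℝ)..t, M.drift (M.bandFlow A B u y) =
          ∫ u in (0 : ℝ)..t, M.drift (M.lumpTarget A y) := by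
        refine intervalIntegral.integral_congr_ae (Eventually.of_forall fun u hu => ?_)
        rw [uIoc_of_le ht.le] at hu
        simp [bandFlow, hy, not_le.2 hu.1]
      rw [e, intervalIntegral.integral_const]
      simp only [bandFlow, bandDividends, hy, if_true, not_le.2 ht, if_false, smul_eq_mul]
      ring
  · have hi := intervalIntegrable_drift_bandFlow h y ht
    have hderiv : ∀ u ∈ Ioo 0 t, HasDerivWithinAt (fun t => M.bandFlow A B t y)
        (M.drift (M.bandFlow A B u y) - M.bandRate A u y) (Ioi u) u := by
      intro u _
      rcases lt_or_ge (M.flow u y : EReal) (barrier A y) with hlt | hge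
      · obtain ⟨e1, e2⟩ := bandFlow_of_lt (B := B) hy hlt
        rw [e1, e2, sub_zero]
        refine ((M.hasDerivWithinAt_flow_right u y).mono
          Ioi_subset_Ici_self).congr_of_eventuallyEq ?_ e1
        filter_upwards [(eventually_flow_lt_barrier hlt).filter_mono nhdsWithin_le_nhds] with s hs
        exact (bandFlow_of_lt hy hs).1
      · obtain ⟨a, -, hs⟩ := bandFlow_of_le h hy hge
        rw [(hs u le_rfl).1, (hs u le_rfl).2, sub_self]
        exact (hasDerivWithinAt_const u _ a).congr (fun s hs' => (hs s (le_of_lt hs')).1)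
          (hs u le_rfl).1
    have key := intervalIntegral.integral_eq_sub_of_hasDeriv_right_of_le ht
      (continuous_bandFlow h hy).continuousOn hderiv (hi.sub (intervalIntegrable_bandRate _ _ _))
    rw [intervalIntegral.integral_sub hi (intervalIntegrable_bandRate _ _ _), bandFlow_zero] at key
    have e := bandDividends_sub (M := M) (A := A) hy le_rfl ht
    rw [bandDividends_of_nonpos le_rfl, sub_zero] at e
    rw [e]
    linarith

theorem bandDividends_sub_eq (h : M.IsBandPartition A B) (y : ℝ) {s t : ℝ} (hs : 0 ≤ s)
    (ht : 0 ≤ t) : M.bandDividends A B t y - M.bandDividends A B s y =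
      M.bandFlow A B s y - M.bandFlow A B t y +
        ∫ u in s..t, M.drift (M.bandFlow A B u y) := by
  rw [← intervalIntegral.integral_interval_sub_left (intervalIntegrable_drift_bandFlow h y ht)
    (intervalIntegrable_drift_bandFlow h y hs)]
  have e1 := bandFlow_eq h y hs
  have e2 := bandFlow_eq h y ht
  linarith

/-- The band rule is silent below the critical level. The second assertion fixes the behaviour
there, so that the path is determined by the claims. -/
theorem bandRule_bandFlow (h : M.IsBandPartition A B) (y : ℝ) {t : ℝ} (ht : 0 ≤ t) :
    M.BandRule A B (fun t => M.bandFlow A B t y) (fun t => M.bandDividends A B t y) t ∧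
      (M.bandFlow A B t y < M.critical →
        ∀ᶠ s in 𝓝[>] t, M.bandDividends A B s y = M.bandDividends A B t y) := by
  -- A path resting at a point of `A` meets the first rule by the balance equation and the other
  -- rules vacuously.
  have habs : ∀ a ∈ A, (∀ s, t ≤ s → M.bandFlow A B s y = a) →
      M.BandRule A B (fun t => M.bandFlow A B t y) (fun t => M.bandDividends A B t y) t ∧
      (M.bandFlow A B t y < M.critical →
        ∀ᶠ s in 𝓝[>] t, M.bandDividends A B s y = M.bandDividends A B t y) := by
    intro a ha hs
    have e := hs t le_rfl
    refine ⟨⟨fun _ => ?_, fun hB => ?_, fun hC => ?_⟩, fun hlt => ?_⟩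
    · filter_upwards [self_mem_nhdsWithin] with s hst
      have hst : t ≤ s := le_of_lt hst
      rw [bandDividends_sub_eq h y ht (ht.trans hst), hs s hst, e]
      ring
    · simp only [e] at hB
      exact absurd hB (h.disjoint a ha)
    · simp only [e] at hC
      exact absurd ha hC.2.1
    · rw [e] at hlt
      exact absurd hlt (not_lt.2 (h.critical_le a ha))
  by_cases hy : y ∈ B
  · obtain ⟨x₀, hx₀, hlt, hsub⟩ := h.nearest y hy
    have hx := lumpTarget_eq h hx₀ hlt hsub
    rcases ht.eq_or_lt with rfl | ht
    · have e := bandFlow_zero (M := M) (A := A) (B := B) y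
      have hc := h.critical_lt y hy
      refine ⟨⟨fun hA => ?_, fun _ => ⟨x₀, hx₀, by simpa only [e], by simpa only [e], ?_⟩,
        fun hC => ?_⟩, fun hlt => ?_⟩
      · simp only [e] at hA
        exact absurd hy (h.disjoint y hA)
      · simp only [bandDividends_of_nonpos le_rfl, e, sub_zero]
        refine rightLim_eq_of_tendsto ?_
        have : Tendsto (fun t => (y - x₀) + M.drift x₀ * t) (𝓝[>] 0) (𝓝 (y - x₀)) := by
          have : Continuous fun t => (y - x₀) + M.drift x₀ * t := by fun_prop
          simpa using (this.tendsto 0).mono_left nhdsWithin_le_nhds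
        refine this.congr' ?_
        filter_upwards [self_mem_nhdsWithin] with s hs
        simp [bandDividends, hy, hx, not_le.2 (mem_Ioi.1 hs)]
      · simp only [e] at hC
        exact absurd hy hC.2.2
      · rw [e] at hlt
        exact absurd hlt (not_lt.2 hc.le)
    · refine habs x₀ hx₀ fun s hs => ?_
      simp [bandFlow, hy, hx, not_le.2 (ht.trans_le hs)]
  · rcases lt_or_ge (M.flow t y : EReal) (barrier A y) with hlt | hge
    · obtain ⟨e, -⟩ := bandFlow_of_lt (B := B) hy hlt
      have hfree : ∀ᶠ s in 𝓝[>] t, M.bandDividends A B s y = M.bandDividends A B t y := by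
        obtain ⟨b, hb, hsub⟩ := (mem_nhdsGT_iff_exists_Ioo_subset' (lt_add_one t)).1
          ((eventually_flow_lt_barrier hlt).filter_mono nhdsWithin_le_nhds)
        filter_upwards [Ioo_mem_nhdsGT hb] with s hs
        rw [← sub_eq_zero, bandDividends_sub hy ht (ht.trans hs.1.le)]
        refine intervalIntegral.integral_zero_ae (Eventually.of_forall fun u hu => ?_)
        rw [uIoc_of_le hs.1.le] at hu
        exact (bandFlow_of_lt (B := B) hy (hsub ⟨hu.1, hu.2.trans_lt hs.2⟩)).2
      have hmem : M.critical ≤ M.bandFlow A B t y →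
          M.bandFlow A B t y ∉ A ∧ M.bandFlow A B t y ∉ B := by
        rw [e]
        intro hc
        refine notMem_of_lt_barrier h hy ?_ ht hlt
        by_contra! hcon
        exact absurd hc (not_le.2 (M.flow_lt_critical hcon t))
      exact ⟨⟨fun hA => absurd hA (hmem (h.critical_le _ hA)).1,
        fun hB => absurd hB (hmem (h.critical_lt _ hB).le).2, fun _ => hfree⟩, fun _ => hfree⟩
    · obtain ⟨a, ha, hs⟩ := bandFlow_of_le h hy hge
      exact habs a ha fun s hst => (hs s hst).1

end

end RiskModel

/-! ### Gluing the pieces at the claims. -/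

namespace RiskModel

section

variable {Ω : Type*} [MeasurableSpace Ω] {μ : Measure Ω} {M : RiskModel μ} {A B : Set ℝ}

/-- The rule of a band strategy and the rule to pay nothing below the critical level. -/
def StrictBandRule (M : RiskModel μ) (A B : Set ℝ) (R L : ℝ → ℝ) (t : ℝ) : Prop :=
  M.BandRule A B R L t ∧ (R t < M.critical → ∀ᶠ s in 𝓝[>] t, L s = L t)

theorem tendsto_sub_nhdsGT (t c : ℝ) : Tendsto (fun s => s - c) (𝓝[>] t) (𝓝[>] (t - c)) := by
  refine tendsto_nhdsWithin_iff.2 ⟨?_, ?_⟩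
  · exact ((by fun_prop : Continuous fun s : ℝ => s - c).tendsto t).mono_left nhdsWithin_le_nhds
  · filter_upwards [self_mem_nhdsWithin] with s hs
    exact sub_lt_sub_right hs c

/-- The rule of a band strategy is local and invariant under time shifts. -/
theorem StrictBandRule.shift {R L R' L' : ℝ → ℝ} {t b c : ℝ} (hL' : Monotone L')
    (h : M.StrictBandRule A B R' L' (t - c)) (hb : t < b)
    (hR : ∀ s ∈ Ico t b, R s = R' (s - c))
    (hL : ∀ s ∈ Ico t b, L s - L t = L' (s - c) - L' (t - c)) : M.StrictBandRule A B R L t := by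
  have hRt : R t = R' (t - c) := hR t ⟨le_rfl, hb⟩
  have hT := tendsto_sub_nhdsGT t c
  have hev : ∀ᶠ s in 𝓝[>] t, s ∈ Ioo t b := Ioo_mem_nhdsGT hb
  have hconst : (∀ᶠ s in 𝓝[>] (t - c), L' s = L' (t - c)) → ∀ᶠ s in 𝓝[>] t, L s = L t := by
    intro h
    filter_upwards [hT.eventually h, hev] with s hs hsb
    have := hL s ⟨hsb.1.le, hsb.2⟩
    linarith
  refine ⟨⟨fun hA => ?_, fun hB => ?_, fun hC => hconst (h.1.2.2 (hRt ▸ hC))⟩,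
    fun hlt => hconst (h.2 (hRt ▸ hlt))⟩
  · filter_upwards [hT.eventually (h.1.1 (hRt ▸ hA)), hev] with s hs hsb
    rw [hL s ⟨hsb.1.le, hsb.2⟩, hs, ← intervalIntegral.integral_comp_sub_right
      (fun u => M.drift (R' u))]
    refine intervalIntegral.integral_congr fun u hu => ?_
    rw [uIcc_of_le hsb.1.le] at hu
    simp only [hR u ⟨hu.1, hu.2.trans_lt hsb.2⟩]
  · obtain ⟨x₀, hx₀, hlt, hsub, hj⟩ := h.1.2.1 (hRt ▸ hB)
    rw [hRt]
    refine ⟨x₀, hx₀, hlt, hsub, ?_⟩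
    have h1 : Tendsto (fun s => L' (s - c) - L' (t - c) + L t) (𝓝[>] t)
        (𝓝 (Function.rightLim L' (t - c) - L' (t - c) + L t)) :=
      (((hL'.tendsto_rightLim _).comp hT).sub_const _).add_const _
    have h2 : Function.rightLim L t = Function.rightLim L' (t - c) - L' (t - c) + L t := by
      refine rightLim_eq_of_tendsto (h1.congr' ?_)
      filter_upwards [hev] with s hsb
      linarith [hL s ⟨hsb.1.le, hsb.2⟩]
    rw [h2, hj]
    ring

end

section

variable {Ω : Type*} [MeasurableSpace Ω] {μ : Measure Ω} [IsProbabilityMeasure μ]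
  (M : RiskModel μ) (A B : Set ℝ) (x : ℝ)

/-- The reserve after the claim at the epoch with index `n` under the band strategy. -/
noncomputable def bandState (n : ℕ) (ω : Ω) : ℝ :=
  Nat.rec x (fun n y => M.bandFlow A B (M.W n ω) y - M.U n ω) n

theorem bandState_succ (n : ℕ) (ω : Ω) : M.bandState A B x (n + 1) ω =
    M.bandFlow A B (M.W n ω) (M.bandState A B x n ω) - M.U n ω := rfl

open Classical in
/-- The dividends of the band strategy. -/
noncomputable def bandL (t : ℝ) (ω : Ω) : ℝ :=
  -- A strategy must have monotone, left-continuous dividends in every scenario, not only almost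
  -- surely; hence the value zero in the irregular ones.
  if M.IsRegular ω then
    ∑' k, M.bandDividends A B (min (t - M.epoch k ω) (M.W k ω)) (M.bandState A B x k ω)
  else 0

open Classical in
/-- The reserve of the band strategy. -/
noncomputable def bandR (t : ℝ) (ω : Ω) : ℝ :=
  ∑' k, if t ∈ Ico (M.epoch k ω) (M.epoch (k + 1) ω) then
    M.bandFlow A B (t - M.epoch k ω) (M.bandState A B x k ω) else 0

variable {M A B x} {ω : Ω}

theorem bandL_eq_sum (h : M.IsRegular ω) {n : ℕ} {t : ℝ} (ht : t ≤ M.epoch n ω) :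
    M.bandL A B x t ω = ∑ k ∈ Finset.range n,
      M.bandDividends A B (min (t - M.epoch k ω) (M.W k ω)) (M.bandState A B x k ω) := by
  rw [bandL, if_pos h]
  -- Pieces that start at or after `t` have a nonpositive time argument, where `bandDividends`
  -- vanishes.
  refine tsum_eq_sum fun k hk => bandDividends_of_nonpos ((min_le_left _ _).trans ?_) _
  rw [sub_nonpos]
  exact ht.trans (h.strictMono_epoch.monotone (by simpa using hk))

theorem bandL_eq (h : M.IsRegular ω) {n : ℕ} {t : ℝ}
    (ht : t ∈ Icc (M.epoch n ω) (M.epoch (n + 1) ω)) :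
    M.bandL A B x t ω = M.bandL A B x (M.epoch n ω) ω +
      M.bandDividends A B (t - M.epoch n ω) (M.bandState A B x n ω) := by
  rw [bandL_eq_sum h ht.2, bandL_eq_sum h le_rfl, Finset.sum_range_succ]
  congr 1
  · refine Finset.sum_congr rfl fun k hk => ?_
    have h1 : M.epoch (k + 1) ω ≤ M.epoch n ω :=
      h.strictMono_epoch.monotone (by simp at hk; omega)
    rw [M.epoch_succ] at h1
    rw [min_eq_right (by linarith [ht.1]), min_eq_right (by linarith)]
  · have := ht.2
    rw [M.epoch_succ] at this
    rw [min_eq_left (by linarith)]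

theorem bandR_eq (h : M.IsRegular ω) {n : ℕ} {t : ℝ}
    (ht : t ∈ Ico (M.epoch n ω) (M.epoch (n + 1) ω)) :
    M.bandR A B x t ω = M.bandFlow A B (t - M.epoch n ω) (M.bandState A B x n ω) := by
  rw [bandR, tsum_eq_single n fun k hk => if_neg fun hk' => ?_, if_pos ht]
  rcases lt_or_gt_of_ne hk with hlt | hlt
  · have := h.strictMono_epoch.monotone (show k + 1 ≤ n from hlt)
    linarith [ht.1, hk'.2]
  · have := h.strictMono_epoch.monotone (show n + 1 ≤ k from hlt)
    linarith [ht.2, hk'.1]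

theorem bandL_of_nonpos {t : ℝ} (ht : t ≤ 0) : M.bandL A B x t ω = 0 := by
  by_cases h : M.IsRegular ω
  · rw [bandL_eq_sum h (n := 0) (by rwa [M.epoch_zero])]
    simp
  · rw [bandL, if_neg h]

theorem monotone_bandL (hp : M.IsBandPartition A B) (ω : Ω) :
    Monotone fun t => M.bandL A B x t ω := by
  intro s t hst
  by_cases h : M.IsRegular ω
  · obtain ⟨n, hn⟩ := (h.tendsto.eventually_ge_atTop t).exists
    simp only [bandL_eq_sum h hn, bandL_eq_sum h (hst.trans hn)]
    exact Finset.sum_le_sum fun k _ =>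
      monotone_bandDividends hp _ (min_le_min_right _ (sub_le_sub_right hst _))
  · simp [bandL, h]

theorem leftCont_bandL (ω : Ω) (t : ℝ) :
    ContinuousWithinAt (fun t => M.bandL A B x t ω) (Iic t) t := by
  by_cases h : M.IsRegular ω
  · obtain ⟨n, hn⟩ := (h.tendsto.eventually_ge_atTop t).exists
    refine ContinuousWithinAt.congr (f := fun t => ∑ k ∈ Finset.range n,
      M.bandDividends A B (min (t - M.epoch k ω) (M.W k ω)) (M.bandState A B x k ω)) ?_
      (fun s hs => bandL_eq_sum h (le_trans hs hn)) (bandL_eq_sum h hn)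
    refine tendsto_finsetSum _ fun k _ => ?_
    refine ContinuousWithinAt.comp (t := Iic (min (t - M.epoch k ω) (M.W k ω)))
      (f := fun s => min (s - M.epoch k ω) (M.W k ω))
      (g := fun u => M.bandDividends A B u (M.bandState A B x k ω))
      (leftCont_bandDividends _ _)
      (by fun_prop : Continuous fun s : ℝ => min (s - M.epoch k ω) (M.W k ω)).continuousWithinAt
      fun s hs => ?_
    exact min_le_min_right _ (sub_le_sub_right (mem_Iic.1 hs) _)
  · simp only [bandL, h, if_false]
    exact continuousWithinAt_const

/-- The path of the band strategy between two claims. -/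
theorem integral_drift_bandR (hp : M.IsBandPartition A B) (h : M.IsRegular ω) {n : ℕ} {t : ℝ}
    (ht : t ∈ Icc (M.epoch n ω) (M.epoch (n + 1) ω)) :
    IntervalIntegrable (fun u => M.drift (M.bandR A B x u ω)) volume (M.epoch n ω) t ∧
    M.bandState A B x n ω + ∫ u in (M.epoch n ω)..t, M.drift (M.bandR A B x u ω) =
      M.bandFlow A B (t - M.epoch n ω) (M.bandState A B x n ω) +
        (M.bandL A B x t ω - M.bandL A B x (M.epoch n ω) ω) := by
  have h0 : 0 ≤ t - M.epoch n ω := sub_nonneg.2 ht.1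
  have e : ∀ u ∈ uIoo (M.epoch n ω) t, M.drift (M.bandFlow A B (u - M.epoch n ω)
      (M.bandState A B x n ω)) = M.drift (M.bandR A B x u ω) := fun u hu => by
    rw [uIoo_of_le ht.1] at hu
    rw [bandR_eq h ⟨hu.1.le, hu.2.trans_le ht.2⟩]
  have hi := (intervalIntegrable_drift_bandFlow hp (M.bandState A B x n ω) h0).comp_sub_right
    (M.epoch n ω)
  rw [zero_add, sub_add_cancel] at hi
  refine ⟨hi.congr_uIoo e, ?_⟩
  rw [← intervalIntegral.integral_congr_uIoo e, intervalIntegral.integral_comp_sub_right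
    (fun u => M.drift (M.bandFlow A B u (M.bandState A B x n ω))), sub_self,
    bandFlow_eq hp _ h0, bandL_eq h ht]
  ring

theorem bandState_eq (hp : M.IsBandPartition A B) (h : M.IsRegular ω) (n : ℕ) :
    IntervalIntegrable (fun u => M.drift (M.bandR A B x u ω)) volume 0 (M.epoch n ω) ∧
    M.bandState A B x n ω = x + (∫ u in (0 : ℝ)..(M.epoch n ω), M.drift (M.bandR A B x u ω)) -
      (∑ k ∈ Finset.range n, M.U k ω) - M.bandL A B x (M.epoch n ω) ω := by
  induction n with
  | zero =>
    rw [M.epoch_zero, bandL_of_nonpos le_rfl]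
    simp [bandState]
  | succ n ih =>
    have hle : M.epoch n ω ≤ M.epoch (n + 1) ω := h.strictMono_epoch.monotone (Nat.le_succ n)
    obtain ⟨h1, h2⟩ := integral_drift_bandR (x := x) hp h ⟨hle, le_rfl⟩
    refine ⟨ih.1.trans h1, ?_⟩
    rw [← intervalIntegral.integral_add_adjacent_intervals ih.1 h1, bandState_succ,
      Finset.sum_range_succ]
    have : M.epoch (n + 1) ω - M.epoch n ω = M.W n ω := by rw [M.epoch_succ]; ring
    rw [this] at h2
    linarith [ih.2]

theorem isClaimPath_band (hp : M.IsBandPartition A B) (h : M.IsRegular ω) :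
    M.IsClaimPath ω x (fun t => M.bandR A B x t ω) (fun t => M.bandL A B x t ω)
      fun t => x + (∫ u in (0 : ℝ)..t, M.drift (M.bandR A B x u ω)) - M.priorClaims t ω -
        M.bandL A B x t ω := by
  have key : ∀ t, 0 ≤ t →
      IntervalIntegrable (fun u => M.drift (M.bandR A B x u ω)) volume 0 t ∧
      M.bandR A B x t ω = x + (∫ u in (0 : ℝ)..t, M.drift (M.bandR A B x u ω)) -
        M.aggregateClaims t ω - M.bandL A B x t ω := by
    intro t ht
    obtain ⟨n, hn⟩ := h.exists_mem ht
    obtain ⟨h1, h2⟩ := integral_drift_bandR (x := x) hp h ⟨hn.1, hn.2.le⟩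
    obtain ⟨h3, h4⟩ := bandState_eq (x := x) hp h n
    refine ⟨h3.trans h1, ?_⟩
    rw [← intervalIntegral.integral_add_adjacent_intervals h3 h1, bandR_eq h hn,
      h.aggregateClaims_eq_sum hn]
    linarith
  exact ⟨h, monotone_bandL hp ω, leftCont_bandL ω, bandL_of_nonpos le_rfl,
    fun t ht => (key t ht).1, fun t ht => (key t ht).2, fun _ _ => rfl⟩

theorem strictBandRule_band (hp : M.IsBandPartition A B) (h : M.IsRegular ω) {t : ℝ} (ht : 0 ≤ t) :
    M.StrictBandRule A B (fun t => M.bandR A B x t ω) (fun t => M.bandL A B x t ω) t := by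
  obtain ⟨n, hn⟩ := h.exists_mem ht
  refine StrictBandRule.shift (c := M.epoch n ω) (b := M.epoch (n + 1) ω)
    (monotone_bandDividends hp (M.bandState A B x n ω))
    (bandRule_bandFlow hp (M.bandState A B x n ω) (sub_nonneg.2 hn.1)) hn.2
    (fun s hs => bandR_eq h ⟨hn.1.trans hs.1, hs.2⟩) fun s hs => ?_
  simp only [bandL_eq h ⟨hn.1.trans hs.1, hs.2.le⟩, bandL_eq h ⟨hn.1, hn.2.le⟩]
  ring

theorem IsClaimPath.rightLim_sub_le (hp : M.IsBandPartition A B) {R L v : ℝ → ℝ}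
    (h : M.IsClaimPath ω x R L v) {t : ℝ} (ht : 0 ≤ t) (hr : M.StrictBandRule A B R L t) :
    Function.rightLim L t - L t ≤ max (R t - M.critical) 0 := by
  have hconst : Function.rightLim L t = L t →
      Function.rightLim L t - L t ≤ max (R t - M.critical) 0 := fun h => by
    rw [h, sub_self]; exact le_max_right _ _
  by_cases hA : R t ∈ A
  · obtain ⟨n, hn⟩ := h.regular.exists_mem ht
    refine hconst ((h.isReservePath n).rightLim_eq_of_mem_A (A := A) (B := B) hn
      (hr.1.update hn.2.ne) ?_)
    rwa [Function.update_of_ne hn.2.ne]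
  by_cases hB : R t ∈ B
  · obtain ⟨x₀, hx₀, -, -, hj⟩ := hr.1.2.1 hB
    rw [hj]
    exact le_max_of_le_left (by linarith [hp.critical_le _ hx₀])
  rcases le_or_gt M.critical (R t) with hc | hc
  · exact hconst (rightLim_eq_of_eventually_eq (hr.1.2.2 ⟨hc, hA, hB⟩))
  · exact hconst (rightLim_eq_of_eventually_eq (hr.2 hc))

end

end RiskModel

/-! ### Adaptedness and predictability of the band strategy. -/

namespace RiskModel

section

variable {Ω : Type*} [MeasurableSpace Ω] {μ : Measure Ω} [IsProbabilityMeasure μ]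
  {M : RiskModel μ} {A B : Set ℝ} {x : ℝ} {ω ω' : Ω} {R L v R' L' v' : ℝ → ℝ}

theorem IsClaimPath.isReservePath_Icc (h : M.IsClaimPath ω x R L v) {n : ℕ} {s b : ℝ}
    (hs : M.epoch n ω ≤ s) (hsb : s ≤ b) (hb : b < M.epoch (n + 1) ω) :
    M.IsReservePath R L s b := by
  have h0 : 0 ≤ s := (h.regular.epoch_nonneg n).trans hs
  refine ⟨h.mono, h.leftCont, hsb, (h.integrable s h0).symm.trans (h.integrable b (h0.trans hsb)),
    fun u hu => ?_⟩
  have e := intervalIntegral.integral_add_adjacent_intervals (h.integrable s h0)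
    ((h.integrable s h0).symm.trans (h.integrable u (h0.trans hu.1)))
  have e1 := h.regular.aggregateClaims_eq_sum ⟨hs, hsb.trans_lt hb⟩
  have e2 := h.regular.aggregateClaims_eq_sum ⟨hs.trans hu.1, hu.2.trans_lt hb⟩
  linarith [h.dyn s h0, h.dyn u (h0.trans hu.1)]

/-- The reserve of a band strategy is determined by the aggregate claims, and it does not
anticipate them. -/
theorem IsClaimPath.eq_of_strictBandRule (hp : M.IsBandPartition A B)
    (h : M.IsClaimPath ω x R L v) (h' : M.IsClaimPath ω' x R' L' v')
    (hr : ∀ t, 0 ≤ t → M.StrictBandRule A B R L t)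
    (hr' : ∀ t, 0 ≤ t → M.StrictBandRule A B R' L' t) {T : ℝ}
    (hY : ∀ t ∈ Icc 0 T, M.aggregateClaims t ω = M.aggregateClaims t ω') :
    ∀ t ∈ Icc 0 T, R t = R' t ∧ L t = L' t := by
  refine real_induction (fun s hs hind => ?_) (fun s hs hind => ?_)
  · have hL : L s = L' s := by
      rcases hs.1.eq_or_lt with rfl | h0
      · rw [h.eq_zero, h'.eq_zero]
      · refine tendsto_nhds_unique ((h.leftCont s).mono_left (nhdsWithin_mono _ Iio_subset_Iic_self))
          (((h'.leftCont s).mono_left (nhdsWithin_mono _ Iio_subset_Iic_self)).congr' ?_)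
        filter_upwards [Ioo_mem_nhdsLT h0] with u hu
        exact (hind u ⟨hu.1.le, hu.2⟩).2.symm
    refine ⟨?_, hL⟩
    rw [h.dyn s hs.1, h'.dyn s hs.1, hL, hY s hs, intervalIntegral.integral_congr_uIoo fun u hu => ?_]
    rw [uIoo_of_le hs.1] at hu
    simp only [(hind u ⟨hu.1.le, hu.2⟩).1]
  · obtain ⟨n, hn⟩ := h.regular.exists_mem hs.1
    obtain ⟨m, hm⟩ := h'.regular.exists_mem hs.1
    filter_upwards [Ioo_mem_nhdsGT hn.2, Ioo_mem_nhdsGT hm.2] with b hb hb'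
    obtain ⟨hRs, hLs⟩ := hind s ⟨hs.1, le_rfl⟩
    obtain ⟨hR, hL⟩ := (h.isReservePath_Icc hn.1 hb.1.le hb.2).eq_of_bandRule hp
      (h'.isReservePath_Icc hm.1 hb'.1.le hb'.2)
      (fun t ht => (hr t (hs.1.trans ht.1)).1) (fun t ht => (hr' t (hs.1.trans ht.1)).1)
      (fun t ht => (hr t (hs.1.trans ht.1)).2) (fun t ht => (hr' t (hs.1.trans ht.1)).2) hRs
      b ⟨hb.1.le, le_rfl⟩
    exact ⟨hR, by linarith⟩

/-- The aggregate claims are step functions constant to the right of each time, so rational times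
and the end point determine them. The observations thus reduce to countably many real variables. -/
theorem IsRegular.aggregateClaims_eq_of_dense (h : M.IsRegular ω) (h' : M.IsRegular ω') {T : ℝ}
    (hT : M.aggregateClaims T ω = M.aggregateClaims T ω')
    (hY : ∀ q : ℚ, (q : ℝ) ∈ Icc 0 T → M.aggregateClaims q ω = M.aggregateClaims q ω') {t : ℝ}
    (ht : t ∈ Icc 0 T) : M.aggregateClaims t ω = M.aggregateClaims t ω' := by
  rcases ht.2.eq_or_lt with rfl | htT
  · exact hT
  obtain ⟨n, hn⟩ := h.exists_mem ht.1
  obtain ⟨m, hm⟩ := h'.exists_mem ht.1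
  obtain ⟨q, hq, hq'⟩ := exists_rat_btwn (lt_min htT (lt_min hn.2 hm.2))
  rw [lt_min_iff, lt_min_iff] at hq'
  rw [h.aggregateClaims_eq_sum hn, h'.aggregateClaims_eq_sum hm,
    ← h.aggregateClaims_eq_sum (t := q) ⟨hn.1.trans hq.le, hq'.2.1⟩,
    ← h'.aggregateClaims_eq_sum (t := q) ⟨hm.1.trans hq.le, hq'.2.2⟩]
  exact hY q ⟨ht.1.trans hq.le, hq'.1.le⟩

variable (M) in
theorem measurableSet_isRegular : MeasurableSet {ω | M.IsRegular ω} := by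
  have : {ω | M.IsRegular ω} = (⋂ n, {ω | 0 < M.W n ω}) ∩ (⋂ n, {ω | 0 ≤ M.U n ω}) ∩
      {ω | Tendsto (fun n => M.epoch n ω) atTop atTop} := by
    ext ω
    simp only [mem_inter_iff, mem_iInter, mem_ofPred_eq]
    exact ⟨fun h => ⟨⟨h.1, h.2⟩, h.3⟩, fun h => ⟨h.1.1, h.1.2, h.2⟩⟩
  rw [this]
  refine ((MeasurableSet.iInter fun n => measurableSet_lt measurable_const (M.measurable_W n)).inter
    (MeasurableSet.iInter fun n => measurableSet_le measurable_const (M.measurable_U n))).inter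
    (measurableSet_tendsto _ fun n => M.measurable_epoch n)

theorem measurable_bandState (hp : M.IsBandPartition A B) (n : ℕ) :
    Measurable (M.bandState A B x n) := by
  induction n with
  | zero => exact measurable_const
  | succ n ih =>
    exact ((measurable_bandFlow hp.critical_mem hp.isOpen.measurableSet).comp
      ((M.measurable_W n).prodMk ih)).sub (M.measurable_U n)

theorem measurable_bandL (hp : M.IsBandPartition A B) (t : ℝ) :
    Measurable (M.bandL A B x t) := by
  refine Measurable.ite (measurableSet_isRegular M) (Measurable.tsum fun k => ?_) measurable_const
  exact (measurable_bandDividends hp.critical_mem hp.isOpen.measurableSet).comp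
    (((measurable_const.sub (M.measurable_epoch k)).min (M.measurable_W k)).prodMk
      (measurable_bandState hp k))

end

section

variable {Ω : Type*} [MeasurableSpace Ω] {μ : Measure Ω} [IsProbabilityMeasure μ]

/-- The sequences of the waiting times and of the claim sizes. -/
noncomputable def claimData (M : RiskModel μ) (ω : Ω) : (ℕ → ℝ) × (ℕ → ℝ) :=
  (fun n => M.W n ω, fun n => M.U n ω)

theorem measurable_claimData (M : RiskModel μ) : Measurable M.claimData :=
  (measurable_pi_lambda _ M.measurable_W).prodMk (measurable_pi_lambda _ M.measurable_U)

/-- The risk model on the space of the sequences of waiting times and claim sizes. -/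
noncomputable def canonical (M : RiskModel μ) : RiskModel (μ.map M.claimData) where
  p := M.p
  r := M.r
  α := M.α
  δ := M.δ
  lam := M.lam
  p_pos := M.p_pos
  r_pos := M.r_pos
  r_lt_α := M.r_lt_α
  r_lt_δ := M.r_lt_δ
  lam_pos := M.lam_pos
  W n z := z.1 n
  U n z := z.2 n
  measurable_W n := by fun_prop
  measurable_U n := by fun_prop
  law_W n := by
    rw [Measure.map_map (by fun_prop) M.measurable_claimData]
    exact M.law_W n
  iIndep_W := by
    rw [iIndepFun_iff_measure_inter_preimage_eq_mul]
    intro S s hs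
    have hm : ∀ i ∈ S, MeasurableSet ((fun z : (ℕ → ℝ) × (ℕ → ℝ) => z.1 i) ⁻¹' s i) :=
      fun i hi => (by fun_prop : Measurable fun z : (ℕ → ℝ) × (ℕ → ℝ) => z.1 i) (hs i hi)
    rw [Measure.map_apply M.measurable_claimData (Finset.measurableSet_biInter _ hm),
      preimage_iInter₂, Finset.prod_congr rfl fun i hi =>
        Measure.map_apply M.measurable_claimData (hm i hi)]
    exact M.iIndep_W.measure_inter_preimage_eq_mul S hs
  U_nonneg n := by
    rw [ae_map_iff M.measurable_claimData.aemeasurable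
      (measurableSet_le measurable_const (by fun_prop))]
    exact M.U_nonneg n
  identDistrib_U n := by
    refine ⟨by fun_prop, by fun_prop, ?_⟩
    rw [Measure.map_map (by fun_prop) M.measurable_claimData,
      Measure.map_map (by fun_prop) M.measurable_claimData]
    exact (M.identDistrib_U n).map_eq
  iIndep_U := by
    rw [iIndepFun_iff_measure_inter_preimage_eq_mul]
    intro S s hs
    have hm : ∀ i ∈ S, MeasurableSet ((fun z : (ℕ → ℝ) × (ℕ → ℝ) => z.2 i) ⁻¹' s i) :=
      fun i hi => (by fun_prop : Measurable fun z : (ℕ → ℝ) × (ℕ → ℝ) => z.2 i) (hs i hi)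
    rw [Measure.map_apply M.measurable_claimData (Finset.measurableSet_biInter _ hm),
      preimage_iInter₂, Finset.prod_congr rfl fun i hi =>
        Measure.map_apply M.measurable_claimData (hm i hi)]
    exact M.iIndep_U.measure_inter_preimage_eq_mul S hs
  indep_W_U := by
    rw [indepFun_iff_measure_inter_preimage_eq_mul]
    intro s t hs ht
    have h1 : MeasurableSet ((fun z : (ℕ → ℝ) × (ℕ → ℝ) => fun n => z.1 n) ⁻¹' s) :=
      (by fun_prop : Measurable fun z : (ℕ → ℝ) × (ℕ → ℝ) => fun n => z.1 n) hs
    have h2 : MeasurableSet ((fun z : (ℕ → ℝ) × (ℕ → ℝ) => fun n => z.2 n) ⁻¹' t) :=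
      (by fun_prop : Measurable fun z : (ℕ → ℝ) × (ℕ → ℝ) => fun n => z.2 n) ht
    rw [Measure.map_apply M.measurable_claimData (h1.inter h2),
      Measure.map_apply M.measurable_claimData h1, Measure.map_apply M.measurable_claimData h2]
    exact (indepFun_iff_measure_inter_preimage_eq_mul.1 M.indep_W_U) s t hs ht

variable {M : RiskModel μ} {A B : Set ℝ} {x : ℝ}

instance : IsProbabilityMeasure (μ.map M.claimData) :=
  Measure.isProbabilityMeasure_map M.measurable_claimData.aemeasurable

theorem isRegular_claimData {ω : Ω} : M.canonical.IsRegular (M.claimData ω) ↔ M.IsRegular ω :=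
  ⟨fun h => ⟨h.1, h.2, h.3⟩, fun h => ⟨h.1, h.2, h.3⟩⟩

theorem bandL_claimData (t : ℝ) (ω : Ω) :
    M.canonical.bandL A B x t (M.claimData ω) = M.bandL A B x t ω := by
  by_cases h : M.IsRegular ω
  · rw [bandL, bandL, if_pos h, if_pos (isRegular_claimData.2 h)]
    rfl
  · rw [bandL, bandL, if_neg h, if_neg (mt isRegular_claimData.1 h)]

theorem IsBandPartition.canonical (hp : M.IsBandPartition A B) : M.canonical.IsBandPartition A B :=
  ⟨hp.critical_mem, hp.isClosed, hp.critical_le, hp.isOpen, hp.critical_lt, hp.disjoint,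
    hp.right_open, hp.nearest⟩

/-- The dividends of the band strategy up to time `t` are a measurable function of the aggregate
claims up to time `t`. -/
theorem exists_measurable_bandL_eq (hp : M.IsBandPartition A B) {t : ℝ} (ht : 0 ≤ t) {D : Set ℝ}
    (hD : MeasurableSet D) :
    ∃ E : Set (Option {q : ℚ // (q : ℝ) ∈ Icc 0 t} → ℝ), MeasurableSet E ∧
      ∀ ω, M.IsRegular ω → (M.bandL A B x t ω ∈ D ↔ (fun o : Option {q : ℚ // (q : ℝ) ∈ Icc 0 t} =>
        M.aggregateClaims (o.elim t fun q => (q : ℚ)) ω) ∈ E) := by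
  -- `Ω` is arbitrary, while the argument needs a standard Borel space; the regular sequences of
  -- waiting times and claim sizes form one.
  set G := {z | M.canonical.IsRegular z} with hG
  have hGm : MeasurableSet G := measurableSet_isRegular _
  have := hGm.standardBorel
  set y : G → Option {q : ℚ // (q : ℝ) ∈ Icc 0 t} → ℝ := fun z o =>
    M.canonical.aggregateClaims (o.elim t fun q => (q : ℚ)) z with hy
  have hym : Measurable y := measurable_pi_lambda _ fun o =>
    (M.canonical.measurable_aggregateClaims _).comp measurable_subtype_coe
  set F : Set G := {z | M.canonical.bandL A B x t z ∈ D} with hF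
  have hFm : MeasurableSet F :=
    ((measurable_bandL hp.canonical t).comp measurable_subtype_coe) hD
  -- Sequences with the same observed claims up to `t` lead to the same dividends, so the set is a
  -- union of fibres of the observation map.
  have hsat : F = y ⁻¹' (y '' F) := by
    refine (subset_preimage_image y F).antisymm ?_
    rintro z ⟨z', hz', he⟩
    have key := (isClaimPath_band (x := x) hp.canonical z.2).eq_of_strictBandRule hp.canonical
      (isClaimPath_band (x := x) hp.canonical z'.2)
      (fun t ht => strictBandRule_band hp.canonical z.2 ht)
      (fun t ht => strictBandRule_band hp.canonical z'.2 ht) (T := t)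
      (fun s hs => IsRegular.aggregateClaims_eq_of_dense z.2 z'.2
        (congrFun he none).symm (fun q hq => (congrFun he (some ⟨q, hq⟩)).symm) hs) t ⟨ht, le_rfl⟩
    simp only [hF, mem_ofPred_eq] at hz' ⊢
    rwa [key.2]
  -- A Borel union of fibres of a Borel map on a standard Borel space comes from a Borel set of the
  -- range, although images of Borel sets need not be Borel.
  rw [hsat, hym.measurableSet_preimage_iff_preimage_val] at hFm
  obtain ⟨E, hE, hEF⟩ := hFm
  refine ⟨E, hE, fun ω hω => ?_⟩
  have hz : M.claimData ω ∈ G := isRegular_claimData.2 hω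
  have e1 : (⟨M.claimData ω, hz⟩ : G) ∈ F ↔ M.bandL A B x t ω ∈ D := by
    rw [← bandL_claimData]; rfl
  have e2 := Set.ext_iff.1 hEF ⟨y ⟨M.claimData ω, hz⟩, mem_range_self _⟩
  rw [← e1, hsat]
  exact e2.symm

end

section

variable {Ω : Type*} [MeasurableSpace Ω] {μ : Measure Ω} [IsProbabilityMeasure μ] [μ.IsComplete]
  {M : RiskModel μ} {A B : Set ℝ} {x : ℝ}

theorem measurable_filtration_bandL (hp : M.IsBandPartition A B) (t : ℝ≥0) :
    Measurable[M.filtration t] (M.bandL A B x t) := by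
  intro D hD
  obtain ⟨E, hE, hiff⟩ := exists_measurable_bandL_eq (x := x) hp t.2 hD
  have hreg := M.measurableSet_filtration_of_ae t M.ae_isRegular
  have hY : Measurable[M.filtration t] fun ω (o : Option {q : ℚ // (q : ℝ) ∈ Icc (0 : ℝ) t}) =>
      M.aggregateClaims (o.elim (t : ℝ) fun q => (q : ℚ)) ω := by
    refine @measurable_pi_lambda _ _ _ (M.filtration t) _ _ fun o => ?_
    cases o with
    | none => exact M.measurable_filtration_aggregateClaims le_rfl
    | some q =>
      exact M.measurable_filtration_aggregateClaims (s := ⟨(q : ℚ), q.2.1⟩) q.2.2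
  have hnull := M.measurableSet_filtration_of_null t
    (N := M.bandL A B x t ⁻¹' D ∩ {ω | M.IsRegular ω}ᶜ)
    (measure_mono_null inter_subset_right M.ae_isRegular)
  -- The irregular scenarios are null, and the augmented filtration contains every subset of them.
  have e : M.bandL A B x t ⁻¹' D = ((fun ω (o : Option {q : ℚ // (q : ℝ) ∈ Icc (0 : ℝ) t}) =>
      M.aggregateClaims (o.elim (t : ℝ) fun q => (q : ℚ)) ω) ⁻¹' E ∩ {ω | M.IsRegular ω}) ∪
      (M.bandL A B x t ⁻¹' D ∩ {ω | M.IsRegular ω}ᶜ) := by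
    ext ω
    by_cases h : M.IsRegular ω
    · simpa [h] using! hiff ω h
    · simp [h]
  rw [e]
  exact @MeasurableSet.union _ (M.filtration t) _ _
    (@MeasurableSet.inter _ (M.filtration t) _ _ (hY hE) hreg) hnull

variable (M x) in
/-- The band strategy of a partition into bands. -/
noncomputable def bandStrategy (hp : M.IsBandPartition A B) : M.Strategy x where
  L := M.bandL A B x
  R := M.bandR A B x
  predictable := by
    refine Measurable.stronglyMeasurable ?_
    refine Filtration.measurable_predictable_of_tendsto_left
      (X := fun t => M.bandL A B x t) (fun t => measurable_filtration_bandL hp t) ?_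
      fun ω t ht => ?_
    · have : (fun ω => M.bandL A B x ((0 : ℝ≥0) : ℝ) ω) = fun _ => 0 :=
        funext fun ω => bandL_of_nonpos le_rfl
      change Measurable[M.filtration 0] fun ω => M.bandL A B x ((0 : ℝ≥0) : ℝ) ω
      rw [this]
      exact measurable_const
    · refine ((leftCont_bandL ω t).mono_left (nhdsWithin_mono _ Iio_subset_Iic_self)).comp
        (tendsto_nhdsWithin_iff.2 ⟨?_, ?_⟩)
      · exact (NNReal.continuous_coe.tendsto t).mono_left nhdsWithin_le_nhds
      · filter_upwards [self_mem_nhdsWithin] with s hs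
        exact NNReal.coe_lt_coe.2 hs
  mono := monotone_bandL hp
  leftCont := leftCont_bandL
  eq_zero ω t ht := bandL_of_nonpos ht
  dynamics := by
    filter_upwards [M.ae_isRegular] with ω h t ht
    exact ⟨(isClaimPath_band hp h).integrable t ht, (isClaimPath_band hp h).dyn t ht⟩
  no_ruin := by
    filter_upwards [M.ae_isRegular] with ω h t ht _
    exact (isClaimPath_band (x := x) hp h).rightLim_sub_le hp ht (strictBandRule_band hp h ht)

end

end RiskModel

/-! ### Identification of the value function and of its bands. -/

namespace RiskModel

section

variable {Ω : Type*} [MeasurableSpace Ω] {μ : Measure Ω} [IsProbabilityMeasure μ] [μ.IsComplete]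
  (M : RiskModel μ)

theorem payoff_bandStrategy (x : ℝ) :
    (M.bandStrategy x M.isBandPartition_minSuper).payoff = ENNReal.ofReal (M.minSuper x) := by
  refine (M.bandStrategy x M.isBandPartition_minSuper).payoff_eq_of_bandRule ?_
  filter_upwards [M.ae_isRegular] with ω h t ht
  exact (strictBandRule_band M.isBandPartition_minSuper h ht).1

theorem value_eq (x : ℝ) : M.value x = ENNReal.ofReal (M.minSuper x) :=
  le_antisymm (iSup_le fun S => S.payoff_le)
    ((M.payoff_bandStrategy x).ge.trans (le_iSup (fun S : M.Strategy x => S.payoff) _))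

theorem V_eq_minSuper : M.V = M.minSuper := by
  ext x
  rw [V, value_eq, ENNReal.toReal_ofReal (M.isSuper_minSuper.nonneg x)]

/-- The integral over claims up to `x - critical` may be extended to all claims, since the value
vanishes at and below the critical level. -/
theorem GV_eq (x : ℝ) : M.GV x = M.generator M.minSuper x := by
  have : ∫ y in Icc 0 (x - M.critical), M.minSuper (x - y) ∂M.claimLaw =
      M.afterClaim M.minSuper x := by
    rw [← integral_indicator measurableSet_Icc]
    refine integral_congr_ae ?_
    filter_upwards [M.ae_claimLaw_nonneg] with u hu
    by_cases h : u ∈ Icc 0 (x - M.critical)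
    · rw [indicator_of_mem h]
    · rw [indicator_of_notMem h, M.isSuper_minSuper.zero]
      have : ¬ u ≤ x - M.critical := fun h' => h ⟨hu, h'⟩
      linarith
  rw [GV, V_eq_minSuper, this, generator]

theorem setA_eq : M.setA = M.bandA M.minSuper := by
  simp only [setA, bandA, GV_eq]

theorem setB_eq : M.setB = M.bandB M.minSuper := by
  simp only [setB, bandB, GV_eq, V_eq_minSuper]

variable {M} {x : ℝ}

theorem Strategy.isBand_iff (S : M.Strategy x) : S.IsBand ↔ ∀ᵐ ω ∂μ, ∀ t, 0 ≤ t →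
    M.BandRule (M.bandA M.minSuper) (M.bandB M.minSuper) (fun t => S.R t ω) (fun t => S.L t ω) t := by
  simp only [IsBand, BandRule, setC, setA_eq, setB_eq, mem_ofPred_eq]

end

end RiskModel

theorem theorem4p2 {Ω : Type*} [MeasurableSpace Ω] (μ : Measure Ω) [IsProbabilityMeasure μ]
    [μ.IsComplete] (M : RiskModel μ) (x : ℝ) (hx : -(M.p / M.α) ≤ x) :
    M.value x < ∞ ∧
    (∃ S : M.Strategy x, S.IsBand) ∧
    ∀ S : M.Strategy x, S.IsBand → S.payoff = M.value x := by
  rw [M.value_eq]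
  refine ⟨ENNReal.ofReal_lt_top, ⟨M.bandStrategy x M.isBandPartition_minSuper, ?_⟩,
    fun S hS => S.payoff_eq_of_bandRule (S.isBand_iff.1 hS)⟩
  rw [RiskModel.Strategy.isBand_iff]
  filter_upwards [M.ae_isRegular] with ω h t ht
  exact (RiskModel.strictBandRule_band M.isBandPartition_minSuper h ht).1
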